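/- All strings are binary, $\lambda$ is the security parameter, "efficient" means probabilistic polynomial time in $\lambda$, $\mathrm{wt}$ is Hamming weight, and $\|$ is concatenation. **Setting.** Let $\delta\ge 0$ be a real constant. Let $\mathsf{PRC}=(\mathsf{KeyGen},\mathsf{Encode},\mathsf{Decode})$ be a triple of polynomial-time randomized algorithms: $\mathsf{KeyGen}(1^\lambda)$ outputs a pair $(\mathsf{pk},\mathsf{sk})$ of keys of fixed lengths, $\mathsf{Encode}(\mathsf{pk},w;\rho)\in\{0,1\}^{n(\lambda)}$ for messages $w\in\{0,1\}^{K(\lambda)}$ and coins $\rho\in\{0,1\}^{\ell(\lambda)}$, and $\mathsf{Decode}(\mathsf{sk},x)\in\{0,1\}^{K(\lambda)}\cup\{\bot\}$ for every string $x$. All length functions here and below, and $\lambda\mapsto\lfloor\delta n(\lambda)\rfloor$, are computable in time polynomial in $\lambda$ (with output in unary). Assume: * (*Pseudorandomness.*) No efficient adversary that is given $1^\lambda$ and $\mathsf{pk}$ distinguishes, with non-negligible advantage, the oracle $\mathsf{Encode}(\mathsf{pk},\cdot)$ (fresh coins for each query) from an oracle that answers each query with a fresh uniform string in $\{0,1\}^{n(\lambda)}$.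 * (*Public-key adaptive $\delta$-robustness.*) For every efficient adversary that on input $(1^\lambda,\mathsf{pk})$ outputs $(w,\rho,x)$, the probability that $\mathrm{wt}(x\oplus \mathsf{Encode}(\mathsf{pk},w;\rho))\le\delta n$ and $\mathsf{Decode}(\mathsf{sk},x)\ne w$ is negligible. **The scheme.** Let $K(\lambda)=\lambda+k(\lambda)+t(\lambda)$ with $t(\lambda)\ge\lambda$, and let $H:\{0,1\}^{\lambda+k}\to\{0,1\}^{\ell+t}$ be a uniformly random function (the random oracle), to which all parties have oracle access. Define $\mathsf{PRC}^{\mathsf{CCA}}$ as follows. * Key generation is that of $\mathsf{PRC}$. The public key is $\mathsf{pk}$ together with $H$; the decoder holds $\mathsf{sk}$, $\mathsf{pk}$ and $H$. * To encode $m\in\{0,1\}^{k}$, sample $r\leftarrow\{0,1\}^\lambda$, write $H(r\|m)=(R_1,R_2)$ with $|R_1|=\ell$ and $|R_2|=t$, and output $\mathsf{Encode}(\mathsf{pk},r\|m\|R_2;R_1)$. * To decode $x$, compute $\mathsf{Decode}(\mathsf{sk},x)$. If it is $\bot$, output $\bot$. Otherwise parse it as $r\|m\|R_2$ and let $(R_1,\tilde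 R_2)=H(r\|m)$. If $\tilde R_2=R_2$, $|x|=n$ and $\mathrm{wt}(\mathsf{Encode}(\mathsf{pk},r\|m\|R_2;R_1)\oplus x)\le\delta n$, output $m$; otherwise output $\bot$. **The CCA game.** For $b\in\{0,1\}$, the game $\mathcal G_b$ samples keys and $H$ and gives $\mathsf{pk}$ to an adversary, which adaptively makes random oracle queries (answered by $H$), encoding queries $m\in\{0,1\}^k$ and decoding queries $x\in\{0,1\}^*$, and finally outputs a bit. In $\mathcal G_0$, encoding and decoding queries are answered by the encoder and the decoder of $\mathsf{PRC}^{\mathsf{CCA}}$. In $\mathcal G_1$, an encoding query $m$ is answered by a fresh uniform $c\in\{0,1\}^n$, and $(m,c)$ is added to a transcript. A decoding query $x$ is answered by a uniformly random element of the set of messages $m$ for which some $(m,c)$ in the transcript satisfies $|x|=n$ and $\mathrm{wt}(c\oplus x)\le\delta n$; if there is none, it is answered by the decoder of $\mathsf{PRC}^{\mathsf{CCA}}$. **Theorem.** $\mathsf{PRC}^{\mathsf{CCA}}$ is $\delta$-CCA secure in the random oracle model: for every efficient adversary $\mathcal A$, the quantity $\bigl|\Pr[\mathcal A\text{ outputs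 }1\text{ in }\mathcal G_0]-\Pr[\mathcal A\text{ outputs }1\text{ in }\mathcal G_1]\bigr|$ is negligible in $\lambda$. -/

import Mathlib

noncomputable section

/-! ### A machine model with a step count, and polynomial time

Programs work on registers, each holding a bit string that is used as a stack. The basic
instructions take one step each (copying a register takes one step per bit), so this is a
multi-stack (equivalently, up to a polynomial, a multi-tape) Turing machine in structured form. -/

/-- Programs over bit-string registers indexed by `ℕ` (every program mentions finitely many). -/
inductive Prog : Type
  | skip : Prog
  | push (x : ℕ) (b : Bool) : Prog
  | pop (x : ℕ) : Prog
  | copy (x y : ℕ) : Prog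
  | seq (p q : Prog) : Prog
  | branch (x : ℕ) (pNil pFalse pTrue : Prog) : Prog
  | loop (x : ℕ) (p : Prog) : Prog

/-- `Runs p s t s'`: the program `p`, started on the registers `s`, halts after exactly `t` steps
and leaves the registers `s'`. -/
inductive Runs : Prog → (ℕ → List Bool) → ℕ → (ℕ → List Bool) → Prop
  | skip (s : ℕ → List Bool) : Runs Prog.skip s 1 s
  | push (s : ℕ → List Bool) (x : ℕ) (b : Bool) :
      Runs (Prog.push x b) s 1 (Function.update s x (b :: s x))
  | pop (s : ℕ → List Bool) (x : ℕ) :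
      Runs (Prog.pop x) s 1 (Function.update s x (s x).tail)
  | copy (s : ℕ → List Bool) (x y : ℕ) :
      Runs (Prog.copy x y) s ((s y).length + 1) (Function.update s x (s y))
  | seq {p q : Prog} {s s' s'' : ℕ → List Bool} {t t' : ℕ} :
      Runs p s t s' → Runs q s' t' s'' → Runs (Prog.seq p q) s (t + t') s''
  | branchNil {x : ℕ} {p₀ p₁ p₂ : Prog} {s s' : ℕ → List Bool} {t : ℕ} :
      s x = [] → Runs p₀ s t s' → Runs (Prog.branch x p₀ p₁ p₂) s (t + 1) s'
  | branchFalse {x : ℕ} {p₀ p₁ p₂ : Prog} {s s' : ℕ → List Bool} {t : ℕ} {w : List Bool} :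
      s x = false :: w → Runs p₁ s t s' → Runs (Prog.branch x p₀ p₁ p₂) s (t + 1) s'
  | branchTrue {x : ℕ} {p₀ p₁ p₂ : Prog} {s s' : ℕ → List Bool} {t : ℕ} {w : List Bool} :
      s x = true :: w → Runs p₂ s t s' → Runs (Prog.branch x p₀ p₁ p₂) s (t + 1) s'
  | loopNil {x : ℕ} {p : Prog} {s : ℕ → List Bool} :
      s x = [] → Runs (Prog.loop x p) s 1 s
  | loopCons {x : ℕ} {p : Prog} {s s' s'' : ℕ → List Bool} {t t' : ℕ} :
      s x ≠ [] → Runs p s t s' → Runs (Prog.loop x p) s' t' s'' →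
        Runs (Prog.loop x p) s (t + t' + 1) s''

/-- Self-delimiting encoding of a tuple of strings: each bit `b` becomes `1b`, and every string is
ended by `0`. -/
def encodeTuple (v : List (List Bool)) : List Bool :=
  v.flatMap fun s => (s.flatMap fun b => [true, b]) ++ [false]

/-- `1^n`. -/
def unary (n : ℕ) : List Bool := List.replicate n true

/-- The map from `inp a` to `out a` is computed in time polynomial in the input length: a single
program, started with the encoded tuple `inp a` in register `0` and all other registers empty,
halts with `out a` in register `1` within polynomially many steps. -/
def PolyTime {α : Type} (inp : α → List (List Bool)) (out : α → List Bool) : Prop :=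
  ∃ (p : Prog) (T : Polynomial ℕ), ∀ a : α, ∃ (t : ℕ) (s : ℕ → List Bool),
    Runs p (Function.update (fun _ => []) 0 (encodeTuple (inp a))) t s ∧
      s 1 = out a ∧ t ≤ T.eval (encodeTuple (inp a)).length

/-- A length function that is computable in polynomial time, `1^lam ↦ 1^(ℓ lam)`; in particular
`ℓ` is polynomially bounded. -/
def LengthComputable (ℓ : ℕ → ℕ) : Prop :=
  PolyTime (fun lam : ℕ => [unary lam]) (fun lam => unary (ℓ lam))

/-- Negligible functions of the security parameter. -/
def Negligible (f : ℕ → ℝ) : Prop :=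
  Asymptotics.SuperpolynomialDecay Filter.atTop (fun lam : ℕ => (lam : ℝ)) f

/-- A uniformly random string in `{0,1}^n`. -/
def randomBits (n : ℕ) : PMF (List Bool) :=
  (PMF.uniformOfFintype (Fin n → Bool)).map List.ofFn

/-- `c` and `x` are strings of length `n` with `wt(c ⊕ x) ≤ δ n`. -/
def Close (δ : ℝ) (n : ℕ) (c x : List Bool) : Prop :=
  c.length = n ∧ x.length = n ∧ (((List.zipWith xor c x).count true : ℕ) : ℝ) ≤ δ * n

/-- The answer `⊥` or `m` of a decoder, as a bit string. -/
def answerString : Option (List Bool) → List Bool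
  | none => []
  | some m => true :: m

/-! ### Efficient adversaries -/

/-- An adversary with oracle access, given by its next-message function: from the security
parameter, its random coins, the public key and the oracle answers received so far, `next`
computes the next message. The numbers of coins and of rounds are polynomial. (Earlier
queries are determined by these data.) -/
structure OracleAdversary where
  coinLen : Polynomial ℕ
  rounds : Polynomial ℕ
  next : ℕ → List Bool → List Bool → List (List Bool) → List Bool
  /-- `next` runs in polynomial time. -/
  efficient : PolyTime
    (fun a : ℕ × List Bool × List Bool × List (List Bool) =>
      unary a.1 :: a.2.1 :: a.2.2.1 :: a.2.2.2)
    (fun a => next a.1 a.2.1 a.2.2.1 a.2.2.2)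

/-- Runs a next-message function against a stateful randomized oracle. A message of length at most
one is the final output (the empty one counts as `0`); a longer message `b b' q` is the oracle
query `q` of kind `(b, b')`. The arguments are the number of rounds left, the answers so far
and the state of the oracle. An adversary that runs out of rounds outputs `0`. -/
def interact {S : Type} (oracle : Bool × Bool → List Bool → S → PMF (List Bool × S))
    (next : List (List Bool) → List Bool) : ℕ → List (List Bool) → S → PMF Bool
  | 0, _, _ => PMF.pure false
  | k + 1, answers, st =>
    match next answers with
    | [] => PMF.pure false
    | [b] => PMF.pure b
    | b :: b' :: q =>
      (oracle (b, b') q st).bind fun r => interact oracle next k (answers ++ [r.1]) r.2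

/-- A polynomial-time adversary that receives a public key and outputs a triple of strings. -/
structure TripleAdversary where
  coinLen : Polynomial ℕ
  out : ℕ → List Bool → List Bool → List Bool × List Bool × List Bool
  efficient : PolyTime
    (fun a : ℕ × List Bool × List Bool => [unary a.1, a.2.1, a.2.2])
    (fun a => encodeTuple [(out a.1 a.2.1 a.2.2).1, (out a.1 a.2.1 a.2.2).2.1,
      (out a.1 a.2.1 a.2.2).2.2])

/-! ### Public-key pseudorandom codes -/

/-- The syntax of a public-key code over the binary alphabet. Randomized algorithms take their
coins as the last argument; `keyGen` returns the pair (public key, secret key). -/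
structure PRC where
  pkLen : ℕ → ℕ
  skLen : ℕ → ℕ
  msgLen : ℕ → ℕ
  codeLen : ℕ → ℕ
  keyCoins : ℕ → ℕ
  encCoins : ℕ → ℕ
  decCoins : ℕ → ℕ
  keyGen : ℕ → List Bool → List Bool × List Bool
  encode : ℕ → List Bool → List Bool → List Bool → List Bool
  decode : ℕ → List Bool → List Bool → List Bool → Option (List Bool)
  keyGen_length : ∀ (lam : ℕ) (r : List Bool), r.length = keyCoins lam →
    (keyGen lam r).1.length = pkLen lam ∧ (keyGen lam r).2.length = skLen lam
  encode_length : ∀ (lam : ℕ) (pk m r : List Bool), pk.length = pkLen lam →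
    m.length = msgLen lam → r.length = encCoins lam →
    (encode lam pk m r).length = codeLen lam
  decode_length : ∀ (lam : ℕ) (sk x r m : List Bool), sk.length = skLen lam →
    r.length = decCoins lam → decode lam sk x r = some m → m.length = msgLen lam

namespace PRC

/-- The three algorithms, and the lengths in the syntax, are computable in polynomial time. -/
structure Efficient (P : PRC) : Prop where
  keyGen : PolyTime (fun a : ℕ × List Bool => [unary a.1, a.2])
    (fun a => encodeTuple [(P.keyGen a.1 a.2).1, (P.keyGen a.1 a.2).2])
  encode : PolyTime
    (fun a : ℕ × List Bool × List Bool × List Bool => [unary a.1, a.2.1, a.2.2.1, a.2.2.2])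
    (fun a => P.encode a.1 a.2.1 a.2.2.1 a.2.2.2)
  decode : PolyTime
    (fun a : ℕ × List Bool × List Bool × List Bool => [unary a.1, a.2.1, a.2.2.1, a.2.2.2])
    (fun a => answerString (P.decode a.1 a.2.1 a.2.2.1 a.2.2.2))
  pkLen : LengthComputable P.pkLen
  skLen : LengthComputable P.skLen
  msgLen : LengthComputable P.msgLen
  codeLen : LengthComputable P.codeLen
  keyCoins : LengthComputable P.keyCoins
  encCoins : LengthComputable P.encCoins
  decCoins : LengthComputable P.decCoins

/-- A random key pair `(pk, sk)`. -/
def keys (P : PRC) (lam : ℕ) : PMF (List Bool × List Bool) :=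
  (randomBits (P.keyCoins lam)).map (P.keyGen lam)

/-- The encoding oracle (`random = false`) or the oracle that answers every message with a fresh
uniform string (`random = true`). Strings that are not messages get the empty answer. -/
def encodingOracle (P : PRC) (lam : ℕ) (random : Bool) (pk : List Bool) :
    Bool × Bool → List Bool → Unit → PMF (List Bool × Unit) := fun _ m _ =>
  if m.length = P.msgLen lam then
    if random then (randomBits (P.codeLen lam)).map fun c => (c, ())
    else (randomBits (P.encCoins lam)).map fun r => (P.encode lam pk m r, ())
  else PMF.pure ([], ())

/-- The pseudorandomness experiment. -/
def pseudorandomGame (P : PRC) (A : OracleAdversary) (lam : ℕ) (random : Bool) : PMF Bool :=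
  (P.keys lam).bind fun k =>
  (randomBits (A.coinLen.eval lam)).bind fun coins =>
  interact (P.encodingOracle lam random k.1) (A.next lam coins k.1) (A.rounds.eval lam) [] ()

/-- Pseudorandomness of a public-key code. -/
def Pseudorandom (P : PRC) : Prop :=
  ∀ A : OracleAdversary, Negligible fun lam =>
    |(P.pseudorandomGame A lam false true).toReal - (P.pseudorandomGame A lam true true).toReal|

open Classical in
/-- The public-key robustness game: the adversary, given `pk`, sends `(m, r, x)`; it wins if `x` is
`δ`-close to `c = Encode(pk, m; r)` but does not decode to `m`. -/
def robustGame (P : PRC) (δ : ℝ) (A : TripleAdversary) (lam : ℕ) : PMF Bool :=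
  (P.keys lam).bind fun k =>
  (randomBits (A.coinLen.eval lam)).bind fun coins =>
  (randomBits (P.decCoins lam)).map fun d =>
    let m := (A.out lam coins k.1).1
    let r := (A.out lam coins k.1).2.1
    let x := (A.out lam coins k.1).2.2
    decide (m.length = P.msgLen lam ∧ r.length = P.encCoins lam ∧
      Close δ (P.codeLen lam) (P.encode lam k.1 m r) x ∧ P.decode lam k.2 x d ≠ some m)

/-- Public-key adaptive `δ`-robustness. -/
def AdaptivelyRobust (P : PRC) (δ : ℝ) : Prop :=
  ∀ A : TripleAdversary, Negligible fun lam => (P.robustGame δ A lam true).toReal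

end PRC

/-! ### CCA security in the random oracle model -/

/-- A public-key code in the random oracle model, with hash function
`H : {0,1}^(hashIn lam) → {0,1}^(hashOut lam)`. Encoding and decoding may query `H`; the decoder
holds both keys. -/
structure ROCode where
  hashIn : ℕ → ℕ
  hashOut : ℕ → ℕ
  msgLen : ℕ → ℕ
  codeLen : ℕ → ℕ
  keyGen : ℕ → PMF (List Bool × List Bool)
  encode : ℕ → (List Bool → List Bool) → List Bool → List Bool → PMF (List Bool)
  decode : ℕ → (List Bool → List Bool) → List Bool → List Bool → List Bool →
    PMF (Option (List Bool))

/-- A function on `{0,1}^a` as a function on strings (strings of other lengths give the empty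
string). -/
def evalHash {a b : ℕ} (H : (Fin a → Bool) → (Fin b → Bool)) (u : List Bool) : List Bool :=
  if u.length = a then List.ofFn (H fun i => u.getD i false) else []

namespace ROCode

open Classical in
/-- The messages recorded in the transcript with a codeword that is `δ`-close to `x`. -/
def matching (δ : ℝ) (n : ℕ) (transcript : List (List Bool × List Bool)) (x : List Bool) :
    Finset (List Bool) :=
  (transcript.toFinset.filter fun p => Close δ n p.2 x).image Prod.fst

open Classical in
/-- The oracles of the CCA game in the real (`random = false`) and in the random
(`random = true`) world; the state is the transcript. Queries of kind `(0,0)` are encoding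
queries, of kind `(0,1)` decoding queries, of kind `(1,0)` or `(1,1)` random oracle queries. -/
def ccaOracle (C : ROCode) (δ : ℝ) (lam : ℕ) (random : Bool) (pk sk : List Bool)
    (H : List Bool → List Bool) :
    Bool × Bool → List Bool → List (List Bool × List Bool) →
      PMF (List Bool × List (List Bool × List Bool))
  | (false, false), m, tr =>
    if m.length = C.msgLen lam then
      if random then (randomBits (C.codeLen lam)).map fun c => (c, tr ++ [(m, c)])
      else (C.encode lam H pk m).map fun c => (c, tr)
    else PMF.pure ([], tr)
  | (false, true), x, tr =>
    if h : random = true ∧ (matching δ (C.codeLen lam) tr x).Nonempty then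
      (PMF.uniformOfFinset (matching δ (C.codeLen lam) tr x) h.2).map fun m =>
        (answerString (some m), tr)
    else (C.decode lam H pk sk x).map fun o => (answerString o, tr)
  | (true, _), u, tr => PMF.pure (H u, tr)

/-- The CCA game, with `H` a uniformly random function. -/
def ccaGame (C : ROCode) (δ : ℝ) (A : OracleAdversary) (lam : ℕ) (random : Bool) : PMF Bool :=
  (C.keyGen lam).bind fun k =>
  (PMF.uniformOfFintype
    ((Fin (C.hashIn lam) → Bool) → (Fin (C.hashOut lam) → Bool))).bind fun H =>
  (randomBits (A.coinLen.eval lam)).bind fun coins =>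
  interact (C.ccaOracle δ lam random k.1 k.2 (evalHash H)) (A.next lam coins k.1)
    (A.rounds.eval lam) [] []

/-- `δ`-CCA security in the random oracle model. -/
def CCASecure (C : ROCode) (δ : ℝ) : Prop :=
  ∀ A : OracleAdversary, Negligible fun lam =>
    |(C.ccaGame δ A lam false true).toReal - (C.ccaGame δ A lam true true).toReal|

end ROCode

namespace PRC

open Classical in
/-- The Fujisaki–Okamoto style scheme built from `P`, with messages of length `msgLen lam` and tags
of length `tagLen lam`. To encode `m`, sample `r ← {0,1}^lam`, split `H(r‖m) = (R₁, R₂)` and output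
`P.Encode(pk, r‖m‖R₂; R₁)`. To decode `x`, compute `r‖m‖R₂` with the decoder of `P`, split
`H(r‖m) = (R₁, R₂')`, and output `m` if `R₂' = R₂` and `P.Encode(pk, r‖m‖R₂; R₁)` is `δ`-close
to `x`; otherwise output `⊥`. -/
def cca (P : PRC) (δ : ℝ) (msgLen tagLen : ℕ → ℕ) : ROCode where
  hashIn lam := lam + msgLen lam
  hashOut lam := P.encCoins lam + tagLen lam
  msgLen := msgLen
  codeLen := P.codeLen
  keyGen := P.keys
  encode lam H pk m := (randomBits lam).map fun r =>
    P.encode lam pk (r ++ m ++ (H (r ++ m)).drop (P.encCoins lam))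
      ((H (r ++ m)).take (P.encCoins lam))
  decode lam H pk sk x := (randomBits (P.decCoins lam)).map fun d =>
    (P.decode lam sk x d).bind fun w =>
      let r := w.take lam
      let m := (w.drop lam).take (msgLen lam)
      let R₂ := w.drop (lam + msgLen lam)
      let h := H (r ++ m)
      if h.drop (P.encCoins lam) = R₂ ∧
          Close δ (P.codeLen lam)
            (P.encode lam pk (r ++ m ++ R₂) (h.take (P.encCoins lam))) x
      then some m else none

end PRC

end

/-! The decoder of the scheme accepts `x` only if re-encoding the decoded string, with coins taken
from the hash, lands close to `x`. Up to a small error it can therefore be replaced by a search,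
without the secret key, among the codewords already known: those returned by encoding queries and
those determined by hash queries. If no known codeword is close to `x`, acceptance means that the
tag part of an unsampled hash value was hit, which has probability `2^{-t}`. If exactly one is close
and its coins are known, a decoder that does not recover its plaintext loses the robustness game. If
two with known coins are close, the decoded string cannot equal both plaintexts, so one of them wins
that game.

The simulator `Cfg.step` plays the CCA game in this way, with a lazily sampled hash function. It
halts with `abortNonce` when the hash input of a ciphertext is repeated or queried, and with
`abortMatch` when two known codewords are close to a decoding query. The real and the random
simulation differ only in the codewords that answer encoding queries. The simulator never reads the
coins of these codewords (`erase_step`), so an oracle can supply them, and pseudorandomness makes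
the probability of each outcome negligibly different in the two worlds
(`pseudorandomGame_distinguisher`).

In each world the simulation outputs a bit `o` with at most the probability of the game plus a
negligible loss (`outcomeProb_ok_le`): aborting only lowers the left side. This comes from a hybrid
argument over the rounds (`gameProb_step`, `expect_run_le`), in which `gameProb` continues a
simulated state with the true game. Since the outcomes of the simulation have total probability one,
the bounds for both bits give a two-sided estimate once the aborts are negligible. Each abort is
bounded in the convenient world and carried to the other by pseudorandomness. In the random world
the answers to encoding queries do not depend on the nonces, so guessing or repeating one is
unlikely (`outcomeProb_abortNonce_le`). In the real world every known codeword is an encoding with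
known coins, so a double match breaks robustness (`outcomeProb_abortMatch_le`). The attack on
robustness guesses the round to use, at the cost of a factor `2q` for `q` rounds
(`expectedWins_le`). `PRC.cca_advantage_le` collects the losses.

The reductions must be efficient in the concrete machine model. For this a calculus of
polynomial-time functions is built from subroutine calls (`PT.call`), pairing and bounded iteration
(`PT.iterate`), and transferred to encoded types as `PF`. -/

noncomputable section

/-! ### Composing programs -/

/-- Bit strings. -/
abbrev Str : Type := List Bool

theorem Polynomial.eval_le_eval_of_le (T : Polynomial ℕ) {a b : ℕ} (h : a ≤ b) :
    T.eval a ≤ T.eval b := by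
  rw [Polynomial.eval_eq_sum_range, Polynomial.eval_eq_sum_range]
  exact Finset.sum_le_sum fun i _ => Nat.mul_le_mul_left _ (Nat.pow_le_pow_left h i)

namespace Prog

/-- All registers mentioned by the program are smaller than `B`. -/
def UsesBelow (B : ℕ) : Prog → Prop
  | skip => True
  | push x _ => x < B
  | pop x => x < B
  | copy x y => x < B ∧ y < B
  | seq p q => p.UsesBelow B ∧ q.UsesBelow B
  | branch x p q r => x < B ∧ p.UsesBelow B ∧ q.UsesBelow B ∧ r.UsesBelow B
  | loop x p => x < B ∧ p.UsesBelow B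

theorem UsesBelow.mono {B C : ℕ} (h : B ≤ C) : ∀ {p : Prog}, p.UsesBelow B → p.UsesBelow C
  | skip, _ => trivial
  | push _ _, hp => lt_of_lt_of_le hp h
  | pop _, hp => lt_of_lt_of_le hp h
  | copy _ _, hp => ⟨hp.1.trans_le h, hp.2.trans_le h⟩
  | seq _ _, hp => ⟨UsesBelow.mono h hp.1, UsesBelow.mono h hp.2⟩
  | branch _ _ _ _, hp => ⟨hp.1.trans_le h, UsesBelow.mono h hp.2.1, UsesBelow.mono h hp.2.2.1,
      UsesBelow.mono h hp.2.2.2⟩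
  | loop _ _, hp => ⟨hp.1.trans_le h, UsesBelow.mono h hp.2⟩

/-- A program mentions finitely many registers. The bound is at least `2` so that the input register
`0` and the output register `1` lie below it. -/
theorem exists_usesBelow : ∀ p : Prog, ∃ B, 2 ≤ B ∧ p.UsesBelow B
  | skip => ⟨2, le_rfl, trivial⟩
  | push x _ => ⟨x + 2, by omega, show x < x + 2 by omega⟩
  | pop x => ⟨x + 2, by omega, show x < x + 2 by omega⟩
  | copy x y => ⟨x + y + 2, by omega, show x < x + y + 2 by omega, show y < x + y + 2 by omega⟩
  | seq p q => by
    obtain ⟨B, hB, hp⟩ := exists_usesBelow p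
    obtain ⟨C, hC, hq⟩ := exists_usesBelow q
    exact ⟨B + C, by omega, hp.mono (by omega), hq.mono (by omega)⟩
  | branch x p q r => by
    obtain ⟨B, hB, hp⟩ := exists_usesBelow p
    obtain ⟨C, hC, hq⟩ := exists_usesBelow q
    obtain ⟨D, hD, hr⟩ := exists_usesBelow r
    exact ⟨x + B + C + D, by omega, show x < _ by omega, hp.mono (by omega), hq.mono (by omega),
      hr.mono (by omega)⟩
  | loop x p => by
    obtain ⟨B, hB, hp⟩ := exists_usesBelow p
    exact ⟨x + B, by omega, show x < _ by omega, hp.mono (by omega)⟩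

/-- The program with all registers moved up by `k`. -/
def shift (k : ℕ) : Prog → Prog
  | skip => skip
  | push x b => push (k + x) b
  | pop x => pop (k + x)
  | copy x y => copy (k + x) (k + y)
  | seq p q => seq (p.shift k) (q.shift k)
  | branch x p q r => branch (k + x) (p.shift k) (q.shift k) (r.shift k)
  | loop x p => loop (k + x) (p.shift k)

/-- Empties the registers `k, …, k + B - 1`, if `z` is empty. -/
def clear (k z : ℕ) : ℕ → Prog
  | 0 => skip
  | B + 1 => seq (clear k z B) (copy (k + B) z)

end Prog

/-- A run sees only registers below `B`, so agreement there suffices and leftovers further up are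
harmless. The registers below `k` belong to the caller and survive. -/
theorem Runs.shift {p : Prog} {s s' : ℕ → Str} {t : ℕ} (h : Runs p s t s') (k : ℕ) {B : ℕ} :
    p.UsesBelow B → ∀ σ : ℕ → Str, (∀ x < B, σ (k + x) = s x) →
      ∃ σ', Runs (p.shift k) σ t σ' ∧ (∀ x < B, σ' (k + x) = s' x) ∧ ∀ y < k, σ' y = σ y := by
  induction h with
  | skip s => exact fun _ σ h => ⟨σ, .skip _, h, fun _ _ => rfl⟩
  | push s x b =>
    intro hB σ h
    refine ⟨_, .push _ _ _, fun y hy => ?_, fun y hy => ?_⟩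
    · by_cases hxy : y = x
      · subst hxy; simp [h y hy]
      · simp [hxy, h y hy]
    · rw [Function.update_of_ne (by omega)]
  | pop s x =>
    intro hB σ h
    refine ⟨_, .pop _ _, fun y hy => ?_, fun y hy => ?_⟩
    · by_cases hxy : y = x
      · subst hxy; simp [h y hy]
      · simp [hxy, h y hy]
    · rw [Function.update_of_ne (by omega)]
  | copy s x z =>
    intro hB σ h
    refine ⟨_, h z hB.2 ▸ Runs.copy σ (k + x) (k + z), fun y hy => ?_, fun y hy => ?_⟩
    · by_cases hxy : y = x
      · subst hxy; simp
      · simp [hxy, h y hy]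
    · rw [Function.update_of_ne (by omega)]
  | seq _ _ ih₁ ih₂ =>
    intro hB σ h
    obtain ⟨σ₁, r₁, h₁, f₁⟩ := ih₁ hB.1 σ h
    obtain ⟨σ₂, r₂, h₂, f₂⟩ := ih₂ hB.2 σ₁ h₁
    exact ⟨σ₂, .seq r₁ r₂, h₂, fun y hy => (f₂ y hy).trans (f₁ y hy)⟩
  | branchNil hx _ ih =>
    intro hB σ h
    obtain ⟨σ₁, r₁, h₁, f₁⟩ := ih hB.2.1 σ h
    exact ⟨σ₁, .branchNil ((h _ hB.1).trans hx) r₁, h₁, f₁⟩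
  | branchFalse hx _ ih =>
    intro hB σ h
    obtain ⟨σ₁, r₁, h₁, f₁⟩ := ih hB.2.2.1 σ h
    exact ⟨σ₁, .branchFalse ((h _ hB.1).trans hx) r₁, h₁, f₁⟩
  | branchTrue hx _ ih =>
    intro hB σ h
    obtain ⟨σ₁, r₁, h₁, f₁⟩ := ih hB.2.2.2 σ h
    exact ⟨σ₁, .branchTrue ((h _ hB.1).trans hx) r₁, h₁, f₁⟩
  | loopNil hx => exact fun hB σ h => ⟨σ, .loopNil ((h _ hB.1).trans hx), h, fun _ _ => rfl⟩
  | loopCons hx _ _ ih₁ ih₂ =>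
    intro hB σ h
    obtain ⟨σ₁, r₁, h₁, f₁⟩ := ih₁ hB.2 σ h
    obtain ⟨σ₂, r₂, h₂, f₂⟩ := ih₂ hB σ₁ h₁
    exact ⟨σ₂, .loopCons (by rwa [h _ hB.1]) r₁ r₂, h₂, fun y hy => (f₂ y hy).trans (f₁ y hy)⟩

/-- A step lengthens the longest register by at most one bit, and `copy` does not lengthen it at
all. Running time thus bounds the length of the output, which composition needs. -/
theorem Runs.length_le {p : Prog} {s s' : ℕ → Str} {t : ℕ} (h : Runs p s t s') :
    ∀ {M : ℕ}, (∀ y, (s y).length ≤ M) → ∀ x, (s' x).length ≤ M + t := by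
  induction h with
  | skip => exact fun h x => (h x).trans (by omega)
  | push s x b =>
    intro M h y
    by_cases hxy : y = x
    · subst hxy; simpa using h y
    · simpa [hxy] using (h y).trans (by omega)
  | pop s x =>
    intro M h y
    have := h y
    by_cases hxy : y = x
    · subst hxy; simp; omega
    · simp [hxy]; omega
  | copy s x z =>
    intro M h y
    have := h y
    have := h z
    by_cases hxy : y = x
    · subst hxy; simp; omega
    · simp [hxy]; omega
  | seq _ _ ih₁ ih₂ => exact fun h x => (ih₂ (ih₁ h) x).trans (by omega)
  | branchNil _ _ ih => exact fun h x => (ih h x).trans (by omega)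
  | branchFalse _ _ ih => exact fun h x => (ih h x).trans (by omega)
  | branchTrue _ _ ih => exact fun h x => (ih h x).trans (by omega)
  | loopNil => exact fun h x => (h x).trans (by omega)
  | loopCons _ _ _ ih₁ ih₂ => exact fun h x => (ih₂ (ih₁ h) x).trans (by omega)

/-- A subroutine expects empty work registers, but an earlier call leaves its contents behind.
Copying the empty register `z` costs a single step per register, however much was stored there. -/
theorem runs_clear {σ : ℕ → Str} {k z : ℕ} (hz : z < k) (h : σ z = []) : ∀ B,
    ∃ σ', Runs (Prog.clear k z B) σ (B + 1) σ' ∧ (∀ x < B, σ' (k + x) = []) ∧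
      ∀ y < k, σ' y = σ y
  | 0 => ⟨σ, .skip _, by simp, fun _ _ => rfl⟩
  | B + 1 => by
    obtain ⟨σ', r, h₁, h₂⟩ := runs_clear hz h B
    have hz' : σ' z = [] := (h₂ z hz).trans h
    refine ⟨_, .seq r (by simpa [hz'] using Runs.copy σ' (k + B) z), fun x hx => ?_, fun y hy => ?_⟩
    · by_cases hxB : x = B
      · subst hxB; simp
      · simpa [hxB] using h₁ x (by omega)
    · rw [Function.update_of_ne (by omega), h₂ y hy]

/-- `Exec p T τ τ'`: the program `p` takes registers that agree with `τ` below `10` to registers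
that agree with `τ'` below `10`, in at most `T` steps. -/
def Exec (p : Prog) (T : ℕ) (τ τ' : ℕ → Str) : Prop :=
  ∀ σ : ℕ → Str, (∀ y < 10, σ y = τ y) → ∃ t σ', Runs p σ t σ' ∧ t ≤ T ∧ ∀ y < 10, σ' y = τ' y

namespace Exec

variable {p q r : Prog} {T T' : ℕ} {τ τ' τ'' : ℕ → Str}

theorem mono (h : Exec p T τ τ') (hT : T ≤ T') : Exec p T' τ τ' := fun σ hσ => by
  obtain ⟨t, σ', r, ht, h⟩ := h σ hσ
  exact ⟨t, σ', r, ht.trans hT, h⟩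

theorem congr (h : Exec p T τ τ') (hT : T ≤ T') (hτ : ∀ y < 10, τ' y = τ'' y) :
    Exec p T' τ τ'' := fun σ hσ => by
  obtain ⟨t, σ', r, ht, h⟩ := h σ hσ
  exact ⟨t, σ', r, ht.trans hT, fun y hy => (h y hy).trans (hτ y hy)⟩

theorem skip : Exec .skip 1 τ τ := fun σ hσ => ⟨1, σ, .skip _, le_rfl, hσ⟩

theorem push (x : ℕ) (b : Bool) (hx : x < 10) :
    Exec (.push x b) 1 τ (Function.update τ x (b :: τ x)) := fun σ hσ => by
  refine ⟨1, _, .push _ _ _, le_rfl, fun y hy => ?_⟩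
  by_cases hxy : y = x
  · subst hxy; simp [hσ y hy]
  · simp [hxy, hσ y hy]

theorem pop (x : ℕ) (hx : x < 10) :
    Exec (.pop x) 1 τ (Function.update τ x (τ x).tail) := fun σ hσ => by
  refine ⟨1, _, .pop _ _, le_rfl, fun y hy => ?_⟩
  by_cases hxy : y = x
  · subst hxy; simp [hσ y hy]
  · simp [hxy, hσ y hy]

theorem copy (x z : ℕ) (hz : z < 10) :
    Exec (.copy x z) ((τ z).length + 1) τ (Function.update τ x (τ z)) := fun σ hσ => by
  refine ⟨_, _, .copy _ _ _, by rw [hσ z hz], fun y hy => ?_⟩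
  by_cases hxy : y = x
  · subst hxy; simp [hσ z hz]
  · simp [hxy, hσ y hy]

theorem seq (h : Exec p T τ τ') (h' : Exec q T' τ' τ'') : Exec (.seq p q) (T + T') τ τ'' :=
  fun σ hσ => by
    obtain ⟨t, σ₁, r, ht, h₁⟩ := h σ hσ
    obtain ⟨t', σ₂, r', ht', h₂⟩ := h' σ₁ h₁
    exact ⟨_, _, .seq r r', Nat.add_le_add ht ht', h₂⟩

theorem branchNil {x : ℕ} (hx : x < 10) (h : τ x = []) (hp : Exec p T τ τ') :
    Exec (.branch x p q r) (T + 1) τ τ' := fun σ hσ => by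
  obtain ⟨t, σ₁, r, ht, h₁⟩ := hp σ hσ
  exact ⟨_, _, .branchNil ((hσ x hx).trans h) r, by omega, h₁⟩

theorem branchFalse {x : ℕ} {w : Str} (hx : x < 10) (h : τ x = false :: w) (hp : Exec q T τ τ') :
    Exec (.branch x p q r) (T + 1) τ τ' := fun σ hσ => by
  obtain ⟨t, σ₁, r, ht, h₁⟩ := hp σ hσ
  exact ⟨_, _, .branchFalse ((hσ x hx).trans h) r, by omega, h₁⟩

theorem branchTrue {x : ℕ} {w : Str} (hx : x < 10) (h : τ x = true :: w) (hp : Exec r T τ τ') :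
    Exec (.branch x p q r) (T + 1) τ τ' := fun σ hσ => by
  obtain ⟨t, σ₁, r, ht, h₁⟩ := hp σ hσ
  exact ⟨_, _, .branchTrue ((hσ x hx).trans h) r, by omega, h₁⟩

theorem loopNil {x : ℕ} (hx : x < 10) (h : τ x = []) : Exec (.loop x p) 1 τ τ :=
  fun σ hσ => ⟨1, σ, .loopNil ((hσ x hx).trans h), le_rfl, hσ⟩

theorem loopCons {x : ℕ} (hx : x < 10) (h : τ x ≠ []) (hp : Exec p T τ τ')
    (h' : Exec (.loop x p) T' τ' τ'') : Exec (.loop x p) (T + T' + 1) τ τ'' := fun σ hσ => by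
  obtain ⟨t, σ₁, r, ht, h₁⟩ := hp σ hσ
  obtain ⟨t', σ₂, r', ht', h₂⟩ := h' σ₁ h₁
  exact ⟨_, _, .loopCons (by rwa [hσ x hx]) r r', by omega, h₂⟩

end Exec

/-- Relative polynomial time: one program computes `f a` from `e a` in time polynomial in the length
of `e a`. -/
def PT {α : Type} (e f : α → Str) : Prop :=
  ∃ (p : Prog) (T : Polynomial ℕ), ∀ a : α, ∃ (t : ℕ) (s : ℕ → Str),
    Runs p (Function.update (fun _ => []) 0 (e a)) t s ∧ s 1 = f a ∧ t ≤ T.eval (e a).length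

/-! ### Closure properties of relative polynomial time. -/

namespace PT

variable {α : Type} {e f g : α → Str}

theorem of_exec (p : Prog) (T : Polynomial ℕ)
    (h : ∀ a, ∃ τ', Exec p (T.eval (e a).length) (Function.update (fun _ => []) 0 (e a)) τ' ∧
      τ' 1 = f a) : PT e f := by
  refine ⟨p, T, fun a => ?_⟩
  obtain ⟨τ', h, h'⟩ := h a
  obtain ⟨t, σ', r, ht, h₁⟩ := h _ fun _ _ => rfl
  exact ⟨t, σ', r, (h₁ 1 (by norm_num)).trans h', ht⟩

theorem length_le (h : PT e f) : ∃ T : Polynomial ℕ, ∀ a, (f a).length ≤ T.eval (e a).length := by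
  obtain ⟨p, T, h⟩ := h
  refine ⟨Polynomial.X + T, fun a => ?_⟩
  obtain ⟨t, s, r, hs, ht⟩ := h a
  have := r.length_le (M := (e a).length) (fun y => ?_) 1
  · rw [hs] at this
    simp only [Polynomial.eval_add, Polynomial.eval_X]
    omega
  · by_cases hy : y = 0
    · subst hy; simp
    · simp [hy]

/-- A subroutine call. -/
theorem call (h : PT e f) (src dst : ℕ) (hs : src < 9) (hd : dst < 9) :
    ∃ (p : Prog) (T : Polynomial ℕ), ∀ a τ, τ src = e a → τ 9 = [] →
      Exec p (T.eval (e a).length) τ (Function.update τ dst (f a)) := by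
  obtain ⟨L, hL⟩ := h.length_le
  obtain ⟨p, T, h⟩ := h
  obtain ⟨B, hB, hp⟩ := p.exists_usesBelow
  -- The subroutine is moved up by `10`, so its input and output are registers `10` and `11`;
  -- register `9` is the empty source for clearing. Clearing takes `B + 1` steps and the two copies
  -- one step more than their lengths, whence the constant `3`.
  refine ⟨.seq (.seq (.clear 10 9 B) (.copy 10 src)) (.seq (p.shift 10) (.copy dst 11)),
    Polynomial.C B + Polynomial.X + T + L + 3, fun a τ hsrc h9 σ hσ => ?_⟩
  obtain ⟨σ₁, r₁, h₁, f₁⟩ := runs_clear (k := 10) (z := 9) (σ := σ) (by norm_num)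
    ((hσ 9 (by norm_num)).trans h9) B
  have r₂ := Runs.copy σ₁ 10 src
  have e₁ : σ₁ src = e a := by rw [f₁ _ (by omega), hσ _ (by omega), hsrc]
  rw [e₁] at r₂
  obtain ⟨t, s, r, hs₁, ht⟩ := h a
  obtain ⟨σ₃, r₃, h₃, f₃⟩ := r.shift 10 hp (Function.update σ₁ 10 (e a)) fun x hx => by
    by_cases hx0 : x = 0
    · subst hx0; simp
    · rw [Function.update_of_ne (by omega), Function.update_of_ne hx0, h₁ x hx]
  have e₃ : σ₃ 11 = f a := (h₃ 1 (by omega)).trans hs₁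
  have r₄ := Runs.copy σ₃ dst 11
  rw [e₃] at r₄
  refine ⟨_, _, .seq (.seq r₁ r₂) (.seq r₃ r₄), ?_, fun y hy => ?_⟩
  · have := hL a
    simp only [Polynomial.eval_add, Polynomial.eval_X, Polynomial.eval_C, Polynomial.eval_ofNat]
    omega
  · by_cases hyd : y = dst
    · subst hyd; simp
    · rw [Function.update_of_ne hyd, Function.update_of_ne hyd, f₃ y hy,
        Function.update_of_ne (by omega), f₁ y hy, hσ y hy]

protected theorem self : PT e e := by
  refine of_exec (.copy 1 0) (Polynomial.X + 1) fun a => ⟨_, (Exec.copy 1 0 (by norm_num)).mono ?_,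
    by simp⟩
  simp

protected theorem const (w : Str) : PT e fun _ => w := by
  induction w with
  | nil => exact of_exec .skip 1 fun a => ⟨_, Exec.skip.mono (by simp), by simp⟩
  | cons b w ih =>
    obtain ⟨p, T, h⟩ := ih
    refine ⟨.seq p (.push 1 b), T + 1, fun a => ?_⟩
    obtain ⟨t, s, r, hs, ht⟩ := h a
    exact ⟨_, _, .seq r (.push _ _ _), by simp [hs], by simpa using ht⟩

theorem comp {β : Type} {e' f' : β → Str} {k : α → β} (hf : PT e' f')
    (hk : PT e fun a => e' (k a)) : PT e fun a => f' (k a) := by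
  obtain ⟨L, hL⟩ := hk.length_le
  obtain ⟨p, T, hp⟩ := hk.call 0 2 (by norm_num) (by norm_num)
  obtain ⟨q, U, hq⟩ := hf.call 2 1 (by norm_num) (by norm_num)
  refine of_exec (.seq p q) (T + U.comp L) fun a => ⟨_, ((hp a _ (by simp) (by simp)).seq
    (hq (k a) _ (by simp) (by simp))).mono ?_, by simp⟩
  simpa using U.eval_le_eval_of_le (hL a)

theorem branch {c f₀ f₁ f₂ : α → Str} (hc : PT e c) (h₀ : PT e f₀) (h₁ : PT e f₁) (h₂ : PT e f₂) :
    PT e fun a => match c a with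
      | [] => f₀ a
      | false :: _ => f₁ a
      | true :: _ => f₂ a := by
  obtain ⟨p, T, hp⟩ := hc.call 0 2 (by norm_num) (by norm_num)
  obtain ⟨p₀, T₀, hp₀⟩ := h₀.call 0 1 (by norm_num) (by norm_num)
  obtain ⟨p₁, T₁, hp₁⟩ := h₁.call 0 1 (by norm_num) (by norm_num)
  obtain ⟨p₂, T₂, hp₂⟩ := h₂.call 0 1 (by norm_num) (by norm_num)
  refine of_exec (.seq p (.branch 2 p₀ p₁ p₂)) (T + (T₀ + T₁ + T₂ + 1)) fun a => ?_
  rcases hca : c a with _ | ⟨_ | _, w⟩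
  · refine ⟨_, ((hp a _ (by simp) (by simp)).seq (Exec.branchNil (by norm_num) (by simp [hca])
      (hp₀ a _ (by simp) (by simp)))).mono ?_, by simp⟩
    simp only [Polynomial.eval_add, Polynomial.eval_one]; omega
  · refine ⟨_, ((hp a _ (by simp) (by simp)).seq (Exec.branchFalse (by norm_num)
      (by simp [hca]; rfl) (hp₁ a _ (by simp) (by simp)))).mono ?_, by simp⟩
    simp only [Polynomial.eval_add, Polynomial.eval_one]; omega
  · refine ⟨_, ((hp a _ (by simp) (by simp)).seq (Exec.branchTrue (by norm_num)
      (by simp [hca]; rfl) (hp₂ a _ (by simp) (by simp)))).mono ?_, by simp⟩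
    simp only [Polynomial.eval_add, Polynomial.eval_one]; omega

theorem cons (b : Bool) (h : PT e f) : PT e fun a => b :: f a := by
  obtain ⟨p, T, h⟩ := h
  refine ⟨.seq p (.push 1 b), T + 1, fun a => ?_⟩
  obtain ⟨t, s, r, hs, ht⟩ := h a
  exact ⟨_, _, .seq r (.push _ _ _), by simp [hs], by simpa using ht⟩

theorem tail (h : PT e f) : PT e fun a => (f a).tail := by
  obtain ⟨p, T, h⟩ := h
  refine ⟨.seq p (.pop 1), T + 1, fun a => ?_⟩
  obtain ⟨t, s, r, hs, ht⟩ := h a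
  exact ⟨_, _, .seq r (.pop _ _), by simp [hs], by simpa using ht⟩

end PT

/-! ### Pairing -/

/-- Self-delimiting pairing of strings. -/
def pairStr (s w : Str) : Str := (s.flatMap fun b => [true, b]) ++ false :: w

theorem encodeTuple_cons (s : Str) (v : List Str) :
    encodeTuple (s :: v) = pairStr s (encodeTuple v) := by
  simp [encodeTuple, pairStr]

theorem encodeTuple_append (v v' : List Str) :
    encodeTuple (v ++ v') = encodeTuple v ++ encodeTuple v' := by
  simp [encodeTuple]

theorem length_pairStr (s w : Str) : (pairStr s w).length = 2 * s.length + 1 + w.length := by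
  have : (s.flatMap fun b => [true, b]).length = 2 * s.length := by
    induction s with
    | nil => rfl
    | cons b s ih => simp at ih ⊢; omega
  simp [pairStr] at this ⊢; omega

namespace Prog

/-- Moves the reverse of register `x` in front of register `y`. -/
def rev (x y : ℕ) : Prog :=
  .loop x (.seq (.branch x .skip (.push y false) (.push y true)) (.pop x))

/-- As `rev`, with a `1` in front of every bit. -/
def dblRev (x y : ℕ) : Prog :=
  .loop x (.seq (.branch x .skip (.push y false) (.push y true)) (.seq (.push y true) (.pop x)))

/-- Puts the pair of registers `x`, `y` into register `d`, with scratch registers `a`, `b`. -/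
def pair (x y d a b : ℕ) : Prog :=
  .seq (.copy a x) (.seq (rev a b) (.seq (.copy d y) (.seq (.push d false) (dblRev b d))))

/-- Splits the pair in register `2`: the reverse of its first component is moved to register
`3`. Register `4` is a flag. -/
def unpair : Prog :=
  .loop 4 (.branch 2 (.pop 4) (.seq (.pop 4) (.pop 2))
    (.seq (.pop 2) (.seq (.branch 2 .skip (.push 3 false) (.push 3 true)) (.pop 2))))

end Prog

theorem Exec.rev {x y : ℕ} (hx : x < 10) (hy : y < 10) (hxy : x ≠ y) : ∀ (w : Str) (τ : ℕ → Str),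
    τ x = w → Exec (.rev x y) (4 * w.length + 1) τ
      (Function.update (Function.update τ x []) y (w.reverse ++ τ y))
  | [], τ, h => (Exec.loopNil hx h).congr (by simp) fun z _ => by
      by_cases hz : z = y
      · subst hz; simp
      · by_cases hz' : z = x
        · subst hz'; simp [hz, h]
        · simp [hz, hz']
  | b :: w, τ, h => by
    have ih := Exec.rev hx hy hxy w
      (Function.update (Function.update τ y (b :: τ y)) x w) (by simp)
    refine (Exec.loopCons hx (by simp [h]) (.seq (T := 2) (?_ : Exec _ _ _ (Function.update τ y
      (b :: τ y))) ((Exec.pop x hx).congr le_rfl fun z _ => ?_)) ih).congr ?_ fun z _ => ?_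
    · cases b
      · exact Exec.branchFalse hx h (.push _ _ hy)
      · exact Exec.branchTrue hx h (.push _ _ hy)
    · rw [Function.update_of_ne hxy, h]; rfl
    · simp; omega
    · by_cases hz : z = y
      · subst hz; simp [hxy.symm]
      · by_cases hz' : z = x
        · subst hz'; simp [hz]
        · simp [hz, hz']

theorem Exec.dblRev {x y : ℕ} (hx : x < 10) (hy : y < 10) (hxy : x ≠ y) :
    ∀ (w : Str) (τ : ℕ → Str), τ x = w → Exec (.dblRev x y) (5 * w.length + 1) τ
      (Function.update (Function.update τ x []) y
        ((w.reverse.flatMap fun b => [true, b]) ++ τ y))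
  | [], τ, h => (Exec.loopNil hx h).congr (by simp) fun z _ => by
      by_cases hz : z = y
      · subst hz; simp
      · by_cases hz' : z = x
        · subst hz'; simp [hz, h]
        · simp [hz, hz']
  | b :: w, τ, h => by
    have ih := Exec.dblRev hx hy hxy w
      (Function.update (Function.update τ y (true :: b :: τ y)) x w) (by simp)
    refine (Exec.loopCons hx (by simp [h]) (.seq (T := 2) (?_ : Exec _ _ _ (Function.update τ y
      (b :: τ y))) (.seq (.push y true hy) ((Exec.pop x hx).congr le_rfl fun z _ => ?_))) ih).congr
      ?_ fun z _ => ?_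
    · cases b
      · exact Exec.branchFalse hx h (.push _ _ hy)
      · exact Exec.branchTrue hx h (.push _ _ hy)
    · rw [Function.update_of_ne hxy, Function.update_of_ne hxy, h]; simp
    · simp; omega
    · by_cases hz : z = y
      · subst hz; simp [hxy.symm]
      · by_cases hz' : z = x
        · subst hz'; simp [hz]
        · simp [hz, hz']

theorem Exec.pair {x y d a b : ℕ} (hx : x < 10) (hy : y < 10) (hd : d < 10) (ha : a < 10)
    (hb : b < 10) (hab : a ≠ b) (hbd : b ≠ d) (hda : d ≠ a) (hya : y ≠ a) (hyb : y ≠ b)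
    (τ : ℕ → Str) (h : τ b = []) :
    Exec (.pair x y d a b) (10 * (τ x).length + (τ y).length + 5) τ
      (Function.update (Function.update (Function.update τ a []) b []) d
        (pairStr (τ x) (τ y))) := by
  refine (Exec.seq (.copy a x hx) (.seq (.rev ha hb hab (τ x) _ (by simp)) (.seq (.copy d y hy)
    (.seq (.push d false hd) (.dblRev hb hd hbd (τ x).reverse _ ?_))))).congr ?_ fun z _ => ?_
  · simp [h, hbd, hab.symm]
  · simp [hya, hyb]; omega
  · by_cases hz : z = d
    · subst hz; simp [hya, hyb, pairStr]
    · by_cases hz' : z = b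
      · subst hz'; simp [hbd]
      · by_cases hza : z = a
        · subst hza; simp [hz, hab]
        · simp [hz, hz', hza]

/-- A leading `1` announces a bit and a leading `0` ends the component. On reaching the end the flag
is popped, which is what stops the loop. -/
theorem Exec.unpair (w : Str) : ∀ (s : Str) (τ : ℕ → Str), τ 2 = pairStr s w → τ 4 = [true] →
    Exec .unpair (7 * s.length + 6) τ (Function.update (Function.update (Function.update τ 2 w) 3
      (s.reverse ++ τ 3)) 4 [])
  | [], τ, h, h4 => by
    refine (Exec.loopCons (by norm_num) (by simp [h4])
      (.branchFalse (by norm_num) (h.trans (by simp [pairStr]; rfl))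
        (.seq (.pop 4 (by norm_num)) (.pop 2 (by norm_num))))
      (.loopNil (by norm_num) (by simp [h4]))).congr (by simp) fun z _ => ?_
    simp only [Function.update_apply]
    split_ifs <;> simp_all [pairStr]
  | b :: s, τ, h, h4 => by
    have ih := Exec.unpair w s
      (Function.update (Function.update τ 2 (pairStr s w)) 3 (b :: τ 3)) (by simp) (by simp [h4])
    refine (Exec.loopCons (by norm_num) (by simp [h4])
      (.branchTrue (by norm_num) (h.trans (by simp [pairStr]; rfl))
        (.seq (.pop 2 (by norm_num)) (.seq (T := 2) (?_ : Exec _ _ _ (Function.update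
          (Function.update τ 2 (τ 2).tail) 3 (b :: τ 3)))
          ((Exec.pop 2 (by norm_num)).congr le_rfl fun z _ => ?_))))
      ih).congr ?_ fun z _ => ?_
    · cases b
      · exact Exec.branchFalse (by norm_num) (by simp [h, pairStr]; rfl)
          ((Exec.push 3 false (by norm_num)).congr le_rfl fun z _ => by simp)
      · exact Exec.branchTrue (by norm_num) (by simp [h, pairStr]; rfl)
          ((Exec.push 3 true (by norm_num)).congr le_rfl fun z _ => by simp)
    · simp only [Function.update_apply]
      split_ifs <;> simp_all [pairStr]
    · simp; omega
    · simp only [Function.update_apply]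
      split_ifs <;> simp_all

theorem Exec.unpair_nil (τ : ℕ → Str) (h : τ 2 = []) (h4 : τ 4 = [true]) :
    Exec .unpair 6 τ (Function.update τ 4 []) := by
  refine (Exec.loopCons (by norm_num) (by simp [h4]) (.branchNil (by norm_num) h
    (.pop 4 (by norm_num))) (.loopNil (by norm_num) (by simp [h4]))).congr (by simp) fun z _ => ?_
  simp [h4]

namespace PT

variable {α : Type} {e f g : α → Str}

theorem pair (hf : PT e f) (hg : PT e g) : PT e fun a => pairStr (f a) (g a) := by
  obtain ⟨L, hL⟩ := hf.length_le
  obtain ⟨M, hM⟩ := hg.length_le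
  obtain ⟨p, T, hp⟩ := hf.call 0 2 (by norm_num) (by norm_num)
  obtain ⟨q, U, hq⟩ := hg.call 0 3 (by norm_num) (by norm_num)
  refine of_exec (.seq p (.seq q (.pair 2 3 1 4 5))) (T + (U + (10 * L + M + 5))) fun a =>
    ⟨_, ((hp a _ (by simp) (by simp)).seq ((hq a _ (by simp) (by simp)).seq
      (Exec.pair (by norm_num) (by norm_num) (by norm_num) (by norm_num) (by norm_num)
        (by norm_num) (by norm_num) (by norm_num) (by norm_num) (by norm_num) _
        (by simp)))).mono ?_, by simp⟩
  have := hL a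
  have := hM a
  simp; omega

theorem fst {h : α → Str} (hh : PT e h) (H : ∀ a, h a = pairStr (f a) (g a) ∨ h a = [] ∧ f a = []) :
    PT e f := by
  obtain ⟨L, hL⟩ := hh.length_le
  obtain ⟨p, T, hp⟩ := hh.call 0 2 (by norm_num) (by norm_num)
  refine of_exec (.seq p (.seq (.push 4 true) (.seq .unpair (.rev 3 1))))
    (T + (1 + ((7 * L + 6) + (4 * L + 1)))) fun a => ?_
  have hLa := hL a
  rcases H a with H | ⟨H, hf⟩
  · refine ⟨_, ((hp a _ (by simp) (by simp)).seq ((Exec.push 4 true (by norm_num)).seq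
      ((Exec.unpair (g a) (f a) _ (by simp [H]) (by simp)).seq
      (Exec.rev (by norm_num) (by norm_num) (by norm_num) (f a).reverse _ (by simp))))).mono ?_,
      by simp⟩
    rw [H, length_pairStr] at hLa
    simp; omega
  · refine ⟨_, ((hp a _ (by simp) (by simp)).seq ((Exec.push 4 true (by norm_num)).seq
      ((Exec.unpair_nil _ (by simp [H]) (by simp)).seq
      (Exec.rev (by norm_num) (by norm_num) (by norm_num) [] _ (by simp))))).mono ?_,
      by simp [hf]⟩
    simp; omega

theorem snd {h : α → Str} (hh : PT e h) (H : ∀ a, h a = pairStr (f a) (g a) ∨ h a = [] ∧ g a = []) :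
    PT e g := by
  obtain ⟨L, hL⟩ := hh.length_le
  obtain ⟨p, T, hp⟩ := hh.call 0 2 (by norm_num) (by norm_num)
  refine of_exec (.seq p (.seq (.push 4 true) (.seq .unpair (.copy 1 2))))
    (T + (1 + ((7 * L + 6) + (L + 1)))) fun a => ?_
  have hLa := hL a
  rcases H a with H | ⟨H, hf⟩
  · refine ⟨_, ((hp a _ (by simp) (by simp)).seq ((Exec.push 4 true (by norm_num)).seq
      ((Exec.unpair (g a) (f a) _ (by simp [H]) (by simp)).seq
      (Exec.copy 1 2 (by norm_num))))).mono ?_, by simp⟩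
    rw [H, length_pairStr] at hLa
    simp; omega
  · refine ⟨_, ((hp a _ (by simp) (by simp)).seq ((Exec.push 4 true (by norm_num)).seq
      ((Exec.unpair_nil _ (by simp [H]) (by simp)).seq
      (Exec.copy 1 2 (by norm_num))))).mono ?_, by simp [hf, H]⟩
    simp [H]; omega

/-- Iterating a step function on states `σ`, with a fixed context `γ`, as long as the states stay
polynomially bounded. -/
theorem iterate {γ σ : Type} {eγ : γ → Str} {eσ : σ → Str} {step : γ → σ → σ}
    (hstep : PT (fun x : γ × σ => pairStr (eγ x.1) (eσ x.2)) fun x => eσ (step x.1 x.2))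
    {c : α → Str} {i : α → σ} {k : α → γ} (hc : PT e c) (hi : PT e fun a => eσ (i a))
    (hk : PT e fun a => eγ (k a)) (S : Polynomial ℕ)
    (hS : ∀ a, ∀ j ≤ (c a).length, (eσ ((step (k a))^[j] (i a))).length ≤ S.eval (e a).length) :
    PT e fun a => eσ ((step (k a))^[(c a).length] (i a)) := by
  obtain ⟨L, hL⟩ := hc.length_le
  obtain ⟨M, hM⟩ := hk.length_le
  obtain ⟨pc, Tc, hpc⟩ := hc.call 0 4 (by norm_num) (by norm_num)
  obtain ⟨pi, Ti, hpi⟩ := hi.call 0 3 (by norm_num) (by norm_num)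
  obtain ⟨pk, Tk, hpk⟩ := hk.call 0 2 (by norm_num) (by norm_num)
  obtain ⟨p, T, hp⟩ := hstep.call 5 3 (by norm_num) (by norm_num)
  let body : Prog := .seq (.pop 4) (.seq (.pair 2 3 5 6 7) p)
  -- Cost of a round: pairing the context and the state takes `10 * M + S + 5`, the pop and the loop
  -- test one step each, and the step function runs on a pair of length at most `2 * M + 1 + S`.
  let D : Polynomial ℕ := 10 * M + S + 7 + T.comp (2 * M + 1 + S)
  have key : ∀ a, ∀ (w : Str) (j : ℕ), j + w.length = (c a).length →
      ∀ τ : ℕ → Str, τ 9 = [] → τ 7 = [] → τ 2 = eγ (k a) → τ 3 = eσ ((step (k a))^[j] (i a)) →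
      τ 4 = w →
      ∃ τ', Exec (.loop 4 body) (w.length * D.eval (e a).length + 1) τ τ' ∧
        τ' 3 = eσ ((step (k a))^[(c a).length] (i a)) := by
    intro a w
    induction w with
    | nil =>
      intro j hj τ h9 h7 h2 h3 h4
      refine ⟨τ, (Exec.loopNil (by norm_num) h4).mono (by simp), ?_⟩
      rw [h3, ← hj]; rfl
    | cons b w ih =>
      intro j hj τ h9 h7 h2 h3 h4
      simp only [List.length_cons] at hj
      have hSj := hS a j (by omega)
      have hMa := hM a
      obtain ⟨τ', h, h'⟩ := ih (j + 1) (by omega) (Function.update (Function.update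
        (Function.update (Function.update (Function.update τ 4 w) 6 []) 7 []) 5 (pairStr (τ 2)
        (τ 3))) 3 (eσ ((step (k a))^[j + 1] (i a)))) (by simp [h9]) (by simp) (by simp [h2])
        (by simp) (by simp)
      refine ⟨τ', (Exec.loopCons (by norm_num) (by simp [h4]) (.seq (.pop 4 (by norm_num))
        (.seq (.pair (by norm_num) (by norm_num) (by norm_num) (by norm_num) (by norm_num)
        (by norm_num) (by norm_num) (by norm_num) (by norm_num) (by norm_num) _ (by simp [h7]))
        ((hp (k a, (step (k a))^[j] (i a)) _ (by simp [h2, h3]) (by simp [h9])).congr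
        le_rfl fun z _ => ?_))) h).mono ?_, h'⟩
      · simp only [Function.iterate_succ_apply', h4, List.tail_cons]
        simp
      · simp only [h2, h3, length_pairStr, D, Function.update_of_ne (show (2 : ℕ) ≠ 4 by norm_num),
          Function.update_of_ne (show (3 : ℕ) ≠ 4 by norm_num), List.length_cons]
        have := T.eval_le_eval_of_le (show 2 * (eγ (k a)).length + 1 +
          (eσ ((step (k a))^[j] (i a))).length ≤ 2 * M.eval (e a).length + 1 +
          S.eval (e a).length by omega)
        simp only [Polynomial.eval_add, Polynomial.eval_mul, Polynomial.eval_ofNat,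
          Polynomial.eval_comp, Polynomial.eval_one, add_mul w.length 1, one_mul]
        omega
  refine of_exec (.seq pc (.seq pi (.seq pk (.seq (.loop 4 body) (.copy 1 3)))))
    (Tc + (Ti + (Tk + ((L * D + 1) + (S + 1))))) fun a => ?_
  obtain ⟨τ', h, h'⟩ := key a (c a) 0 (by simp) (Function.update (Function.update (Function.update
    (Function.update (fun _ => []) 0 (e a)) 4 (c a)) 3 (eσ (i a))) 2 (eγ (k a))) (by simp)
    (by simp) (by simp) (by simp) (by simp)
  refine ⟨_, ((hpc a _ (by simp) (by simp)).seq ((hpi a _ (by simp) (by simp)).seq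
    ((hpk a _ (by simp) (by simp)).seq (h.seq (Exec.copy 1 3 (by norm_num)))))).mono ?_,
    by simp [h']⟩
  rw [h']
  have := hS a _ le_rfl
  have := Nat.mul_le_mul_right (D.eval (e a).length) (hL a)
  simp only [Polynomial.eval_add, Polynomial.eval_mul, Polynomial.eval_one]
  omega

end PT
end

noncomputable section

/-! ### Polynomial time on restricted domains. -/

theorem PT.restrict {α β : Type} {e f : α → Str} (h : PT e f) (k : β → α) :
    PT (fun b => e (k b)) fun b => f (k b) := by
  obtain ⟨p, T, h⟩ := h
  exact ⟨p, T, fun b => h (k b)⟩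

theorem PT.congr {α : Type} {e f g : α → Str} (h : PT e g) (H : ∀ a, f a = g a) : PT e f :=
  (funext H : f = g) ▸ h

/-- A branch has to be computable only where it is taken. This permits a branch to use the head of a
list, which exists only if the list is nonempty. -/
theorem PT.cases {α : Type} {e c f : α → Str} (hc : PT e c)
    (h₀ : PT (fun a : {a // c a = []} => e a) fun a => f a)
    (h₁ : PT (fun a : {a // ∃ w, c a = false :: w} => e a) fun a => f a)
    (h₂ : PT (fun a : {a // ∃ w, c a = true :: w} => e a) fun a => f a) : PT e f := by
  obtain ⟨p, T, hp⟩ := hc.call 0 2 (by norm_num) (by norm_num)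
  obtain ⟨p₀, T₀, hp₀⟩ := h₀.call 0 1 (by norm_num) (by norm_num)
  obtain ⟨p₁, T₁, hp₁⟩ := h₁.call 0 1 (by norm_num) (by norm_num)
  obtain ⟨p₂, T₂, hp₂⟩ := h₂.call 0 1 (by norm_num) (by norm_num)
  refine PT.of_exec (.seq p (.branch 2 p₀ p₁ p₂)) (T + (T₀ + T₁ + T₂ + 1)) fun a => ?_
  rcases hca : c a with _ | ⟨_ | _, w⟩
  · refine ⟨_, ((hp a _ (by simp) (by simp)).seq (Exec.branchNil (by norm_num) (by simp [hca])
      (hp₀ ⟨a, hca⟩ _ (by simp) (by simp)))).mono ?_, by simp⟩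
    simp only [Polynomial.eval_add, Polynomial.eval_one]; omega
  · refine ⟨_, ((hp a _ (by simp) (by simp)).seq (Exec.branchFalse (by norm_num)
      (by simp [hca]; rfl) (hp₁ ⟨a, w, hca⟩ _ (by simp) (by simp)))).mono ?_, by simp⟩
    simp only [Polynomial.eval_add, Polynomial.eval_one]; omega
  · refine ⟨_, ((hp a _ (by simp) (by simp)).seq (Exec.branchTrue (by norm_num)
      (by simp [hca]; rfl) (hp₂ ⟨a, w, hca⟩ _ (by simp) (by simp)))).mono ?_, by simp⟩
    simp only [Polynomial.eval_add, Polynomial.eval_one]; omega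

/-! ### Encodable types and polynomial-time functions between them -/

/-- Types whose elements are represented by strings. -/
class Enc (α : Type) where
  enc : α → Str

open Enc (enc)

/-- Bit strings are also lists of encodable elements; the priority makes them stand for themselves
instead of being encoded as tuples. -/
instance (priority := high) : Enc Str := ⟨id⟩
-- In unary the size of a number is its value, so a loop may run for a computed number of rounds.
instance : Enc ℕ := ⟨unary⟩
instance : Enc Bool := ⟨fun b => [b]⟩
instance : Enc Unit := ⟨fun _ => []⟩
instance {α β : Type} [Enc α] [Enc β] : Enc (α × β) := ⟨fun p => pairStr (enc p.1) (enc p.2)⟩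
instance (priority := low) {α : Type} [Enc α] : Enc (List α) := ⟨fun l => encodeTuple (l.map enc)⟩
/-- The length of the representation. -/
def size {α : Type} [Enc α] (a : α) : ℕ := (enc a).length

/-- Functions computable in polynomial time. -/
@[fun_prop]
def PF {α β : Type} [Enc α] [Enc β] (f : α → β) : Prop := PT enc fun a => enc (f a)

/-- Functions bounded by a polynomial in the size of the argument. -/
def PB {α : Type} [Enc α] (f : α → ℕ) : Prop := ∃ T : Polynomial ℕ, ∀ a, f a ≤ T.eval (size a)

section sizes
variable {α β : Type} [Enc α] [Enc β]

theorem size_str (s : Str) : size s = s.length := rfl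
theorem size_nat (n : ℕ) : size n = n := by simp [size, enc, unary]
theorem size_bool (b : Bool) : size b = 1 := rfl
theorem size_pair (a : α) (b : β) : size (a, b) = 2 * size a + 1 + size b :=
  length_pairStr _ _
theorem enc_nil : enc ([] : List α) = [] := rfl
theorem enc_cons (a : α) (l : List α) : enc (a :: l) = pairStr (enc a) (enc l) := by
  simp [enc, encodeTuple_cons]
theorem enc_append (l l' : List α) : enc (l ++ l') = enc l ++ enc l' := by
  simp [enc, encodeTuple_append]
theorem size_nil : size ([] : List α) = 0 := rfl
theorem size_cons (a : α) (l : List α) : size (a :: l) = 2 * size a + 1 + size l := by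
  simp [size, enc_cons, length_pairStr]
theorem size_append (l l' : List α) : size (l ++ l') = size l + size l' := by
  simp [size, enc_append]
theorem length_le_size (l : List α) : l.length ≤ size l := by
  induction l with
  | nil => simp
  | cons a l ih => simp [size_cons]; omega
end sizes

section rules
variable {α β γ δ σ : Type} [Enc α] [Enc β] [Enc γ] [Enc δ] [Enc σ]

theorem PF.congr {f g : α → β} (h : PF g) (H : ∀ a, f a = g a) : PF f := (funext H : f = g) ▸ h

@[fun_prop] theorem PF.id : PF fun a : α => a := PT.self

@[fun_prop] theorem PF.const (b : β) : PF fun _ : α => b := PT.const _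

@[fun_prop] theorem PF.comp {f : β → γ} {g : α → β} (hf : PF f) (hg : PF g) :
    PF fun a => f (g a) := PT.comp (f' := fun b => Enc.enc (f b)) hf hg

@[fun_prop] theorem PF.pair {f : α → β} {g : α → γ} (hf : PF f) (hg : PF g) :
    PF fun a => (f a, g a) := PT.pair hf hg

@[fun_prop] theorem PF.fst {f : α → β × γ} (hf : PF f) : PF fun a => (f a).1 :=
  PT.fst (g := fun a => enc (f a).2) hf fun _ => .inl rfl

@[fun_prop] theorem PF.snd {f : α → β × γ} (hf : PF f) : PF fun a => (f a).2 :=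
  PT.snd (f := fun a => enc (f a).1) hf fun _ => .inl rfl

/-- Passing between types costs nothing if the representing strings coincide. Structures, list
concatenation and unary arithmetic are reduced to pairs and strings in this way. -/
theorem PF.of_enc_eq {f : α → β} {g : α → γ} (hf : PF f) (h : ∀ a, enc (g a) = enc (f a)) :
    PF g := by
  unfold PF at hf ⊢; simpa only [h] using hf

@[fun_prop] theorem PF.enc {f : α → β} (hf : PF f) : PF fun a => enc (f a) :=
  hf.of_enc_eq fun _ => rfl

@[fun_prop] theorem PF.bif {c : α → Bool} {f g : α → β} (hc : PF c) (hf : PF f) (hg : PF g) :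
    PF fun a => bif c a then f a else g a := by
  have := PT.branch hc hf hg hf
  unfold PF
  refine PT.congr this fun a => ?_
  change Enc.enc (bif c a then f a else g a) = _
  cases c a <;> rfl

theorem PF.strCases {s : α → Str} {f : α → β} {g : α × Bool × Str → β} (hs : PF s) (hf : PF f)
    (hg : PF g) : PF fun a => match s a with
      | [] => f a
      | b :: t => g (a, b, t) := by
  have key (b : Bool) : PT (fun a : {a // ∃ w, s a = b :: w} => Enc.enc a.1)
      (fun a => Enc.enc (match s a.1 with
      | [] => f a.1
      | b :: t => g (a.1, b, t))) := by
    have := PT.comp (e' := Enc.enc) (f' := fun x => Enc.enc (g x))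
      (k := fun a : {a // ∃ w, s a = b :: w} => (a.1, b, (s a.1).tail)) hg
      (PT.pair (PT.restrict (e := Enc.enc) (f := Enc.enc) PT.self Subtype.val)
        (PT.pair (PT.const [b]) (hs.tail.restrict Subtype.val)))
    refine PT.congr this fun a => ?_
    obtain ⟨a, w, h⟩ := a
    simp [h]
  refine PT.cases (c := s) hs ?_ (key false) (key true)
  refine PT.congr (hf.restrict (fun a : {a // s a = []} => a.1)) fun a => ?_
  simp [a.2]

/-- A list is nonempty exactly if its encoding is, and then the pair of head and tail has the same
encoding as the list. Which bit comes first is irrelevant, so one argument serves both nonempty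
branches. -/
theorem PF.listCases {l : α → List β} {f : α → γ} {g : α × β × List β → γ} (hl : PF l) (hf : PF f)
    (hg : PF g) : PF fun a => match l a with
      | [] => f a
      | b :: t => g (a, b, t) := by
  have key (b : Bool) : PT (fun a : {a // ∃ w, Enc.enc (l a) = b :: w} => Enc.enc a.1)
      (fun a => Enc.enc (match l a.1 with
      | [] => f a.1
      | b :: t => g (a.1, b, t))) := by
    have hne : ∀ a : {a // ∃ w, Enc.enc (l a) = b :: w}, l a.1 ≠ [] := fun a h => by
      obtain ⟨a, w, h'⟩ := a; simp [h, enc_nil] at h'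
    have := PT.comp (e' := Enc.enc) (k := fun a : {a // ∃ w, Enc.enc (l a) = b :: w} =>
        (a.1, (l a.1).head (hne a), (l a.1).tail)) hg (by
      have := PT.pair (PT.restrict (e := Enc.enc) (f := Enc.enc) PT.self Subtype.val)
        (PT.restrict hl (Subtype.val : {a // ∃ w, Enc.enc (l a) = b :: w} → α))
      refine PT.congr this fun a => ?_
      change pairStr _ (pairStr (Enc.enc ((l a.1).head (hne a))) (Enc.enc (l a.1).tail)) = _
      rw [← enc_cons, List.cons_head_tail])
    refine PT.congr this fun a => ?_
    obtain ⟨x, t, hl⟩ := List.exists_cons_of_ne_nil (hne a)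
    simp [hl]
  refine PT.cases (c := fun a => Enc.enc (l a)) hl ?_ (key false) (key true)
  have := hf.restrict (fun a : {a // Enc.enc (l a) = []} => a.1)
  refine PT.congr this fun a => ?_
  have ha := a.2
  rcases h : l a.1 with _ | ⟨x, t⟩
  · simp [h]
  · rw [h, enc_cons] at ha; simp [pairStr] at ha

/-! #### Polynomial bounds -/

theorem PF.pb_size {f : α → β} (hf : PF f) : PB fun a => size (f a) := PT.length_le hf

theorem PB.const (n : ℕ) : PB fun _ : α => n := ⟨Polynomial.C n, fun _ => by simp⟩

theorem PB.mono {f g : α → ℕ} (hg : PB g) (h : ∀ a, f a ≤ g a) : PB f := by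
  obtain ⟨T, hT⟩ := hg
  exact ⟨T, fun a => (h a).trans (hT a)⟩

theorem PB.add {f g : α → ℕ} (hf : PB f) (hg : PB g) : PB fun a => f a + g a := by
  obtain ⟨T, hT⟩ := hf
  obtain ⟨U, hU⟩ := hg
  exact ⟨T + U, fun a => by simpa using Nat.add_le_add (hT a) (hU a)⟩

theorem PB.mul {f g : α → ℕ} (hf : PB f) (hg : PB g) : PB fun a => f a * g a := by
  obtain ⟨T, hT⟩ := hf
  obtain ⟨U, hU⟩ := hg
  exact ⟨T * U, fun a => by simpa using Nat.mul_le_mul (hT a) (hU a)⟩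

theorem PB.comp {f : β → ℕ} {g : α → β} (hf : PB f) (hg : PF g) : PB fun a => f (g a) := by
  obtain ⟨T, hT⟩ := hf
  obtain ⟨U, hU⟩ := hg.pb_size
  exact ⟨T.comp U, fun a => (hT _).trans (by simpa using T.eval_le_eval_of_le (hU a))⟩

theorem PF.pb {f : α → ℕ} (hf : PF f) : PB f := hf.pb_size.mono fun _ => (size_nat _).ge

/-! #### Iteration -/

/-- Iteration of a step function that only adds a bounded amount to the state. -/
theorem PF.iterateStr {f : γ × σ → σ} (hf : PF f) {D : γ → ℕ} (hD : PB D)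
    (hgrow : ∀ g s, size (f (g, s)) ≤ size s + D g) {c : α → Str} {g : α → γ} {i : α → σ}
    (hc : PF c) (hg : PF g) (hi : PF i) :
    PF fun a => (fun s => f (g a, s))^[(c a).length] (i a) := by
  obtain ⟨S, hS⟩ := (hi.pb_size.add (hc.pb_size.mul (hD.comp hg)))
  refine PT.iterate (eγ := Enc.enc) (eσ := Enc.enc) (step := fun g s => f (g, s)) hf hc hi hg S
    fun a j hj => le_trans ?_ (hS a)
  have key : ∀ j, size ((fun s => f (g a, s))^[j] (i a)) ≤ size (i a) + j * D (g a) := by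
    intro j
    induction j with
    | zero => simp
    | succ j ih =>
      rw [Function.iterate_succ_apply', add_mul, one_mul]
      have := hgrow (g a) ((fun s => f (g a, s))^[j] (i a))
      omega
  exact (key j).trans (Nat.add_le_add_left (Nat.mul_le_mul_right _ hj) _)

theorem PF.iterate {f : γ × σ → σ} (hf : PF f) {D : γ → ℕ} (hD : PB D)
    (hgrow : ∀ g s, size (f (g, s)) ≤ size s + D g) {c : α → ℕ} {g : α → γ} {i : α → σ}
    (hc : PF c) (hg : PF g) (hi : PF i) :
    PF fun a => (fun s => f (g a, s))^[c a] (i a) := by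
  have := PF.iterateStr hf hD hgrow hc.enc hg hi
  simpa [Enc.enc, unary] using this

@[fun_prop] theorem PF.succ {f : α → ℕ} (hf : PF f) : PF fun a => f a + 1 := PT.cons true hf

@[fun_prop] theorem PF.length {f : α → Str} (hf : PF f) : PF fun a => (f a).length := by
  have := PF.iterateStr (σ := ℕ) (γ := Unit) (f := fun x => x.2 + 1) (by fun_prop) (PB.const 1)
    (fun g s => by simp [size_nat]) hf (PF.const ()) (PF.const 0)
  simpa using this

@[fun_prop] theorem PF.size {f : α → β} (hf : PF f) : PF fun a => size (f a) := hf.enc.length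

/-- The loop carries the rest of the list and the accumulator, and the size of the rest counts twice
in the pair. Consuming `b` frees more than `4 * size b`, which pays for that summand in `hgrow`. The
loop runs `size (l a)` rounds, at least as many as there are elements; surplus rounds meet the empty
list and change nothing. -/
theorem PF.foldlList {f : γ × σ × β → σ} (hf : PF f) {D : γ → ℕ} (hD : PB D)
    (hgrow : ∀ g s b, _root_.size (f (g, s, b)) ≤ _root_.size s + D g + 4 * _root_.size b)
    {l : α → List β} {g : α → γ} {i : α → σ} (hl : PF l) (hg : PF g) (hi : PF i) :
    PF fun a => (l a).foldl (fun s b => f (g a, s, b)) (i a) := by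
  let step : γ × List β × σ → List β × σ := fun x => match x.2.1 with
    | [] => ([], x.2.2)
    | b :: t => (t, f (x.1, x.2.2, b))
  have hstep : PF step := PF.listCases (l := fun x : γ × List β × σ => x.2.1)
    (f := fun x => ([], x.2.2)) (g := fun y : (γ × List β × σ) × β × List β =>
      (y.2.2, f (y.1.1, y.1.2.2, y.2.1))) (by fun_prop) (by fun_prop) (by fun_prop)
  have h := PF.iterate hstep hD (fun g s => ?_) hl.size hg (hl.pair hi)
  · refine PF.congr (h.snd) fun a => ?_
    have key : ∀ (l : List β) (n : ℕ) (s : σ), l.length ≤ n →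
        ((fun s => step (g a, s))^[n] (l, s)) = ([], l.foldl (fun s b => f (g a, s, b)) s) := by
      intro l
      induction l with
      | nil =>
        intro n s _
        induction n with
        | zero => rfl
        | succ n ih => rw [Function.iterate_succ_apply]; simpa [step] using ih
      | cons b l ih =>
        intro n s hn
        obtain ⟨n, rfl⟩ : ∃ m, n = m + 1 := ⟨n - 1, by simp at hn; omega⟩
        rw [Function.iterate_succ_apply]
        exact ih n _ (by simpa using hn)
    rw [key _ _ _ (length_le_size _)]
  · obtain ⟨l, s⟩ := s
    rcases l with _ | ⟨b, t⟩
    · simp [step]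
    · have := hgrow g s b
      simp only [step, size_pair, size_cons]; omega

theorem PF.foldlStr {f : γ × σ × Bool → σ} (hf : PF f) {D : γ → ℕ} (hD : PB D)
    (hgrow : ∀ g s b, _root_.size (f (g, s, b)) ≤ _root_.size s + D g)
    {l : α → Str} {g : α → γ} {i : α → σ} (hl : PF l) (hg : PF g) (hi : PF i) :
    PF fun a => (l a).foldl (fun s b => f (g a, s, b)) (i a) := by
  let step : γ × Str × σ → Str × σ := fun x => match x.2.1 with
    | [] => ([], x.2.2)
    | b :: t => (t, f (x.1, x.2.2, b))
  have hstep : PF step := PF.strCases (s := fun x : γ × Str × σ => x.2.1)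
    (f := fun x => ([], x.2.2)) (g := fun y : (γ × Str × σ) × Bool × Str =>
      (y.2.2, f (y.1.1, y.1.2.2, y.2.1))) (by fun_prop) (by fun_prop) (by fun_prop)
  have h := PF.iterateStr hstep hD (fun g s => ?_) hl hg (hl.pair hi)
  · refine PF.congr (h.snd) fun a => ?_
    have key : ∀ (l : Str) (s : σ),
        ((fun s => step (g a, s))^[l.length] (l, s)) =
          ([], l.foldl (fun s b => f (g a, s, b)) s) := by
      intro l
      induction l with
      | nil => intro s; rfl
      | cons b l ih =>
        intro s
        rw [List.length_cons, Function.iterate_succ_apply]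
        exact ih _
    rw [key]
  · obtain ⟨l, s⟩ := s
    rcases l with _ | ⟨b, t⟩
    · simp [step]
    · have := hgrow g s b
      simp only [step, size_pair, size_str, List.length_cons]; omega

/-! #### Strings, lists and numbers -/

@[fun_prop] theorem PF.strCons {b : α → Bool} {s : α → Str} (hb : PF b) (hs : PF s) :
    PF fun a => b a :: s a := by
  have : PF fun a => bif b a then true :: s a else false :: s a :=
    hb.bif (PT.cons true hs) (PT.cons false hs)
  refine PF.congr (this) fun a => ?_
  cases b a <;> rfl

@[fun_prop] theorem PF.strTail {s : α → Str} (hs : PF s) : PF fun a => (s a).tail := PT.tail hs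

@[fun_prop] theorem PF.strReverse {s : α → Str} (hs : PF s) : PF fun a => (s a).reverse := by
  have := PF.foldlStr (σ := Str) (γ := Unit) (f := fun x => x.2.2 :: x.2.1) (by fun_prop)
    (PB.const 1) (fun g s b => by simp [size_str]) hs (PF.const ()) (PF.const [])
  simpa using this

@[fun_prop] theorem PF.strAppend {s t : α → Str} (hs : PF s) (ht : PF t) :
    PF fun a => s a ++ t a := by
  have := PF.foldlStr (σ := Str) (γ := Unit) (f := fun x => x.2.2 :: x.2.1) (by fun_prop)
    (PB.const 1) (fun g s b => by simp [size_str]) hs.strReverse (PF.const ()) ht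
  simpa using this

@[fun_prop] theorem PF.strDrop {n : α → ℕ} {s : α → Str} (hn : PF n) (hs : PF s) :
    PF fun a => (s a).drop (n a) := by
  have := PF.iterate (σ := Str) (γ := Unit) (f := fun x => x.2.tail) (by fun_prop)
    (PB.const 0) (fun g s => by simp [size_str]) hn (PF.const ()) hs
  refine PF.congr (this) fun a => ?_
  generalize s a = t
  generalize n a = k
  induction k generalizing t with
  | zero => rfl
  | succ k ih => rw [Function.iterate_succ_apply, ← ih]; simp

@[fun_prop] theorem PF.strTake {n : α → ℕ} {s : α → Str} (hn : PF n) (hs : PF s) :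
    PF fun a => (s a).take (n a) := by
  have h1 : PF fun a => (s a).reverse.drop ((s a).drop (n a)).length := by fun_prop
  have := h1.strReverse
  refine PF.congr (this) fun a => ?_
  rw [List.length_drop, List.reverse_drop, List.reverse_reverse, List.length_reverse,
    List.take_eq_take_iff]
  omega

@[fun_prop] theorem PF.strIsEmpty {s : α → Str} (hs : PF s) : PF fun a => (s a).isEmpty := by
  have := PF.strCases hs (PF.const true) (PF.const (α := α × Bool × Str) false)
  refine PF.congr (this) fun a => ?_
  cases s a <;> rfl

@[fun_prop] theorem PF.listIsEmpty {l : α → List β} (hl : PF l) : PF fun a => (l a).isEmpty := by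
  have := PF.listCases hl (PF.const true) (PF.const (α := α × β × List β) false)
  refine PF.congr (this) fun a => ?_
  cases l a <;> rfl

@[fun_prop] theorem PF.not {b : α → Bool} (hb : PF b) : PF fun a => !b a := by
  have := hb.bif (PF.const false) (PF.const true)
  refine PF.congr (this) fun a => ?_
  cases b a <;> rfl

@[fun_prop] theorem PF.and {b c : α → Bool} (hb : PF b) (hc : PF c) : PF fun a => b a && c a := by
  have := hb.bif hc (PF.const false)
  refine PF.congr (this) fun a => ?_
  cases b a <;> rfl

@[fun_prop] theorem PF.or {b c : α → Bool} (hb : PF b) (hc : PF c) : PF fun a => b a || c a := by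
  have := hb.bif (PF.const true) hc
  refine PF.congr (this) fun a => ?_
  cases b a <;> rfl

@[fun_prop] theorem PF.xor {b c : α → Bool} (hb : PF b) (hc : PF c) :
    PF fun a => Bool.xor (b a) (c a) := by
  have := hb.bif hc.not hc
  refine PF.congr (this) fun a => ?_
  cases b a <;> simp

@[fun_prop] theorem PF.natAdd {m n : α → ℕ} (hm : PF m) (hn : PF n) : PF fun a => m a + n a := by
  have := hm.enc.strAppend hn.enc
  refine PF.of_enc_eq this fun a => ?_
  exact List.replicate_add _ _ _

@[fun_prop] theorem PF.natSub {m n : α → ℕ} (hm : PF m) (hn : PF n) : PF fun a => m a - n a := by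
  have := hn.strDrop hm.enc
  refine PF.of_enc_eq this fun a => ?_
  simp [Enc.enc, unary]

@[fun_prop] theorem PF.natMul {m n : α → ℕ} (hm : PF m) (hn : PF n) : PF fun a => m a * n a := by
  have := PF.iterate (σ := ℕ) (γ := ℕ) (f := fun x => x.2 + x.1) (D := fun g => g) (by fun_prop)
    PF.id.pb (fun g s => by simp [size_nat]) hm hn (PF.const 0)
  refine PF.congr (this) fun a => ?_
  generalize m a = k
  induction k with
  | zero => simp
  | succ k ih => rw [Function.iterate_succ_apply', ← ih]; ring

@[fun_prop] theorem PF.natIsZero {m : α → ℕ} (hm : PF m) : PF fun a => m a == 0 := by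
  have := hm.enc.strIsEmpty
  refine PF.congr (this) fun a => ?_
  cases h : m a <;> simp [Enc.enc, unary, List.replicate_succ]

@[fun_prop] theorem PF.natLe {m n : α → ℕ} (hm : PF m) (hn : PF n) :
    PF fun a => decide (m a ≤ n a) := by
  have := (hm.natSub hn).natIsZero
  refine PF.congr (this) fun a => ?_
  rw [Bool.eq_iff_iff]; simp [Nat.sub_eq_zero_iff_le]

@[fun_prop] theorem PF.natEq {m n : α → ℕ} (hm : PF m) (hn : PF n) :
    PF fun a => decide (m a = n a) := by
  have := (hm.natLe hn).and (hn.natLe hm)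
  refine PF.congr (this) fun a => ?_
  rw [Bool.eq_iff_iff]; simp; omega

@[fun_prop] theorem PF.polyEval (T : Polynomial ℕ) {m : α → ℕ} (hm : PF m) :
    PF fun a => T.eval (m a) := by
  induction T using Polynomial.induction_on' with
  | add p q hp hq => simpa using hp.natAdd hq
  | monomial k c =>
    have : PF fun a => m a ^ k := by
      induction k with
      | zero => simpa using PF.const 1
      | succ k ih => simpa [pow_succ] using ih.natMul hm
    simpa using (PF.const c).natMul this

@[fun_prop] theorem PF.strEq {s t : α → Str} (hs : PF s) (ht : PF t) :
    PF fun a => decide (s a = t a) := by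
  -- The accumulator holds the part of `t` not yet compared and the verdict so far; running out of
  -- `t` counts as a mismatch.
  let f : Unit × (Str × Bool) × Bool → Str × Bool := fun x => match x.2.1.1 with
    | [] => ([], false)
    | b :: t => (t, x.2.1.2 && !Bool.xor b x.2.2)
  have hf : PF f := PF.strCases (s := fun x : Unit × (Str × Bool) × Bool => x.2.1.1)
    (f := fun _ => ([], false))
    (g := fun y : (Unit × (Str × Bool) × Bool) × Bool × Str =>
      (y.2.2, y.1.2.1.2 && !Bool.xor y.2.1 y.1.2.2)) (by fun_prop) (by fun_prop) (by fun_prop)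
  have h := PF.foldlStr hf (PB.const 0) (fun g s b => ?_) hs (PF.const ()) (ht.pair (PF.const true))
  · refine PF.congr (h.fst.strIsEmpty.and h.snd) fun a => ?_
    have key : ∀ (u v : Str) (ok : Bool),
        ((u.foldl (fun s b => f ((), s, b)) (v, ok)).1.isEmpty &&
          (u.foldl (fun s b => f ((), s, b)) (v, ok)).2) = (decide (u = v) && ok) := by
      intro u
      induction u with
      | nil => intro v ok; cases v <;> simp
      | cons b u ih =>
        intro v ok
        rcases v with _ | ⟨c, v⟩
        · rw [List.foldl_cons]; simp only [f]; rw [ih]; simp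
        · rw [List.foldl_cons]; simp only [f]; rw [ih]
          cases b <;> cases c <;> cases ok <;> simp
    rw [key]; simp
  · obtain ⟨s, ok⟩ := s
    rcases s with _ | ⟨c, s⟩ <;> simp [f, size_pair, size_str, size_bool]

@[fun_prop] theorem PF.countXor {s t : α → Str} (hs : PF s) (ht : PF t) :
    PF fun a => (List.zipWith Bool.xor (s a) (t a)).count true := by
  let f : Unit × (Str × ℕ) × Bool → Str × ℕ := fun x => match x.2.1.1 with
    | [] => ([], x.2.1.2)
    | b :: t => (t, bif Bool.xor x.2.2 b then x.2.1.2 + 1 else x.2.1.2)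
  have hf : PF f := PF.strCases (s := fun x : Unit × (Str × ℕ) × Bool => x.2.1.1)
    (f := fun x => ([], x.2.1.2))
    (g := fun y : (Unit × (Str × ℕ) × Bool) × Bool × Str =>
      (y.2.2, bif Bool.xor y.1.2.2 y.2.1 then y.1.2.1.2 + 1 else y.1.2.1.2))
    (by fun_prop) (by fun_prop) (by fun_prop)
  have h := PF.foldlStr hf (PB.const 1) (fun g s b => ?_) hs (PF.const ()) (ht.pair (PF.const 0))
  · refine PF.congr (h.snd) fun a => ?_
    have key : ∀ (u v : Str) (n : ℕ),
        (u.foldl (fun s b => f ((), s, b)) (v, n)).2 =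
          (List.zipWith Bool.xor u v).count true + n := by
      intro u
      induction u with
      | nil => intro v ok; simp
      | cons b u ih =>
        intro v n
        rcases v with _ | ⟨c, v⟩
        · rw [List.foldl_cons]; simp only [f]; rw [ih]; simp
        · rw [List.foldl_cons]; simp only [f]; rw [ih]
          cases b <;> cases c <;> simp [List.zipWith_cons_cons]; all_goals omega
    rw [key]; simp
  · obtain ⟨s, n⟩ := s
    rcases s with _ | ⟨c, s⟩
    · simp [f]
    · simp only [f, size_pair, size_str, size_nat, List.length_cons]
      cases Bool.xor b c <;> simp <;> omega

@[fun_prop] theorem PF.listCons {b : α → β} {l : α → List β} (hb : PF b) (hl : PF l) :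
    PF fun a => b a :: l a := (hb.pair hl).of_enc_eq fun _ => enc_cons _ _

@[fun_prop] theorem PF.listAppend {l l' : α → List β} (hl : PF l) (hl' : PF l') :
    PF fun a => l a ++ l' a := (hl.enc.strAppend hl'.enc).of_enc_eq fun _ => enc_append _ _

@[fun_prop] theorem PF.listReverse {l : α → List β} (hl : PF l) : PF fun a => (l a).reverse := by
  have := PF.foldlList (σ := List β) (γ := Unit) (f := fun x => x.2.2 :: x.2.1) (by fun_prop)
    (PB.const 1) (fun g s b => by simp only [size_cons]; omega) hl (PF.const ()) (PF.const [])
  simpa using this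

theorem PF.listFilter {p : α × β → Bool} {l : α → List β} (hp : PF p) (hl : PF l) :
    PF fun a => (l a).filter fun b => p (a, b) := by
  have := PF.foldlList (σ := List β) (γ := α)
    (f := fun x => bif p (x.1, x.2.2) then x.2.2 :: x.2.1 else x.2.1) (by fun_prop)
    (PB.const 1) (fun g s b => by cases p (g, b) <;> simp [size_cons] <;> omega) hl PF.id (PF.const [])
  refine PF.congr (this.listReverse) fun a => ?_
  have key : ∀ (l acc : List β), l.foldl (fun s b => bif p (a, b) then b :: s else s) acc =
      (l.filter fun b => p (a, b)).reverse ++ acc := by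
    intro l
    induction l with
    | nil => simp
    | cons b l ih => intro acc; cases h : p (a, b) <;> simp [h, ih]
  rw [key]; simp

end rules
end

noncomputable section
open Enc (enc)

/-! ### Simulating the CCA game without the secret key -/

/-- A hash query or a ciphertext known to the simulator: nonce `r`, message `m`, hash value
`(a, b)` and codeword `c`. -/
structure Entry where
  r : Str
  m : Str
  a : Str
  b : Str
  c : Str

/-- The random strings used in one round: a nonce, a hash value `(a, b)` and a codeword. -/
structure Block where
  r : Str
  a : Str
  b : Str
  c : Str

/-- The state of the simulator: the outcome (empty while running), the answers given so far, the
hash queries, and the ciphertexts. -/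
structure SimState where
  out : Str
  ans : List Str
  ro : List Entry
  ct : List Entry

/-- The data of the scheme and of the adversary at a fixed security parameter, public key and
fixed coins of the adversary. -/
structure Cfg where
  lam : ℕ
  k : ℕ
  t : ℕ
  l : ℕ
  n : ℕ
  θ : ℕ
  next : List Str → Str
  encode : Str → Str → Str

instance : Enc Entry := ⟨fun e => enc (e.r, e.m, e.a, e.b, e.c)⟩
instance : Enc Block := ⟨fun e => enc (e.r, e.a, e.b, e.c)⟩
instance : Enc SimState := ⟨fun s => enc (s.out, s.ans, s.ro, s.ct)⟩

/-- Both strings have length `n`, and they differ in at most `θ` places. -/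
def closeB (n θ : ℕ) (c x : Str) : Bool :=
  decide (c.length = n) && (decide (x.length = n) &&
    decide ((List.zipWith Bool.xor c x).count true ≤ θ))

/-- The entries with a given hash input. -/
def withKey (es : List Entry) (u : Str) : List Entry := es.filter fun e => decide (e.r ++ e.m = u)

/-- The entries whose codeword is close to a given string. -/
def closeTo (n θ : ℕ) (es : List Entry) (x : Str) : List Entry :=
  es.filter fun e => closeB n θ e.c x

/-- The outcome when a nonce is guessed or repeated. -/
def abortNonce : Str := [true, true]

/-- The outcome when two codewords are close to the same string. -/
def abortMatch : Str := [false, false]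

namespace SimState

def init : SimState := ⟨[], [], [], []⟩

def answer (s : SimState) (a : Str) : SimState := ⟨s.out, s.ans ++ [a], s.ro, s.ct⟩

def halt (s : SimState) (o : Str) : SimState := ⟨o, s.ans, s.ro, s.ct⟩

/-- The outcome; running out of rounds counts as the output `0`. -/
def outcome (s : SimState) : Str := bif s.out.isEmpty then [false] else s.out

end SimState

namespace Cfg

variable (C : Cfg)

/-- A repeated hash input would tie the new codeword to a hash value or ciphertext fixed before,
hence the abort. The truncations here and below change nothing for strings of the correct lengths;
they keep the state bounded on arbitrary inputs, as the running time requires. -/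
def onEncode (c : Str) (b : Block) (m : Str) (s : SimState) : SimState :=
  bif decide (m.length = C.k) then
    bif (withKey (s.ct ++ s.ro) (b.r ++ m)).isEmpty then
      ⟨s.out, s.ans ++ [c.take C.n], s.ro, ⟨b.r, m, b.a, b.b, c.take C.n⟩ :: s.ct⟩
    else s.halt abortNonce
  else s.answer []

/-- The secret key is replaced by a search among the known codewords. The answer `[]` stands for
`⊥`. -/
def onDecode (x : Str) (s : SimState) : SimState :=
  match closeTo C.n C.θ (s.ct ++ s.ro) x with
  | [] => s.answer []
  | e :: es => bif es.isEmpty then s.answer (true :: e.m.take C.k) else s.halt abortMatch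

/-- Lazy sampling. The hash value at the input of a ciphertext would have to contain the coins of
its codeword, which are unknown when the codeword comes from an external oracle; such a query halts
the simulation. -/
def onHash (b : Block) (u : Str) (s : SimState) : SimState :=
  bif decide (u.length = C.lam + C.k) then
    bif (withKey s.ct u).isEmpty then
      match withKey s.ro u with
      | [] => ⟨s.out, s.ans ++ [b.a ++ b.b],
          ⟨u.take C.lam, u.drop C.lam, b.a, b.b, (C.encode (u ++ b.b) b.a).take C.n⟩ :: s.ro, s.ct⟩
      | e :: _ => s.answer ((e.a ++ e.b).take (C.l + C.t))
    else s.halt abortNonce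
  else s.answer []

/-- The reaction to a message of the adversary; `c` is the answer to an encoding query. -/
def react (c : Str) (b : Block) (s : SimState) : Str → SimState
  | [] => s.halt [false]
  | [o] => s.halt [o]
  | false :: false :: m => C.onEncode c b m s
  | false :: true :: x => C.onDecode x s
  | true :: _ :: u => C.onHash b u s

/-- One round of the simulation. -/
def step (c : Str) (b : Block) (s : SimState) : SimState :=
  bif s.out.isEmpty then C.react c b s (C.next s.ans) else s

/-- The message of an encoding query. -/
def msg (s : SimState) : Str := (C.next s.ans).tail.tail

/-- The string encoded in answer to an encoding query. -/
def plain (b : Block) (s : SimState) : Str := b.r ++ C.msg s ++ b.b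

/-- One round of the simulation of the random or the real world. -/
def worldStep (random : Bool) (b : Block) (s : SimState) : SimState :=
  C.step (bif random then b.c else C.encode (C.plain b s) b.a) b s

/-- The next message of the adversary is a valid encoding query. -/
def isEncodeMsg : Str → Bool
  | false :: false :: m => decide (m.length = C.k)
  | _ => false

/-- A round of the simulation with a list of answers to the encoding queries. If they are used up,
the simulation waits with a pending query. -/
def extStep (b : Block) (p : SimState × List Str × Str) : SimState × List Str × Str :=
  bif p.2.2.isEmpty then
    bif p.1.out.isEmpty && C.isEncodeMsg (C.next p.1.ans) then
      match p.2.1 with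
      | [] => (p.1, [], false :: false :: C.plain b p.1)
      | c :: cs => (C.step c b p.1, cs, [])
    else (C.step [] b p.1, p.2.1, [])
  else p

/-- The number of random bits for one round. -/
def width : ℕ := C.lam + (C.l + (C.t + C.n))

def parse (x : Str) : Block :=
  ⟨x.take C.lam, (x.drop C.lam).take C.l, (x.drop (C.lam + C.l)).take C.t,
    (x.drop (C.lam + (C.l + C.t))).take C.n⟩

/-- One round of the simulation with the random bits taken from a tape. -/
def tapeStep (random : Bool) (p : Str × SimState) : Str × SimState :=
  (p.1.drop C.width, C.worldStep random (C.parse p.1) p.2)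

def tapeExtStep (p : Str × SimState × List Str × Str) : Str × SimState × List Str × Str :=
  (p.1.drop C.width, C.extStep (C.parse p.1) p.2)

/-- The attack on robustness that a decoding query in the state `s` gives. In the random world only
hash queries are considered. The flag `second` says which close codeword to use. -/
def attackOn (random second : Bool) (s : SimState) (x : Str) : Str × Str × Str :=
  match closeTo C.n C.θ (bif random then s.ro else s.ct ++ s.ro) x with
  | [] => ([], [], [])
  | e :: es => bif second then match es with
      | [] => ([], [], [])
      | e' :: _ => (e'.r ++ e'.m ++ e'.b, e'.a, x)
    else (e.r ++ e.m ++ e.b, e.a, x)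

/-- Rounds without a suitable query give the empty triple. Whether it wins is immaterial, since
winning probabilities occur only in upper bounds. -/
def attack (random second : Bool) (s : SimState) : Str × Str × Str :=
  bif s.out.isEmpty then match C.next s.ans with
    | false :: true :: x => C.attackOn random second s x
    | _ => ([], [], [])
  else ([], [], [])

end Cfg

/-- A configuration that depends on a parameter. -/
def Cfg.of {ε : Type} (lam k t l n θ : ε → ℕ) (next : ε × List Str → Str)
    (encode : ε × Str × Str → Str) (e : ε) : Cfg :=
  ⟨lam e, k e, t e, l e, n e, θ e, fun v => next (e, v), fun w r => encode (e, w, r)⟩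

/-! ### The simulator is computable in polynomial time. -/

section
variable {α : Type} [Enc α]

@[fun_prop] theorem PF.entryMk {r m a b c : α → Str} (hr : PF r) (hm : PF m) (ha : PF a)
    (hb : PF b) (hc : PF c) : PF fun x => Entry.mk (r x) (m x) (a x) (b x) (c x) :=
  PF.of_enc_eq (f := fun x => (r x, m x, a x, b x, c x)) (by fun_prop) fun _ => rfl

theorem PF.entryTuple {e : α → Entry} (he : PF e) :
    PF fun x => ((e x).r, (e x).m, (e x).a, (e x).b, (e x).c) := he.of_enc_eq fun _ => rfl

@[fun_prop] theorem PF.entryR {e : α → Entry} (he : PF e) : PF fun x => (e x).r :=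
  he.entryTuple.fst
@[fun_prop] theorem PF.entryM {e : α → Entry} (he : PF e) : PF fun x => (e x).m :=
  he.entryTuple.snd.fst
@[fun_prop] theorem PF.entryA {e : α → Entry} (he : PF e) : PF fun x => (e x).a :=
  he.entryTuple.snd.snd.fst
@[fun_prop] theorem PF.entryB {e : α → Entry} (he : PF e) : PF fun x => (e x).b :=
  he.entryTuple.snd.snd.snd.fst
@[fun_prop] theorem PF.entryC {e : α → Entry} (he : PF e) : PF fun x => (e x).c :=
  he.entryTuple.snd.snd.snd.snd

@[fun_prop] theorem PF.blockMk {r a b c : α → Str} (hr : PF r) (ha : PF a)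
    (hb : PF b) (hc : PF c) : PF fun x => Block.mk (r x) (a x) (b x) (c x) :=
  PF.of_enc_eq (f := fun x => (r x, a x, b x, c x)) (by fun_prop) fun _ => rfl

theorem PF.blockTuple {e : α → Block} (he : PF e) :
    PF fun x => ((e x).r, (e x).a, (e x).b, (e x).c) := he.of_enc_eq fun _ => rfl

@[fun_prop] theorem PF.blockR {e : α → Block} (he : PF e) : PF fun x => (e x).r :=
  he.blockTuple.fst
@[fun_prop] theorem PF.blockA {e : α → Block} (he : PF e) : PF fun x => (e x).a :=
  he.blockTuple.snd.fst
@[fun_prop] theorem PF.blockB {e : α → Block} (he : PF e) : PF fun x => (e x).b :=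
  he.blockTuple.snd.snd.fst
@[fun_prop] theorem PF.blockC {e : α → Block} (he : PF e) : PF fun x => (e x).c :=
  he.blockTuple.snd.snd.snd

@[fun_prop] theorem PF.simStateMk {o : α → Str} {v : α → List Str} {f g : α → List Entry}
    (ho : PF o) (hv : PF v) (hf : PF f) (hg : PF g) :
    PF fun x => SimState.mk (o x) (v x) (f x) (g x) :=
  PF.of_enc_eq (f := fun x => (o x, v x, f x, g x)) (by fun_prop) fun _ => rfl

theorem PF.simStateTuple {s : α → SimState} (hs : PF s) :
    PF fun x => ((s x).out, (s x).ans, (s x).ro, (s x).ct) := hs.of_enc_eq fun _ => rfl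

@[fun_prop] theorem PF.simOut {s : α → SimState} (hs : PF s) : PF fun x => (s x).out :=
  hs.simStateTuple.fst
@[fun_prop] theorem PF.simAns {s : α → SimState} (hs : PF s) : PF fun x => (s x).ans :=
  hs.simStateTuple.snd.fst
@[fun_prop] theorem PF.simRo {s : α → SimState} (hs : PF s) : PF fun x => (s x).ro :=
  hs.simStateTuple.snd.snd.fst
@[fun_prop] theorem PF.simCt {s : α → SimState} (hs : PF s) : PF fun x => (s x).ct :=
  hs.simStateTuple.snd.snd.snd

@[fun_prop] theorem PF.answer {s : α → SimState} {a : α → Str} (hs : PF s) (ha : PF a) :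
    PF fun x => (s x).answer (a x) := by unfold SimState.answer; fun_prop
@[fun_prop] theorem PF.halt {s : α → SimState} {a : α → Str} (hs : PF s) (ha : PF a) :
    PF fun x => (s x).halt (a x) := by unfold SimState.halt; fun_prop
@[fun_prop] theorem PF.outcome {s : α → SimState} (hs : PF s) :
    PF fun x => (s x).outcome := by unfold SimState.outcome; fun_prop

@[fun_prop] theorem PF.closeB {n θ : α → ℕ} {c x : α → Str} (hn : PF n) (hθ : PF θ) (hc : PF c)
    (hx : PF x) : PF fun a => closeB (n a) (θ a) (c a) (x a) := by
  unfold _root_.closeB; fun_prop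

@[fun_prop] theorem PF.withKey {es : α → List Entry} {u : α → Str} (he : PF es) (hu : PF u) :
    PF fun a => withKey (es a) (u a) :=
  PF.listFilter (p := fun p : α × Entry => decide (p.2.r ++ p.2.m = u p.1)) (by fun_prop) he

@[fun_prop] theorem PF.closeTo {n θ : α → ℕ} {es : α → List Entry} {x : α → Str} (hn : PF n)
    (hθ : PF θ) (he : PF es) (hx : PF x) : PF fun a => closeTo (n a) (θ a) (es a) (x a) :=
  PF.listFilter (p := fun p : α × Entry => _root_.closeB (n p.1) (θ p.1) p.2.c (x p.1))
    (by fun_prop) he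

variable {ε : Type} [Enc ε] {lam k t l n θ : ε → ℕ} {next : ε × List Str → Str}
  {encode : ε × Str × Str → Str}

theorem PF.cfgOnEncode (hk : PF k) (hn : PF n) : PF fun x : ε × Str × Block × Str × SimState =>
    (Cfg.of lam k t l n θ next encode x.1).onEncode x.2.1 x.2.2.1 x.2.2.2.1 x.2.2.2.2 := by
  unfold Cfg.onEncode Cfg.of; dsimp only; fun_prop

theorem PF.cfgOnDecode (hk : PF k) (hn : PF n) (hθ : PF θ) : PF fun x : ε × Str × SimState =>
    (Cfg.of lam k t l n θ next encode x.1).onDecode x.2.1 x.2.2 := by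
  refine PF.congr (PF.listCases (l := fun x : ε × Str × SimState =>
    _root_.closeTo (n x.1) (θ x.1) (x.2.2.ct ++ x.2.2.ro) x.2.1) (f := fun x => x.2.2.answer [])
    (g := fun y : (ε × Str × SimState) × Entry × List Entry => bif y.2.2.isEmpty then
      y.1.2.2.answer (true :: y.2.1.m.take (k y.1.1)) else y.1.2.2.halt abortMatch)
      (by fun_prop) (by fun_prop) (by fun_prop)) fun x => ?_
  unfold Cfg.onDecode Cfg.of
  dsimp only
  cases _root_.closeTo (n x.1) (θ x.1) (x.2.2.ct ++ x.2.2.ro) x.2.1 <;> rfl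

theorem PF.cfgOnHash (hlam : PF lam) (hk : PF k) (ht : PF t) (hl : PF l) (hn : PF n)
    (hencode : PF encode) : PF fun x : ε × Block × Str × SimState =>
      (Cfg.of lam k t l n θ next encode x.1).onHash x.2.1 x.2.2.1 x.2.2.2 := by
  have h := PF.listCases (l := fun x : ε × Block × Str × SimState =>
    _root_.withKey x.2.2.2.ro x.2.2.1)
    (f := fun x => SimState.mk x.2.2.2.out (x.2.2.2.ans ++ [x.2.1.a ++ x.2.1.b])
      (Entry.mk (x.2.2.1.take (lam x.1)) (x.2.2.1.drop (lam x.1)) x.2.1.a x.2.1.b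
        ((encode (x.1, x.2.2.1 ++ x.2.1.b, x.2.1.a)).take (n x.1)) :: x.2.2.2.ro) x.2.2.2.ct)
    (g := fun y : (ε × Block × Str × SimState) × Entry × List Entry =>
      y.1.2.2.2.answer ((y.2.1.a ++ y.2.1.b).take (l y.1.1 + t y.1.1)))
    (by fun_prop) (by fun_prop) (by fun_prop)
  have h' : PF fun x : ε × Block × Str × SimState =>
    bif decide (x.2.2.1.length = lam x.1 + k x.1) then
      bif (_root_.withKey x.2.2.2.ct x.2.2.1).isEmpty then _ else x.2.2.2.halt abortNonce
    else x.2.2.2.answer [] := PF.bif (by fun_prop) (PF.bif (by fun_prop) h (by fun_prop))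
      (by fun_prop)
  refine h'.congr fun x => ?_
  unfold Cfg.onHash Cfg.of
  dsimp only
  cases _root_.withKey x.2.2.2.ro x.2.2.1 <;> rfl

theorem PF.cfgReact (hlam : PF lam) (hk : PF k) (ht : PF t) (hl : PF l) (hn : PF n) (hθ : PF θ)
    (hencode : PF encode) : PF fun x : ε × Str × Block × SimState × Str =>
      (Cfg.of lam k t l n θ next encode x.1).react x.2.1 x.2.2.1 x.2.2.2.1 x.2.2.2.2 := by
  have h1 := PF.cfgOnEncode (lam := lam) (t := t) (l := l) (θ := θ) (next := next)
    (encode := encode) hk hn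
  have h2 := PF.cfgOnDecode (lam := lam) (t := t) (l := l) (next := next)
    (encode := encode) hk hn hθ
  have h3 := PF.cfgOnHash (θ := θ) (next := next) hlam hk ht hl hn hencode
  have h := PF.strCases (s := fun x : ε × Str × Block × SimState × Str => x.2.2.2.2) (f := fun x => x.2.2.2.1.halt [false])
    (g := fun y : (ε × Str × Block × SimState × Str) × Bool × Str => match y.2.2 with
      | [] => y.1.2.2.2.1.halt [y.2.1]
      | b :: w => bif y.2.1 then
            (Cfg.of lam k t l n θ next encode y.1.1).onHash y.1.2.2.1 w y.1.2.2.2.1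
          else bif b then (Cfg.of lam k t l n θ next encode y.1.1).onDecode w y.1.2.2.2.1
          else (Cfg.of lam k t l n θ next encode y.1.1).onEncode y.1.2.1 y.1.2.2.1 w y.1.2.2.2.1)
    (by fun_prop) (by fun_prop) ?_
  · refine h.congr fun x => ?_
    rcases x with ⟨e, c, b, s, _ | ⟨_ | _, _ | ⟨_ | _, w⟩⟩⟩ <;> rfl
  · refine PF.strCases (s := fun y : (ε × Str × Block × SimState × Str) × Bool × Str => y.2.2)
      (f := fun y => y.1.2.2.2.1.halt [y.2.1])
      (g := fun z : ((ε × Str × Block × SimState × Str) × Bool × Str) × Bool × Str => bif z.1.2.1 then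
            (Cfg.of lam k t l n θ next encode z.1.1.1).onHash z.1.1.2.2.1 z.2.2 z.1.1.2.2.2.1
          else bif z.2.1 then
            (Cfg.of lam k t l n θ next encode z.1.1.1).onDecode z.2.2 z.1.1.2.2.2.1
          else (Cfg.of lam k t l n θ next encode z.1.1.1).onEncode z.1.1.2.1 z.1.1.2.2.1 z.2.2
            z.1.1.2.2.2.1) (by fun_prop) (by fun_prop) ?_
    exact PF.bif (by fun_prop)
      (h3.comp (g := fun z : ((ε × Str × Block × SimState × Str) × Bool × Str) × Bool × Str =>
        (z.1.1.1, z.1.1.2.2.1, z.2.2, z.1.1.2.2.2.1)) (by fun_prop)) (PF.bif (by fun_prop)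
      (h2.comp (g := fun z : ((ε × Str × Block × SimState × Str) × Bool × Str) × Bool × Str =>
        (z.1.1.1, z.2.2, z.1.1.2.2.2.1)) (by fun_prop))
      (h1.comp (g := fun z : ((ε × Str × Block × SimState × Str) × Bool × Str) × Bool × Str =>
        (z.1.1.1, z.1.1.2.1, z.1.1.2.2.1, z.2.2, z.1.1.2.2.2.1)) (by fun_prop)))

theorem PF.cfgStep (hlam : PF lam) (hk : PF k) (ht : PF t) (hl : PF l) (hn : PF n) (hθ : PF θ)
    (hnext : PF next) (hencode : PF encode) : PF fun x : ε × Str × Block × SimState =>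
      (Cfg.of lam k t l n θ next encode x.1).step x.2.1 x.2.2.1 x.2.2.2 := by
  have h := PF.cfgReact (next := next) hlam hk ht hl hn hθ hencode
  refine PF.bif (c := fun x : ε × Str × Block × SimState => x.2.2.2.out.isEmpty) (by fun_prop)
    (h.comp (g := fun x : ε × Str × Block × SimState => (x.1, x.2.1, x.2.2.1, x.2.2.2,
      next (x.1, x.2.2.2.ans))) (by fun_prop)) (by fun_prop)

theorem PF.cfgWorldStep (hlam : PF lam) (hk : PF k) (ht : PF t) (hl : PF l) (hn : PF n)
    (hθ : PF θ) (hnext : PF next) (hencode : PF encode) (random : Bool) :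
    PF fun x : ε × Block × SimState =>
      (Cfg.of lam k t l n θ next encode x.1).worldStep random x.2.1 x.2.2 := by
  have h := PF.cfgStep hlam hk ht hl hn hθ hnext hencode
  refine h.comp (g := fun x : ε × Block × SimState => (x.1, (bif random then x.2.1.c else
    encode (x.1, x.2.1.r ++ (next (x.1, x.2.2.ans)).tail.tail ++ x.2.1.b, x.2.1.a)), x.2.1, x.2.2))
    (by fun_prop)

theorem PF.cfgIsEncodeMsg (hk : PF k) : PF fun x : ε × Str =>
      (Cfg.of lam k t l n θ next encode x.1).isEncodeMsg x.2 := by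
  have h := PF.strCases (s := fun x : ε × Str => x.2) (f := fun x => false)
    (g := fun y : (ε × Str) × Bool × Str => match y.2.2 with
      | [] => false
      | b :: w => bif y.2.1 || b then false else decide (w.length = k y.1.1))
    (by fun_prop) (by fun_prop) (PF.strCases (s := fun y : (ε × Str) × Bool × Str => y.2.2)
      (f := fun y => false) (g := fun z : ((ε × Str) × Bool × Str) × Bool × Str =>
        bif z.1.2.1 || z.2.1 then false else decide (z.2.2.length = k z.1.1.1))
        (by fun_prop) (by fun_prop) (by fun_prop))
  refine h.congr fun x => ?_
  rcases x with ⟨e, _ | ⟨_ | _, _ | ⟨_ | _, w⟩⟩⟩ <;> rfl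

theorem PF.cfgExtStep (hlam : PF lam) (hk : PF k) (ht : PF t) (hl : PF l) (hn : PF n)
    (hθ : PF θ) (hnext : PF next) (hencode : PF encode) :
    PF fun x : ε × Block × SimState × List Str × Str =>
      (Cfg.of lam k t l n θ next encode x.1).extStep x.2.1 x.2.2 := by
  have h := PF.cfgStep hlam hk ht hl hn hθ hnext hencode
  have h' := PF.cfgIsEncodeMsg (lam := lam) (t := t) (l := l) (n := n) (θ := θ) (next := next)
    (encode := encode) hk
  have h'' := h'.comp (g := fun x : ε × Block × SimState × List Str × Str =>
    (x.1, next (x.1, x.2.2.1.ans))) (by fun_prop)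
  have hc := PF.listCases (l := fun x : ε × Block × SimState × List Str × Str => x.2.2.2.1)
    (f := fun x => (x.2.2.1, ([] : List Str), false :: false :: (x.2.1.r ++
      (next (x.1, x.2.2.1.ans)).tail.tail ++ x.2.1.b)))
    (g := fun y : (ε × Block × SimState × List Str × Str) × Str × List Str =>
      ((Cfg.of lam k t l n θ next encode y.1.1).step y.2.1 y.1.2.1 y.1.2.2.1, y.2.2, []))
    (by fun_prop) (by fun_prop) ((h.comp (g := fun y : (ε × Block × SimState × List Str × Str) ×
      Str × List Str => (y.1.1, y.2.1, y.1.2.1, y.1.2.2.1)) (by fun_prop)).pair (by fun_prop))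
  refine PF.bif (c := fun x : ε × Block × SimState × List Str × Str => x.2.2.2.2.isEmpty)
    (by fun_prop) (PF.bif (PF.and (by fun_prop) h'') (hc.congr ?_) ((h.comp (g := fun x :
      ε × Block × SimState × List Str × Str => (x.1, [], x.2.1, x.2.2.1))
      (by fun_prop)).pair (by fun_prop))) (by fun_prop)
  intro x
  dsimp only
  cases x.2.2.2.1 <;> rfl

theorem PF.cfgParse (hlam : PF lam) (ht : PF t) (hl : PF l) (hn : PF n) : PF fun x : ε × Str =>
    (Cfg.of lam k t l n θ next encode x.1).parse x.2 := by
  unfold Cfg.parse Cfg.of; dsimp only; fun_prop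

theorem PF.cfgWidth (hlam : PF lam) (ht : PF t) (hl : PF l) (hn : PF n) : PF fun x : ε =>
    (Cfg.of lam k t l n θ next encode x).width := by
  unfold Cfg.width Cfg.of; dsimp only; fun_prop

theorem PF.cfgAttackOn (hn : PF n) (hθ : PF θ) (random second : Bool) :
    PF fun x : ε × SimState × Str =>
      (Cfg.of lam k t l n θ next encode x.1).attackOn random second x.2.1 x.2.2 := by
  have h := PF.listCases (l := fun y : (ε × SimState × Str) × Entry × List Entry => y.2.2)
    (f := fun x => (([], [], []) : Str × Str × Str))
    (g := fun z : ((ε × SimState × Str) × Entry × List Entry) × Entry × List Entry =>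
      (z.2.1.r ++ z.2.1.m ++ z.2.1.b, z.2.1.a, z.1.1.2.2)) (by fun_prop) (by fun_prop)
    (by fun_prop)
  refine (PF.listCases (l := fun x : ε × SimState × Str => _root_.closeTo (n x.1) (θ x.1)
    (bif random then x.2.1.ro else x.2.1.ct ++ x.2.1.ro) x.2.2) (f := fun x => ([], [], []))
    (by fun_prop) (by fun_prop) (PF.bif (PF.const second) h
    (g := fun y : (ε × SimState × Str) × Entry × List Entry =>
      (y.2.1.r ++ y.2.1.m ++ y.2.1.b, y.2.1.a, y.1.2.2)) (by fun_prop))).congr fun x => ?_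
  unfold Cfg.attackOn Cfg.of
  dsimp only
  rcases _root_.closeTo (n x.1) (θ x.1) (bif random then x.2.1.ro else x.2.1.ct ++ x.2.1.ro) x.2.2
    with _ | ⟨e, _ | ⟨e', es⟩⟩ <;> rfl

theorem PF.cfgAttack (hn : PF n) (hθ : PF θ) (hnext : PF next) (random second : Bool) :
    PF fun x : ε × SimState =>
      (Cfg.of lam k t l n θ next encode x.1).attack random second x.2 := by
  have h := PF.cfgAttackOn (lam := lam) (k := k) (t := t) (l := l) (next := next)
    (encode := encode) hn hθ random second
  have hm := PF.strCases (s := fun x : ε × SimState => next (x.1, x.2.ans))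
    (f := fun x => (([], [], []) : Str × Str × Str))
    (g := fun y : (ε × SimState) × Bool × Str => match y.2.2 with
      | [] => ([], [], [])
      | b :: w => bif !y.2.1 && b then
          (Cfg.of lam k t l n θ next encode y.1.1).attackOn random second y.1.2 w
        else ([], [], [])) (by fun_prop) (by fun_prop)
    (PF.strCases (s := fun y : (ε × SimState) × Bool × Str => y.2.2)
      (f := fun y => ([], [], [])) (g := fun z : ((ε × SimState) × Bool × Str) × Bool × Str =>
        bif !z.1.2.1 && z.2.1 then
          (Cfg.of lam k t l n θ next encode z.1.1.1).attackOn random second z.1.1.2 z.2.2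
        else ([], [], [])) (by fun_prop) (by fun_prop) (PF.bif (by fun_prop) (h.comp (g := fun z :
          ((ε × SimState) × Bool × Str) × Bool × Str => (z.1.1.1, z.1.1.2, z.2.2))
          (by fun_prop)) (by fun_prop)))
  refine (PF.bif (c := fun x : ε × SimState => x.2.out.isEmpty) (by fun_prop) hm
    (PF.const (([], [], []) : Str × Str × Str))).congr fun x => ?_
  simp only [Cfg.attack, Cfg.of]
  rcases next (x.1, x.2.ans) with _ | ⟨_ | _, _ | ⟨_ | _, w⟩⟩ <;> rfl

end

/-! #### The growth of the state -/

theorem size_entry (e : Entry) : size e = 2 * e.r.length + 2 * e.m.length + 2 * e.a.length +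
    2 * e.b.length + e.c.length + 4 := by
  change size (e.r, e.m, e.a, e.b, e.c) = _
  simp only [size_pair, size_str]; omega

theorem size_simState (s : SimState) : size s = 2 * s.out.length + 2 * size s.ans +
    2 * size s.ro + size s.ct + 3 := by
  change size (s.out, s.ans, s.ro, s.ct) = _
  simp only [size_pair, size_str]; omega

namespace Cfg
variable (C : Cfg)

theorem size_answer (s : SimState) (a : Str) : size (s.answer a) = size s + 4 * a.length + 2 := by
  simp only [SimState.answer, size_simState, size_append, size_cons, size_nil, size_str]; omega

theorem size_halt (s : SimState) (o : Str) : size (s.halt o) ≤ size s + 2 * o.length := by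
  simp only [SimState.halt, size_simState]; omega

/-- `PF.iterate` demands additive growth independent of the state. The truncations and the length
checks keep the codeword, the stored entries and the adversary's message out of the bound; the
factor `20` generously covers the doublings in nested pairs. -/
theorem size_step_le (c : Str) (b : Block) (s : SimState) : size (C.step c b s) ≤ size s +
    20 * (b.r.length + b.a.length + b.b.length + C.k + C.lam + C.n + C.l + C.t + 1) := by
  have hh := fun o => size_halt s o
  have ha := fun o => size_answer s o
  unfold step
  cases s.out.isEmpty
  · simp
  rcases C.next s.ans with _ | ⟨_ | _, _ | ⟨_ | _, w⟩⟩ <;>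
    simp only [cond_true, react]
  · have := hh [false]; simp at this; omega
  · have := hh [false]; simp at this; omega
  · unfold onEncode
    cases h : decide (w.length = C.k)
    · have := ha []; simp at this ⊢; omega
    · cases (withKey (s.ct ++ s.ro) (b.r ++ w)).isEmpty
      · have := hh abortNonce; simp [abortNonce] at this ⊢; omega
      · simp only [decide_eq_true_eq] at h
        simp only [cond_true, size_simState, size_append, size_cons, size_nil, size_str,
          size_entry]
        have := List.length_take_le C.n c
        omega
  · unfold onDecode
    rcases closeTo C.n C.θ (s.ct ++ s.ro) w with _ | ⟨e, es⟩
    · have := ha []; simp at this ⊢; omega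
    · cases h : es.isEmpty
      · have := hh abortMatch; simp [h, abortMatch] at this ⊢; omega
      · have := ha (true :: e.m.take C.k)
        have := List.length_take_le C.k e.m
        simp only [h, cond_true, List.length_cons] at *; omega
  · have := hh [true]; simp at this; omega
  all_goals
    unfold onHash
    cases h : decide (w.length = C.lam + C.k)
    · have := ha []; simp at this ⊢; omega
    · cases (withKey s.ct w).isEmpty
      · have := hh abortNonce; simp [abortNonce] at this ⊢; omega
      · rcases withKey s.ro w with _ | ⟨e, es⟩
        · simp only [decide_eq_true_eq] at h
          simp only [cond_true, size_simState, size_append, size_cons, size_nil, size_str,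
            size_entry, List.length_append]
          have := List.length_take_le C.n (C.encode (w ++ b.b) b.a)
          have := List.length_take_le' C.lam w
          have := List.length_drop (i := C.lam) (l := w)
          omega
        · have := ha ((e.a ++ e.b).take (C.l + C.t))
          have := List.length_take_le (C.l + C.t) (e.a ++ e.b)
          simp only [cond_true]; omega

theorem size_parse_le (x : Str) : (C.parse x).r.length ≤ C.lam ∧ (C.parse x).a.length ≤ C.l ∧
    (C.parse x).b.length ≤ C.t := by
  simp only [parse, List.length_take]; omega

/-- A bound for the growth of the state in one round. -/
def growth : ℕ := 40 * (C.k + C.lam + C.n + C.l + C.t + 1)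

theorem size_step_parse_le (c x : Str) (s : SimState) :
    size (C.step c (C.parse x) s) ≤ size s + C.growth := by
  have := C.size_step_le c (C.parse x) s
  have := C.size_parse_le x
  unfold growth; omega

theorem size_tapeStep_le (random : Bool) (p : Str × SimState) :
    size (C.tapeStep random p) ≤ size p + C.growth := by
  obtain ⟨x, s⟩ := p
  have := C.size_step_parse_le (bif random then (C.parse x).c else
    C.encode (C.plain (C.parse x) s) (C.parse x).a) x s
  simp only [tapeStep, size_pair, size_str, worldStep, List.length_drop] at this ⊢
  omega

theorem length_msg {w : Str} (h : C.isEncodeMsg w = true) : w.tail.tail.length = C.k := by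
  rcases w with _ | ⟨_ | _, _ | ⟨_ | _, w⟩⟩ <;> simp_all [isEncodeMsg]

/-- The simulator state is the first component of a pair and counts twice, whence `2 * growth`. A
pending query is short because only messages of length `k` get that far. -/
theorem size_tapeExtStep_le (p : Str × SimState × List Str × Str) :
    size (C.tapeExtStep p) ≤ size p + 2 * C.growth := by
  obtain ⟨x, s, cs, w⟩ := p
  unfold tapeExtStep extStep
  dsimp only
  have hs := C.size_parse_le x
  cases w.isEmpty
  · simp only [cond_false, size_pair, size_str, List.length_drop]; omega
  cases hw : s.out.isEmpty && C.isEncodeMsg (C.next s.ans)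
  · have := C.size_step_parse_le [] x s
    simp only [cond_true, cond_false, size_pair, size_str, List.length_drop, List.length_nil]
    omega
  rcases cs with _ | ⟨c, cs⟩
  · simp only [Bool.and_eq_true] at hw
    have := C.length_msg hw.2
    simp only [cond_true, size_pair, size_str, List.length_drop, plain, msg, size_nil,
      List.length_cons, List.length_append, growth]
    omega
  · have := C.size_step_parse_le c x s
    simp only [cond_true, size_pair, size_str, List.length_drop, List.length_nil, size_cons]
    omega

end Cfg

/-! #### The reductions -/

/-- A number below `2 q` computed from random bits. -/
def guessStep (q : ℕ) (p : ℕ × ℕ) (b : Bool) : ℕ × ℕ :=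
  bif decide (p.1 + 1 ≤ q) then (p.1 + p.1, bif b then p.2 + p.1 else p.2) else p

def guess (q : ℕ) (g : Str) : ℕ := (g.foldl (guessStep q) (1, 0)).2

section
variable {α ε : Type} [Enc α] [Enc ε] {lam k t l n θ : ε → ℕ} {next : ε × List Str → Str}
  {encode : ε × Str × Str → Str}

@[fun_prop] theorem PF.guess {q : α → ℕ} {g : α → Str} (hq : PF q) (hg : PF g) :
    PF fun a => guess (q a) (g a) := by
  refine PF.snd (PF.foldlStr (f := fun x : ℕ × (ℕ × ℕ) × Bool => guessStep x.1 x.2.1 x.2.2)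
    (D := fun q => 3 * q) (by unfold guessStep; fun_prop) ((PB.const 3).mul PF.id.pb)
    (fun q s b => ?_) hg hq (PF.const (1, 0)))
  unfold guessStep
  cases h : decide (s.1 + 1 ≤ q)
  · simp
  · simp only [decide_eq_true_eq] at h
    cases b <;> simp only [cond_true, cond_false, size_pair, size_nat] <;>
      rw [show s = (s.1, s.2) from rfl, size_pair] <;> simp only [size_nat] <;> omega

theorem PF.cfgGrowth (hlam : PF lam) (hk : PF k) (ht : PF t) (hl : PF l) (hn : PF n) :
    PF fun x : ε => (Cfg.of lam k t l n θ next encode x).growth := by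
  unfold Cfg.growth Cfg.of; dsimp only; fun_prop

theorem PF.tapeLoop (hlam : PF lam) (hk : PF k) (ht : PF t) (hl : PF l) (hn : PF n)
    (hθ : PF θ) (hnext : PF next) (hencode : PF encode) (random : Bool) {e : α → ε} {q : α → ℕ}
    {p : α → Str × SimState} (he : PF e) (hq : PF q) (hp : PF p) : PF fun a =>
      ((Cfg.of lam k t l n θ next encode (e a)).tapeStep random)^[q a] (p a) := by
  have hw := PF.cfgWidth (k := k) (θ := θ) (next := next) (encode := encode) hlam ht hl hn
  have hpa := PF.cfgParse (k := k) (θ := θ) (next := next) (encode := encode) hlam ht hl hn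
  have hs := PF.cfgWorldStep hlam hk ht hl hn hθ hnext hencode random
  refine PF.iterate (f := fun x : ε × Str × SimState =>
    (Cfg.of lam k t l n θ next encode x.1).tapeStep random x.2) ?_
    (PF.cfgGrowth (θ := θ) (next := next) (encode := encode) hlam hk ht hl hn).pb
    (fun g s => Cfg.size_tapeStep_le _ _ _) hq he hp
  exact (PF.strDrop (hw.comp (g := fun x : ε × Str × SimState => x.1) (by fun_prop))
    (by fun_prop)).pair (hs.comp (g := fun x : ε × Str × SimState => (x.1, _, x.2.2))
    (PF.pair (by fun_prop) (PF.pair (hpa.comp (g := fun x : ε × Str × SimState => (x.1, x.2.1))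
      (by fun_prop)) (by fun_prop))))

theorem PF.tapeExtLoop (hlam : PF lam) (hk : PF k) (ht : PF t) (hl : PF l) (hn : PF n)
    (hθ : PF θ) (hnext : PF next) (hencode : PF encode) {e : α → ε} {q : α → ℕ}
    {p : α → Str × SimState × List Str × Str} (he : PF e) (hq : PF q) (hp : PF p) : PF fun a =>
      (Cfg.of lam k t l n θ next encode (e a)).tapeExtStep^[q a] (p a) := by
  have hw := PF.cfgWidth (k := k) (θ := θ) (next := next) (encode := encode) hlam ht hl hn
  have hpa := PF.cfgParse (k := k) (θ := θ) (next := next) (encode := encode) hlam ht hl hn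
  have hs := PF.cfgExtStep hlam hk ht hl hn hθ hnext hencode
  refine PF.iterate (f := fun x : ε × Str × SimState × List Str × Str =>
    (Cfg.of lam k t l n θ next encode x.1).tapeExtStep x.2) ?_
    ((PB.const 2).mul
      (PF.cfgGrowth (θ := θ) (next := next) (encode := encode) hlam hk ht hl hn).pb)
    (fun g s => Cfg.size_tapeExtStep_le _ _) hq he hp
  exact (PF.strDrop (hw.comp (g := fun x : ε × Str × SimState × List Str × Str => x.1)
    (by fun_prop)) (by fun_prop)).pair (hs.comp (g := fun x : ε × Str × SimState × List Str × Str
    => (x.1, _, x.2.2)) (PF.pair (by fun_prop) (PF.pair (hpa.comp (g := fun x : ε × Str ×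
      SimState × List Str × Str => (x.1, x.2.1)) (by fun_prop)) (by fun_prop))))

end

/-! ### The efficiency hypotheses in terms of `PF`. -/

theorem LengthComputable.pf {f : ℕ → ℕ} (h : LengthComputable f) : PF f := by
  -- `encodeTuple` also closes its last string with a delimiter, so a one-element tuple is the
  -- encoding of a pair with `Unit`, not of the number alone.
  have h : PF (α := ℕ × Unit) fun x => f x.1 := by
    have h := PT.restrict (e := fun n : ℕ => encodeTuple [unary n]) (f := fun n => unary (f n)) h
      (fun x : ℕ × Unit => x.1)
    simp only [encodeTuple_cons] at h
    exact h
  exact h.comp (g := fun n => (n, ())) (by fun_prop)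

theorem enc_nextInput : (enc : ℕ × Str × Str × List Str → Str) =
    fun a => encodeTuple (unary a.1 :: a.2.1 :: a.2.2.1 :: a.2.2.2) := by
  funext a
  simp [enc, encodeTuple_cons]

theorem OracleAdversary.pf (A : OracleAdversary) :
    PF fun a : ℕ × Str × Str × List Str => A.next a.1 a.2.1 a.2.2.1 a.2.2.2 := by
  unfold PF
  rw [enc_nextInput]
  exact A.efficient

theorem PRC.Efficient.pf_encode {P : PRC} (hP : P.Efficient) :
    PF fun a : ℕ × Str × Str × Str => P.encode a.1 a.2.1 a.2.2.1 a.2.2.2 := by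
  have h : PF (α := ℕ × Str × Str × Str × Unit)
      fun a => P.encode a.1 a.2.1 a.2.2.1 a.2.2.2.1 := by
    have h := PT.restrict (e := fun a : ℕ × Str × Str × Str =>
        encodeTuple [unary a.1, a.2.1, a.2.2.1, a.2.2.2])
      (f := fun a => P.encode a.1 a.2.1 a.2.2.1 a.2.2.2) hP.encode
      (fun x : ℕ × Str × Str × Str × Unit => (x.1, x.2.1, x.2.2.1, x.2.2.2.1))
    simp only [encodeTuple_cons] at h
    exact h
  exact h.comp (g := fun a : ℕ × Str × Str × Str => (a.1, a.2.1, a.2.2.1, a.2.2.2, ()))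
    (by fun_prop)

namespace PRC

/-- The simulation for an adversary against CCA security; the parameter consists of the security
parameter, the coins of the adversary and the public key. -/
def simCfg (P : PRC) (A : OracleAdversary) (k t θ : ℕ → ℕ) (e : ℕ × Str × Str) : Cfg :=
  Cfg.of (fun e => e.1) (fun e => k e.1) (fun e => t e.1) (fun e => P.encCoins e.1)
    (fun e => P.codeLen e.1) (fun e => θ e.1) (fun p => A.next p.1.1 p.1.2.1 p.1.2.2 p.2)
    (fun p => P.encode p.1.1 p.1.2.2 p.2.1 p.2.2) e

/-- What the reductions need to be efficient; `W` bounds the number of random bits per round. -/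
structure SimEfficient (P : PRC) (k t θ : ℕ → ℕ) (W : Polynomial ℕ) : Prop where
  eff : P.Efficient
  pf_k : PF k
  pf_t : PF t
  pf_θ : PF θ
  width : ∀ lam, lam + (P.encCoins lam + (t lam + P.codeLen lam)) ≤ W.eval lam

/-- The coin length of an adversary is a polynomial, while the number of bits per round is merely a
computable length function. `W` dominates it, and the surplus coins remain unread. -/
theorem exists_simEfficient {P : PRC} (hP : P.Efficient) {k t θ : ℕ → ℕ} (hk : PF k) (ht : PF t)
    (hθ : PF θ) : ∃ W, P.SimEfficient k t θ W := by
  have h1 := hP.encCoins.pf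
  have h2 := hP.codeLen.pf
  obtain ⟨W, hW⟩ := PF.pb (f := fun lam => lam + (P.encCoins lam + (t lam + P.codeLen lam)))
    (by fun_prop)
  exact ⟨W, hP, hk, ht, hθ, fun lam => by simpa [size_nat] using hW lam⟩

variable {P : PRC} {k t θ : ℕ → ℕ} {W : Polynomial ℕ}

/-- The adversary against pseudorandomness: it simulates `A` and tests whether the outcome is
`target`. -/
def distinguisher (h : P.SimEfficient k t θ W) (A : OracleAdversary) (target : Str) :
    OracleAdversary where
  coinLen := A.coinLen + A.rounds * W
  -- Each simulated round makes at most one query, and the verdict takes one more message.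
  rounds := A.rounds + 1
  next lam coins pk answers :=
    -- A next-message function has no memory: the whole simulation is replayed on the same tape with
    -- the answers received so far, until it ends or lacks an answer.
    let p := (P.simCfg A k t θ (lam, coins.take (A.coinLen.eval lam), pk)).tapeExtStep^[
      A.rounds.eval lam] (coins.drop (A.coinLen.eval lam), SimState.init, answers, [])
    bif p.2.2.2.isEmpty then [decide (p.2.1.outcome = target)] else p.2.2.2
  efficient := by
    have hk := h.pf_k
    have ht := h.pf_t
    have hθ := h.pf_θ
    have h1 := h.eff.encCoins.pf
    have h2 := h.eff.codeLen.pf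
    have hloop := PF.tapeExtLoop (α := ℕ × Str × Str × List Str) (ε := ℕ × Str × Str)
      (lam := fun e => e.1) (k := fun e => k e.1) (t := fun e => t e.1)
      (l := fun e => P.encCoins e.1) (n := fun e => P.codeLen e.1) (θ := fun e => θ e.1)
      (next := fun p => A.next p.1.1 p.1.2.1 p.1.2.2 p.2)
      (encode := fun p => P.encode p.1.1 p.1.2.2 p.2.1 p.2.2)
      (e := fun a => (a.1, a.2.1.take (A.coinLen.eval a.1), a.2.2.1))
      (q := fun a => A.rounds.eval a.1)
      (p := fun a => (a.2.1.drop (A.coinLen.eval a.1), SimState.init, a.2.2.2, []))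
      (by fun_prop) (by fun_prop) (by fun_prop) (by fun_prop) (by fun_prop) (by fun_prop)
      (A.pf.comp (g := fun p : (ℕ × Str × Str) × List Str => (p.1.1, p.1.2.1, p.1.2.2, p.2))
        (by fun_prop))
      (h.eff.pf_encode.comp (g := fun p : (ℕ × Str × Str) × Str × Str =>
        (p.1.1, p.1.2.2, p.2.1, p.2.2)) (by fun_prop))
      (by fun_prop) (by fun_prop) (by fun_prop)
    have hfin := PF.bif (hloop.snd.snd.snd.strIsEmpty)
      ((PF.strEq hloop.snd.fst.outcome (PF.const target)).strCons (PF.const []))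
      hloop.snd.snd.snd
    unfold PF at hfin
    rw [enc_nextInput] at hfin
    exact hfin

/-- The adversary against robustness: it simulates `A` up to a random round, and uses the decoding
query in this round. -/
def attacker (h : P.SimEfficient k t θ W) (A : OracleAdversary) (random second : Bool) :
    TripleAdversary where
  -- The coins of `A`, the bits that guess a round, and the tape of the simulation.
  coinLen := A.coinLen + (A.rounds + A.rounds * W)
  out lam coins pk :=
    let C := P.simCfg A k t θ (lam, coins.take (A.coinLen.eval lam), pk)
    let rest := coins.drop (A.coinLen.eval lam)
    let q := A.rounds.eval lam
    C.attack random second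
      ((C.tapeStep random)^[guess q (rest.take q)] (rest.drop q, SimState.init)).2
  efficient := by
    have hk := h.pf_k
    have ht := h.pf_t
    have hθ := h.pf_θ
    have h1 := h.eff.encCoins.pf
    have h2 := h.eff.codeLen.pf
    have hnext := A.pf.comp (g := fun p : (ℕ × Str × Str) × List Str =>
      (p.1.1, p.1.2.1, p.1.2.2, p.2)) (by fun_prop)
    have hloop := PF.tapeLoop (α := ℕ × Str × Str × Unit) (ε := ℕ × Str × Str)
      (lam := fun e => e.1) (k := fun e => k e.1) (t := fun e => t e.1)
      (l := fun e => P.encCoins e.1) (n := fun e => P.codeLen e.1) (θ := fun e => θ e.1)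
      (next := fun p => A.next p.1.1 p.1.2.1 p.1.2.2 p.2)
      (encode := fun p => P.encode p.1.1 p.1.2.2 p.2.1 p.2.2)
      (e := fun a => (a.1, a.2.1.take (A.coinLen.eval a.1), a.2.2.1))
      (q := fun a => guess (A.rounds.eval a.1)
        ((a.2.1.drop (A.coinLen.eval a.1)).take (A.rounds.eval a.1)))
      (p := fun a => ((a.2.1.drop (A.coinLen.eval a.1)).drop (A.rounds.eval a.1), SimState.init))
      (by fun_prop) (by fun_prop) (by fun_prop) (by fun_prop) (by fun_prop) (by fun_prop)
      hnext
      (h.eff.pf_encode.comp (g := fun p : (ℕ × Str × Str) × Str × Str =>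
        (p.1.1, p.1.2.2, p.2.1, p.2.2)) (by fun_prop)) random
      (by fun_prop) (by fun_prop) (by fun_prop)
    have hatt := (PF.cfgAttack (ε := ℕ × Str × Str)
      (lam := fun e => e.1) (k := fun e => k e.1) (t := fun e => t e.1)
      (l := fun e => P.encCoins e.1) (n := fun e => P.codeLen e.1) (θ := fun e => θ e.1)
      (encode := fun p => P.encode p.1.1 p.1.2.2 p.2.1 p.2.2) (by fun_prop) (by fun_prop)
      hnext random second).comp (g := fun a : ℕ × Str × Str × Unit =>
        ((a.1, a.2.1.take (A.coinLen.eval a.1), a.2.2.1), _)) (PF.pair (by fun_prop) hloop.snd)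
    have hfin := hatt.fst.pair (hatt.snd.fst.pair (hatt.snd.snd.pair (PF.const ())))
    have := PT.restrict hfin (fun a : ℕ × Str × Str => (a.1, a.2.1, a.2.2, ()))
    unfold PolyTime
    simp only [encodeTuple_cons]
    exact this

end PRC
end

noncomputable section
open scoped ENNReal

/-! ### Expectations -/

/-- The expectation of a nonnegative function. -/
def expect {α : Type*} (p : PMF α) (f : α → ℝ≥0∞) : ℝ≥0∞ := ∑' a, p a * f a

section expect
variable {α β : Type*} (p : PMF α) {f g : α → ℝ≥0∞}

theorem bind_apply_eq_expect (q : α → PMF β) (b : β) :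
    p.bind q b = expect p fun a => q a b := PMF.bind_apply _ _ _

theorem expect_pure (a : α) (f : α → ℝ≥0∞) : expect (PMF.pure a) f = f a := by
  classical
  rw [expect, tsum_eq_single a]
  · simp [PMF.pure_apply]
  · intro b hb; simp [PMF.pure_apply, hb]

theorem expect_bind (q : α → PMF β) (f : β → ℝ≥0∞) :
    expect (p.bind q) f = expect p fun a => expect (q a) f := by
  simp only [expect, PMF.bind_apply, ← ENNReal.tsum_mul_left, ← ENNReal.tsum_mul_right]
  rw [ENNReal.tsum_comm]
  simp only [mul_assoc]

theorem expect_map (k : α → β) (f : β → ℝ≥0∞) :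
    expect (p.map k) f = expect p fun a => f (k a) := by
  simp only [PMF.map, expect_bind, Function.comp_def, expect_pure]

theorem map_apply_eq_expect [DecidableEq β] (k : α → β) (b : β) :
    p.map k b = expect p fun a => if k a = b then 1 else 0 := by
  simp only [PMF.map_apply, expect, mul_ite, mul_one, mul_zero, eq_comm]
  congr!

theorem expect_mono (h : ∀ a ∈ p.support, f a ≤ g a) : expect p f ≤ expect p g :=
  ENNReal.tsum_le_tsum fun a => by
    by_cases ha : p a = 0
    · simp [ha]
    · gcongr; exact h a ((p.mem_support_iff a).2 ha)

theorem expect_congr (h : ∀ a ∈ p.support, f a = g a) : expect p f = expect p g :=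
  le_antisymm (expect_mono p fun a ha => (h a ha).le) (expect_mono p fun a ha => (h a ha).ge)

theorem expect_add (f g : α → ℝ≥0∞) :
    expect p (fun a => f a + g a) = expect p f + expect p g := by
  simp only [expect, mul_add, ENNReal.tsum_add]

theorem expect_sum {ι : Type*} (s : Finset ι) (f : ι → α → ℝ≥0∞) :
    expect p (fun a => ∑ i ∈ s, f i a) = ∑ i ∈ s, expect p (f i) := by
  classical
  induction s using Finset.induction_on with
  | empty => simp [expect]
  | insert i s hi ih => simp only [Finset.sum_insert hi, expect_add, ih]

theorem expect_const (c : ℝ≥0∞) : expect p (fun _ => c) = c := by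
  rw [expect, ENNReal.tsum_mul_right, p.tsum_coe, one_mul]

theorem expect_mul_left (c : ℝ≥0∞) (f : α → ℝ≥0∞) :
    expect p (fun a => c * f a) = c * expect p f := by
  simp only [expect, ← ENNReal.tsum_mul_left]
  congr! 2; ring

theorem expect_le_one (h : ∀ a, f a ≤ 1) : expect p f ≤ 1 :=
  (expect_mono p fun a _ => h a).trans (expect_const p 1).le

theorem expect_comm (q : PMF β) (f : α → β → ℝ≥0∞) :
    expect p (fun a => expect q (f a)) = expect q fun b => expect p fun a => f a b := by
  simp only [expect, ← ENNReal.tsum_mul_left]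
  rw [ENNReal.tsum_comm]
  congr! 4; ring

theorem expect_uniform [Fintype α] [Nonempty α] (f : α → ℝ≥0∞) :
    expect (PMF.uniformOfFintype α) f = (Fintype.card α : ℝ≥0∞)⁻¹ * ∑ a, f a := by
  simp only [expect, PMF.uniformOfFintype_apply, tsum_fintype, Finset.mul_sum]

end expect

/-! ### Random strings -/

theorem expect_randomBits (n : ℕ) (f : Str → ℝ≥0∞) :
    expect (randomBits n) f = (2 ^ n : ℝ≥0∞)⁻¹ * ∑ v : Fin n → Bool, f (List.ofFn v) := by
  rw [randomBits, expect_map, expect_uniform]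
  simp

theorem expect_randomBits_add (m n : ℕ) (f : Str → ℝ≥0∞) : expect (randomBits (m + n)) f =
    expect (randomBits m) fun x => expect (randomBits n) fun y => f (x ++ y) := by
  simp only [expect_randomBits]
  rw [← Finset.mul_sum, ← mul_assoc, ← Fintype.sum_prod_type', pow_add,
    ENNReal.mul_inv (by simp) (by simp), ← (Fin.appendEquiv m n).sum_comp]
  congr! 2 with v
  simp [Fin.appendEquiv, List.ofFn_fin_append]

theorem length_of_mem_randomBits {n : ℕ} {x : Str} (h : x ∈ (randomBits n).support) :
    x.length = n := by
  simp only [randomBits, PMF.support_map, Set.mem_image] at h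
  obtain ⟨v, -, rfl⟩ := h
  simp

theorem expect_randomBits_eq_le (n : ℕ) (x : Str) :
    (expect (randomBits n) fun y => if y = x then 1 else 0) ≤ (2 ^ n : ℝ≥0∞)⁻¹ := by
  classical
  rw [expect_randomBits]
  refine (mul_le_mul_right (b := (∑ v : Fin n → Bool, if List.ofFn v = x then 1 else 0)) (c := 1) ?_ _).trans
    (by simp)
  rw [Finset.sum_boole]
  norm_cast
  refine Finset.card_le_one.2 fun v hv w hw => ?_
  simp only [Finset.mem_filter] at hv hw
  exact List.ofFn_injective (hv.2.trans hw.2.symm)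

/-! ### Random functions -/

/-- The basis of lazy sampling: the value at `x` may be drawn afresh. Exchanging it with an
independent uniform value is an involution of the product, so the uniform distribution is preserved.
-/
theorem expect_uniform_update {X Y : Type} [Fintype X] [DecidableEq X] [Fintype Y] [Nonempty Y]
    (x : X) (F : (X → Y) → ℝ≥0∞) : expect (PMF.uniformOfFintype (X → Y)) F =
      expect (PMF.uniformOfFintype (X → Y)) fun H => expect (PMF.uniformOfFintype Y) fun y =>
        F (Function.update H x y) := by
  simp only [expect_uniform]
  rw [← Finset.mul_sum, ← Fintype.sum_prod_type' (f := fun H y => F (Function.update H x y))]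
  let e : (X → Y) × Y ≃ (X → Y) × Y :=
    { toFun := fun p => (Function.update p.1 x p.2, p.1 x)
      invFun := fun p => (Function.update p.1 x p.2, p.1 x)
      left_inv := fun p => by simp
      right_inv := fun p => by simp }
  have : ∑ p : (X → Y) × Y, F (Function.update p.1 x p.2) = ∑ p : (X → Y) × Y, F p.1 :=
    e.sum_comp (fun p => F p.1)
  rw [this, Fintype.sum_prod_type]
  simp only [Finset.sum_const, Finset.card_univ, nsmul_eq_mul]
  rw [← Finset.mul_sum, ← mul_assoc (Fintype.card Y : ℝ≥0∞)⁻¹, ENNReal.inv_mul_cancel (by simp)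
    (by simp), one_mul]

/-- A uniformly random function from strings of length `a` to strings of length `b`. -/
def randomOracle (a b : ℕ) : PMF (Str → Str) :=
  (PMF.uniformOfFintype ((Fin a → Bool) → (Fin b → Bool))).map evalHash

theorem expect_randomOracle_update {a b : ℕ} {u : Str} (hu : u.length = a)
    (F : (Str → Str) → ℝ≥0∞) : expect (randomOracle a b) F =
      expect (randomOracle a b) fun g => expect (randomBits b) fun h =>
        F (Function.update g u h) := by
  simp only [randomOracle, expect_map, randomBits]
  rw [expect_uniform_update (fun i : Fin a => u.getD i false)]
  congr! 6 with H y
  funext w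
  by_cases hw : w = u
  · subst hw; simp [evalHash, hu]
  · rw [Function.update_of_ne hw]
    unfold evalHash
    split_ifs with hwa
    · rw [Function.update_of_ne]
      intro h
      refine hw (List.ext_getElem (hwa.trans hu.symm) fun i h1 h2 => ?_)
      have := congrFun h ⟨i, hwa ▸ h1⟩
      simpa [List.getD_eq_getElem?_getD, h1, h2] using this
    · rfl

theorem eq_nil_of_mem_randomOracle {a b : ℕ} {g : Str → Str} (hg : g ∈ (randomOracle a b).support)
    {u : Str} (hu : u.length ≠ a) : g u = [] := by
  simp only [randomOracle, PMF.support_map, Set.mem_image] at hg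
  obtain ⟨H, -, rfl⟩ := hg
  simp [evalHash, hu]

/-! ### The simulation with random coins -/

namespace Cfg
variable (C : Cfg)

def blocks : PMF Block :=
  (randomBits C.lam).bind fun r => (randomBits C.l).bind fun a => (randomBits C.t).bind fun b =>
    (randomBits C.n).map fun c => ⟨r, a, b, c⟩

/-- The state after a number of rounds. -/
def run (random : Bool) : ℕ → SimState → PMF SimState
  | 0, s => PMF.pure s
  | j + 1, s => C.blocks.bind fun b => run random j (C.worldStep random b s)

theorem expect_blocks (f : Block → ℝ≥0∞) : expect C.blocks f =
    expect (randomBits C.lam) fun r => expect (randomBits C.l) fun a =>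
      expect (randomBits C.t) fun b => expect (randomBits C.n) fun c => f ⟨r, a, b, c⟩ := by
  simp only [blocks, expect_bind, expect_map]

theorem expect_run_succ (random : Bool) (j : ℕ) (s : SimState) (f : SimState → ℝ≥0∞) :
    expect (C.run random (j + 1) s) f =
      expect C.blocks fun b => expect (C.run random j (C.worldStep random b s)) f := by
  simp only [run, expect_bind]

theorem expect_parse (f : Block → ℝ≥0∞) :
    (expect (randomBits C.width) fun x => f (C.parse x)) = expect C.blocks f := by
  simp only [width, expect_randomBits_add, expect_blocks]
  refine expect_congr _ fun r hr => expect_congr _ fun a ha => expect_congr _ fun b hb =>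
    expect_congr _ fun c hc => ?_
  have hr := length_of_mem_randomBits hr
  have ha := length_of_mem_randomBits ha
  have hb := length_of_mem_randomBits hb
  have hc := length_of_mem_randomBits hc
  congr 1
  simp only [parse, ← List.drop_drop, List.drop_left' hr, List.drop_left' ha, List.drop_left' hb,
    List.take_left' hr, List.take_left' ha, List.take_left' hb, List.take_of_length_le hc.le]

theorem parse_append {x y : Str} (hx : x.length = C.width) : C.parse (x ++ y) = C.parse x := by
  unfold width at hx
  simp only [parse, List.drop_append, List.take_append, Block.mk.injEq, List.length_drop]
  refine ⟨?_, ?_, ?_, ?_⟩ <;>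
  · refine (congrArg _ (List.take_eq_nil_iff.2 (.inl ?_))).trans (List.append_nil _)
    omega

/-- Successive rounds read disjoint stretches of the tape, which are independent; the last `extra`
bits are never reached. -/
theorem expect_tape (random : Bool) (f : SimState → ℝ≥0∞) (extra : ℕ) : ∀ (j : ℕ) (s : SimState),
    (expect (randomBits (j * C.width + extra)) fun x =>
      f ((C.tapeStep random)^[j] (x, s)).2) = expect (C.run random j s) f
  | 0, s => by simp [run, expect_pure, expect_const]
  | j + 1, s => by
    rw [show (j + 1) * C.width + extra = C.width + (j * C.width + extra) by ring,
      expect_randomBits_add, expect_run_succ, ← expect_parse]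
    refine expect_congr _ fun x hx => ?_
    rw [← expect_tape random f extra j]
    refine expect_congr _ fun y _ => ?_
    have hx := length_of_mem_randomBits hx
    rw [Function.iterate_succ_apply, tapeStep]
    simp only [List.drop_left' hx, C.parse_append hx]

theorem step_halted {c : Str} {b : Block} {s : SimState} (h : s.out ≠ []) : C.step c b s = s := by
  unfold step
  cases h' : s.out.isEmpty
  · rfl
  · exact absurd (by simpa using h') h

theorem run_halted (random : Bool) {s : SimState} (h : s.out ≠ []) : ∀ j,
    C.run random j s = PMF.pure s
  | 0 => rfl
  | j + 1 => by
    simp only [run, worldStep, C.step_halted h, run_halted random h j, PMF.bind_const]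

theorem step_running {c : Str} {b : Block} {s : SimState} (h : s.out = []) :
    C.step c b s = C.react c b s (C.next s.ans) := by
  simp [step, h]

end Cfg
end

noncomputable section
open scoped ENNReal

/-! ### The table of hash values -/

namespace Entry

/-- The hash input. -/
def key (e : Entry) : Str := e.r ++ e.m

end Entry

/-- The hash function `g`, changed at the entries of a table. -/
def override (es : List Entry) (g : Str → Str) : Str → Str :=
  es.foldr (fun e g => Function.update g e.key (e.a ++ e.b)) g

theorem override_append (es es' : List Entry) (g : Str → Str) :
    override (es ++ es') g = override es (override es' g) := List.foldr_append

theorem override_cons (e : Entry) (es : List Entry) (g : Str → Str) :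
    override (e :: es) g = Function.update (override es g) e.key (e.a ++ e.b) := rfl

theorem override_of_notMem {es : List Entry} {u : Str} (h : u ∉ es.map Entry.key) (g : Str → Str) :
    override es g u = g u := by
  induction es with
  | nil => rfl
  | cons e es ih =>
    simp only [List.map_cons, List.mem_cons, not_or] at h
    rw [override_cons, Function.update_of_ne h.1, ih h.2]

theorem override_of_mem {es : List Entry} (hes : (es.map Entry.key).Nodup) {e : Entry}
    (he : e ∈ es) (g : Str → Str) : override es g e.key = e.a ++ e.b := by
  induction es with
  | nil => simp at he
  | cons e' es ih =>
    simp only [List.map_cons, List.nodup_cons] at hes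
    rcases List.mem_cons.1 he with rfl | he
    · simp [override_cons]
    · rw [override_cons, Function.update_of_ne, ih hes.2 he]
      exact fun h => hes.1 (h ▸ List.mem_map_of_mem he)

theorem override_update {es : List Entry} {u : Str} (h : u ∉ es.map Entry.key) (g : Str → Str)
    (v : Str) : override es (Function.update g u v) = Function.update (override es g) u v := by
  induction es with
  | nil => rfl
  | cons e es ih =>
    simp only [List.map_cons, List.mem_cons, not_or] at h
    rw [override_cons, ih h.2, override_cons, Function.update_comm h.1]

theorem withKey_isEmpty {es : List Entry} {u : Str} :
    (withKey es u).isEmpty = true ↔ u ∉ es.map Entry.key := by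
  simp [withKey, Entry.key]

theorem mem_withKey {es : List Entry} {u : Str} {e : Entry} :
    e ∈ withKey es u ↔ e ∈ es ∧ e.key = u := by
  simp [withKey, Entry.key]

theorem mem_closeTo {n θ : ℕ} {es : List Entry} {x : Str} {e : Entry} :
    e ∈ closeTo n θ es x ↔ e ∈ es ∧ closeB n θ e.c x = true := by
  simp [closeTo]

theorem closeB_iff {δ : ℝ} (hδ : 0 ≤ δ) (n : ℕ) (c x : Str) :
    closeB n ⌊δ * n⌋₊ c x = true ↔ Close δ n c x := by
  simp [closeB, Close, Nat.le_floor_iff (mul_nonneg hδ (Nat.cast_nonneg n))]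

/-- The hash values known to the simulator. In the random world, the ciphertexts have none. -/
def SimState.table (random : Bool) (s : SimState) : List Entry :=
  bif random then s.ro else s.ct ++ s.ro

/-- The transcript of the CCA game. -/
def SimState.transcript (random : Bool) (s : SimState) : List (Str × Str) :=
  bif random then (s.ct.map fun e => (e.m, e.c)).reverse else []

namespace Cfg
variable (C : Cfg)

/-- The strings in the entry have the right lengths, and the codeword is correct. -/
structure Valid (e : Entry) : Prop where
  r : e.r.length = C.lam
  m : e.m.length = C.k
  a : e.a.length = C.l
  b : e.b.length = C.t
  c : e.c = C.encode (e.r ++ e.m ++ e.b) e.a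

/-- In the random world the codewords of ciphertexts are not encodings, so validity is asked of the
table only and the lengths in the ciphertexts are recorded separately. Distinct keys make the table
a function, and give two close entries different plaintexts. -/
structure Inv (random : Bool) (s : SimState) : Prop where
  valid : ∀ e ∈ s.table random, C.Valid e
  nodup : ((s.ct ++ s.ro).map Entry.key).Nodup
  ct : ∀ e ∈ s.ct, e.r.length = C.lam ∧ e.m.length = C.k

structure BlockOK (b : Block) : Prop where
  length_r : b.r.length = C.lam
  length_a : b.a.length = C.l
  length_b : b.b.length = C.t

theorem blockOK_of_mem {b : Block} (hb : b ∈ C.blocks.support) : C.BlockOK b := by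
  simp only [blocks, PMF.mem_support_bind_iff, PMF.support_map, Set.mem_image] at hb
  obtain ⟨r, hr, a, ha, b', hb', c, -, rfl⟩ := hb
  exact ⟨length_of_mem_randomBits hr, length_of_mem_randomBits ha, length_of_mem_randomBits hb'⟩

variable {C} in
theorem Inv.table_nodup {random : Bool} {s : SimState} (h : C.Inv random s) :
    ((s.table random).map Entry.key).Nodup := by
  cases random
  · exact h.nodup
  · have := h.nodup
    rw [List.map_append, List.nodup_append] at this
    exact this.2.1

variable {C} in
theorem Inv.answer {random : Bool} {s : SimState} (h : C.Inv random s) (a : Str) :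
    C.Inv random (s.answer a) := ⟨h.valid, h.nodup, h.ct⟩

/-- The configuration belongs to the given code, keys and security parameter. -/
structure Simulates (P : PRC) (δ : ℝ) (k t : ℕ → ℕ) (lam : ℕ) (pk sk : Str) : Prop where
  lam_eq : C.lam = lam
  k_eq : C.k = k lam
  t_eq : C.t = t lam
  l_eq : C.l = P.encCoins lam
  n_eq : C.n = P.codeLen lam
  θ_eq : C.θ = ⌊δ * P.codeLen lam⌋₊
  encode_eq : C.encode = P.encode lam pk
  nonneg : 0 ≤ δ
  msgLen_eq : P.msgLen lam = lam + k lam + t lam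
  length_pk : pk.length = P.pkLen lam
  length_sk : sk.length = P.skLen lam

end Cfg

/-! ### Decoding with a partially known hash function -/

namespace PRC

open Classical in
/-- The check made by the decoder. -/
def check (P : PRC) (δ : ℝ) (k : ℕ → ℕ) (lam : ℕ) (pk x : Str) (g : Str → Str) (w : Str) :
    Option Str :=
  let r := w.take lam
  let m := (w.drop lam).take (k lam)
  let R₂ := w.drop (lam + k lam)
  let h := g (r ++ m)
  if h.drop (P.encCoins lam) = R₂ ∧ Close δ (P.codeLen lam)
    (P.encode lam pk (r ++ m ++ R₂) (h.take (P.encCoins lam))) x then some m else none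

theorem cca_encode (P : PRC) (δ : ℝ) (k t : ℕ → ℕ) (lam : ℕ) (g : Str → Str) (pk m : Str) :
    (P.cca δ k t).encode lam g pk m = (randomBits lam).map fun r =>
      P.encode lam pk (r ++ m ++ (g (r ++ m)).drop (P.encCoins lam))
        ((g (r ++ m)).take (P.encCoins lam)) := rfl

theorem cca_decode (P : PRC) (δ : ℝ) (k t : ℕ → ℕ) (lam : ℕ) (g : Str → Str) (pk sk x : Str) :
    (P.cca δ k t).decode lam g pk sk x = (randomBits (P.decCoins lam)).map fun d =>
      (P.decode lam sk x d).bind (P.check δ k lam pk x g) := rfl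

/-- The triple wins the robustness game. -/
def Wins (P : PRC) (δ : ℝ) (lam : ℕ) (pk sk : Str) (w : Str × Str × Str) (d : Str) : Prop :=
  w.1.length = P.msgLen lam ∧ w.2.1.length = P.encCoins lam ∧
    Close δ (P.codeLen lam) (P.encode lam pk w.1 w.2.1) w.2.2 ∧ P.decode lam sk w.2.2 d ≠ some w.1

open Classical in
/-- The probability that the triple wins the robustness game. -/
def winProb (P : PRC) (δ : ℝ) (lam : ℕ) (pk sk : Str) (w : Str × Str × Str) : ℝ≥0∞ :=
  expect (randomBits (P.decCoins lam)) fun d => if P.Wins δ lam pk sk w d then 1 else 0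

end PRC

theorem take_append_take_drop (i j : ℕ) (w : Str) :
    w.take (i + j) = w.take i ++ (w.drop i).take j := List.take_add

namespace Cfg.Simulates

variable {C : Cfg} {P : PRC} {δ : ℝ} {k t : ℕ → ℕ} {lam : ℕ} {pk sk : Str}

theorem close_iff (hC : C.Simulates P δ k t lam pk sk) (c x : Str) :
    closeB C.n C.θ c x = true ↔ Close δ (P.codeLen lam) c x := by
  rw [hC.n_eq, hC.θ_eq, closeB_iff hC.nonneg]

theorem length_encode (hC : C.Simulates P δ k t lam pk sk) {r m a b : Str} (hr : r.length = C.lam)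
    (hm : m.length = C.k) (ha : a.length = C.l) (hb : b.length = C.t) :
    (C.encode (r ++ m ++ b) a).length = C.n := by
  rw [hC.encode_eq, hC.n_eq]
  refine P.encode_length lam pk _ _ hC.length_pk ?_ (ha.trans hC.l_eq)
  rw [hC.msgLen_eq, List.length_append, List.length_append, hr, hm, hb, hC.lam_eq, hC.k_eq, hC.t_eq]

/-- The hash value at the key is `a ++ b`: the tag agrees, and re-encoding reproduces the stored
codeword. -/
theorem check_hit (hC : C.Simulates P δ k t lam pk sk) {es : List Entry}
    (hes : (es.map Entry.key).Nodup) {e : Entry} (he : e ∈ es) (hv : C.Valid e) {x : Str}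
    (hx : closeB C.n C.θ e.c x = true) (g : Str → Str) :
    P.check δ k lam pk x (override es g) (e.r ++ e.m ++ e.b) = some e.m := by
  have hr := hv.r.trans hC.lam_eq
  have hm := hv.m.trans hC.k_eq
  have ha := hv.a.trans hC.l_eq
  have hrm : (e.r ++ e.m).length = lam + k lam := by simp [hr, hm]
  have hg := override_of_mem hes he g
  unfold Entry.key at hg
  rw [hv.c, hC.close_iff, hC.encode_eq] at hx
  have h1 : (e.r ++ e.m ++ e.b).take lam = e.r := by rw [List.append_assoc, List.take_left' hr]
  have h2 : ((e.r ++ e.m ++ e.b).drop lam).take (k lam) = e.m := by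
    rw [List.append_assoc, List.drop_left' hr, List.take_left' hm]
  refine (if_pos ⟨?_, ?_⟩).trans (congrArg some h2)
  · rw [h1, h2, hg, List.drop_left' ha, List.drop_left' hrm]
  · rw [h1, h2, hg, List.take_left' ha, List.drop_left' hrm]
    exact hx

theorem wins (hC : C.Simulates P δ k t lam pk sk) {e : Entry} (hv : C.Valid e) {x d : Str}
    (hx : closeB C.n C.θ e.c x = true) (hd : P.decode lam sk x d ≠ some (e.r ++ e.m ++ e.b)) :
    P.Wins δ lam pk sk (e.r ++ e.m ++ e.b, e.a, x) d := by
  refine ⟨?_, hv.a.trans hC.l_eq, ?_, hd⟩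
  · rw [hC.msgLen_eq, List.length_append, List.length_append, hv.r, hv.m, hv.b, hC.lam_eq,
      hC.k_eq, hC.t_eq]
  · rw [← hC.close_iff, ← hC.encode_eq, ← hv.c]
    exact hx

/-- If the decoded hash input were in the table, the tag check would make the re-encoding equal to
the codeword of that entry, which is not close to `x`. Acceptance therefore hinges on a hash value
not sampled yet. -/
theorem check_miss (hC : C.Simulates P δ k t lam pk sk) {es : List Entry}
    (hes : (es.map Entry.key).Nodup) (hv : ∀ e ∈ es, C.Valid e) {x : Str}
    (hx : closeTo C.n C.θ es x = []) (g : Str → Str) {w m : Str}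
    (h : P.check δ k lam pk x (override es g) w = some m) :
    w.take (lam + k lam) ∉ es.map Entry.key ∧
      (g (w.take (lam + k lam))).drop (P.encCoins lam) = w.drop (lam + k lam) := by
  unfold PRC.check at h
  dsimp only at h
  split_ifs at h with hc
  obtain ⟨h1, h2⟩ := hc
  rw [← take_append_take_drop] at h1 h2
  have key : w.take (lam + k lam) ∉ es.map Entry.key := fun hmem => by
    obtain ⟨e, he, hew⟩ := List.mem_map.1 hmem
    have hg := override_of_mem hes he g
    rw [← hew, hg] at h1 h2
    have ha := (hv e he).a.trans hC.l_eq
    rw [List.drop_left' ha] at h1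
    rw [← h1, List.take_left' ha, ← hC.encode_eq] at h2
    unfold Entry.key at h2
    rw [← (hv e he).c, ← hC.close_iff] at h2
    have : e ∈ closeTo C.n C.θ es x := mem_closeTo.2 ⟨he, h2⟩
    simp [hx] at this
  rw [override_of_notMem key] at h1
  exact ⟨key, h1⟩

end Cfg.Simulates

/-- Evaluating a random function at a point outside of the table. -/
theorem expect_override_update {es : List Entry} {u : Str} {N l t : ℕ} (hu : u.length = N)
    (hnot : u ∉ es.map Entry.key) (F : (Str → Str) → ℝ≥0∞) :
    (expect (randomOracle N (l + t)) fun g => F (override es g)) =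
      expect (randomBits l) fun a => expect (randomBits t) fun b =>
        expect (randomOracle N (l + t)) fun g => F (Function.update (override es g) u (a ++ b)) := by
  rw [expect_randomOracle_update hu, expect_comm, expect_randomBits_add]
  simp only [override_update hnot]

theorem expect_randomOracle_drop_le {u : Str} {N l t : ℕ} (hu : u.length = N) (z : Str) :
    (expect (randomOracle N (l + t)) fun g => if (g u).drop l = z then 1 else 0) ≤
      (2 ^ t : ℝ≥0∞)⁻¹ := by
  have h := expect_override_update (es := []) (l := l) (t := t) hu (by simp)
    (fun g => if (g u).drop l = z then 1 else 0)
  simp only [override, List.foldr_nil, Function.update_self, expect_const] at h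
  refine h.trans_le ?_
  rw [← expect_const (randomBits l) (2 ^ t : ℝ≥0∞)⁻¹]
  refine expect_mono _ fun a ha => ?_
  simp only [List.drop_left' (length_of_mem_randomBits ha)]
  exact expect_randomBits_eq_le t z

/-! ### Comparing the CCA game with the simulation -/

section game

variable (C : Cfg) (P : PRC) (δ : ℝ) (k t : ℕ → ℕ) (lam : ℕ) (pk sk : Str) (random : Bool)
  (o : Bool)

/-- The probability of the output `o` in the rest of the CCA game, after the simulated state `s`. -/
def gameProb (j : ℕ) (s : SimState) : ℝ≥0∞ :=
  if s.out = [] then expect (randomOracle (lam + k lam) (P.encCoins lam + t lam)) fun g =>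
    interact ((P.cca δ k t).ccaOracle δ lam random pk sk (override (s.table random) g)) C.next j
      s.ans (s.transcript random) o
  else if s.outcome = [o] then 1 else 0

/-- The probability that the simulated state `s` leads to a win in the robustness game. -/
def attackProb (second : Bool) (s : SimState) : ℝ≥0∞ :=
  P.winProb δ lam pk sk (C.attack random second s)

variable {C P δ k t lam pk sk random o}

/-! ### One round of the game, by the kind of query. -/

theorem gameProb_halt {j : ℕ} {s : SimState} {w : Str} (hw : w.length ≠ 1) (hw' : w ≠ []) :
    gameProb C P δ k t lam pk sk random o j (s.halt w) = 0 := by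
  have : ¬ w.isEmpty = true := by simpa using hw'
  simp only [gameProb, SimState.halt, hw', SimState.outcome, this, if_false, cond_false]
  rw [if_neg]
  rintro rfl
  simp at hw

theorem gameProb_running {j : ℕ} {s : SimState} (h : s.out = []) :
    gameProb C P δ k t lam pk sk random o j s =
      expect (randomOracle (lam + k lam) (P.encCoins lam + t lam)) fun g =>
        interact ((P.cca δ k t).ccaOracle δ lam random pk sk (override (s.table random) g)) C.next
          j s.ans (s.transcript random) o := if_pos h

theorem gameProb_answer {j : ℕ} {s : SimState} (h : s.out = []) (a : Str) :
    gameProb C P δ k t lam pk sk random o j (s.answer a) =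
      expect (randomOracle (lam + k lam) (P.encCoins lam + t lam)) fun g =>
        interact ((P.cca δ k t).ccaOracle δ lam random pk sk (override (s.table random) g)) C.next
          j (s.ans ++ [a]) (s.transcript random) o := if_pos h

theorem interact_query {S : Type} {oracle : Bool × Bool → Str → S → PMF (Str × S)}
    {next : List Str → Str} {j : ℕ} {ans : List Str} {st : S} {b b' : Bool} {q : Str}
    (h : next ans = b :: b' :: q) (o : Bool) : interact oracle next (j + 1) ans st o =
      expect (oracle (b, b') q st) fun r => interact oracle next j (ans ++ [r.1]) r.2 o := by
  rw [interact, h]; rfl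

/-- On a nonce collision the simulator aborts and contributes `0`, hence an inequality. Otherwise,
in the real world, the hash function is unsampled at the new key, so the coins and the tag of the
round may serve as its value there. -/
theorem gameProb_encode (hC : C.Simulates P δ k t lam pk sk) {s : SimState} {j : ℕ} {m : Str}
    (hs : s.out = []) (hinv : C.Inv random s) (hnext : C.next s.ans = false :: false :: m) :
    (expect C.blocks fun b => gameProb C P δ k t lam pk sk random o j (C.worldStep random b s)) ≤
      gameProb C P δ k t lam pk sk random o (j + 1) s := by
  have hstep : ∀ b, C.worldStep random b s =
      C.onEncode (bif random then b.c else C.encode (b.r ++ m ++ b.b) b.a) b m s := fun b => by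
    simp [Cfg.worldStep, C.step_running hs, hnext, Cfg.react, Cfg.plain, Cfg.msg]
  simp only [hstep, gameProb_running hs, interact_query hnext, ROCode.ccaOracle]
  by_cases hm : m.length = C.k
  swap
  · have hm' : m.length ≠ (P.cca δ k t).msgLen lam := fun h => hm (h.trans hC.k_eq.symm)
    simp only [Cfg.onEncode, hm, decide_false, cond_false, gameProb_answer hs, if_neg hm',
      expect_pure, expect_const, le_refl]
  have hm' : m.length = (P.cca δ k t).msgLen lam := hm.trans hC.k_eq
  have hmk : m.length = k lam := hm.trans hC.k_eq
  simp only [if_pos hm']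
  simp only [Cfg.onEncode, hm, decide_true, cond_true]
  cases random
  · simp only [Bool.false_eq_true, if_false, expect_map, cond_false]
    simp only [PRC.cca_encode, expect_map]
    -- The nonce is drawn before the hash function, so that the latter can be resampled at a fixed
    -- key.
    rw [expect_comm (randomOracle _ _)]
    simp only [Cfg.expect_blocks, hC.lam_eq]
    refine expect_mono _ fun r hr => ?_
    have hr := length_of_mem_randomBits hr
    by_cases hkey : r ++ m ∈ (s.ct ++ s.ro).map Entry.key
    · have : (withKey (s.ct ++ s.ro) (r ++ m)).isEmpty = false := by
        rw [Bool.eq_false_iff]; exact fun h => withKey_isEmpty.1 h hkey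
      simp only [this, cond_false, abortNonce, gameProb_halt (show [true, true].length ≠ 1 by simp)
        (show [true, true] ≠ [] by simp), expect_const, zero_le]
    have : (withKey (s.ct ++ s.ro) (r ++ m)).isEmpty = true := withKey_isEmpty.2 hkey
    simp only [this, cond_true]
    refine le_of_le_of_eq ?_ (expect_override_update (by rw [List.length_append, hr, hmk]) hkey
      fun G => interact ((P.cca δ k t).ccaOracle δ lam false pk sk G) C.next j
        (s.ans ++ [P.encode lam pk (r ++ m ++ (G (r ++ m)).drop (P.encCoins lam))
          ((G (r ++ m)).take (P.encCoins lam))]) (s.transcript false) o).symm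
    rw [hC.l_eq, hC.t_eq]
    refine expect_mono _ fun a ha => expect_mono _ fun b hb => ?_
    have ha := length_of_mem_randomBits ha
    have hb := length_of_mem_randomBits hb
    rw [expect_const, gameProb_running (by exact hs), List.take_of_length_le
      (hC.length_encode (hr.trans hC.lam_eq.symm) hm (ha.trans hC.l_eq.symm) (hb.trans hC.t_eq.symm)).le]
    simp only [Function.update_self, List.drop_left' ha, List.take_left' ha, hC.encode_eq]
    exact le_rfl
  · simp only [if_true, expect_map, cond_true]
    rw [expect_comm]
    simp only [Cfg.expect_blocks]
    rw [← expect_const (randomBits C.lam) (expect (randomBits ((P.cca δ k t).codeLen lam)) _)]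
    refine expect_mono _ fun r _ => ?_
    rw [← expect_const (randomBits C.l) (expect (randomBits ((P.cca δ k t).codeLen lam)) _)]
    refine expect_mono _ fun a _ => ?_
    rw [← expect_const (randomBits C.t) (expect (randomBits ((P.cca δ k t).codeLen lam)) _)]
    refine expect_mono _ fun b _ => ?_
    rw [hC.n_eq]
    refine expect_mono _ fun c hc => ?_
    cases (withKey (s.ct ++ s.ro) (r ++ m)).isEmpty
    · simp only [cond_false, abortNonce, gameProb_halt (show [true, true].length ≠ 1 by simp)
        (show [true, true] ≠ [] by simp), zero_le]
    · rw [cond_true, gameProb_running (by exact hs), List.take_of_length_le (length_of_mem_randomBits hc).le]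
      simp only [SimState.transcript, cond_true, List.map_cons, List.reverse_cons]
      exact le_rfl

/-- Aborting at the key of a ciphertext only loses probability. Any other query is either read from
the table or sampled afresh at a point outside it. -/
theorem gameProb_hash (hC : C.Simulates P δ k t lam pk sk) {s : SimState} {j : ℕ} {u : Str}
    {b' : Bool} (hs : s.out = []) (hinv : C.Inv random s)
    (hnext : C.next s.ans = true :: b' :: u) :
    (expect C.blocks fun b => gameProb C P δ k t lam pk sk random o j (C.worldStep random b s)) ≤
      gameProb C P δ k t lam pk sk random o (j + 1) s := by
  have hstep : ∀ b, C.worldStep random b s = C.onHash b u s := fun b => by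
    simp [Cfg.worldStep, C.step_running hs, hnext, Cfg.react]
  simp only [hstep, gameProb_running hs, interact_query hnext, ROCode.ccaOracle, expect_pure]
  by_cases hu : u.length = C.lam + C.k
  swap
  · simp only [Cfg.onHash, hu, decide_false, cond_false, gameProb_answer hs, expect_const]
    refine expect_mono _ fun g hg => ?_
    rw [override_of_notMem, eq_nil_of_mem_randomOracle hg (by rwa [hC.lam_eq, hC.k_eq] at hu)]
    intro hmem
    obtain ⟨e, he, rfl⟩ := List.mem_map.1 hmem
    exact hu (by rw [Entry.key, List.length_append, (hinv.valid e he).r, (hinv.valid e he).m])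
  by_cases hct : u ∈ s.ct.map Entry.key
  · have : (withKey s.ct u).isEmpty = false := by
      rw [Bool.eq_false_iff]; exact fun h => withKey_isEmpty.1 h hct
    simp only [Cfg.onHash, hu, decide_true, cond_true, this, cond_false, abortNonce,
      gameProb_halt (show [true, true].length ≠ 1 by simp) (show [true, true] ≠ [] by simp),
      expect_const, zero_le]
  have hct' : (withKey s.ct u).isEmpty = true := withKey_isEmpty.2 hct
  simp only [Cfg.onHash, hu, decide_true, cond_true, hct']
  rcases hro : withKey s.ro u with _ | ⟨e, es⟩
  · have hro : u ∉ s.ro.map Entry.key := withKey_isEmpty.1 (by simp [hro])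
    have htab : u ∉ (s.table random).map Entry.key := by
      cases random
      · simpa [SimState.table] using ⟨by simpa using hct, by simpa using hro⟩
      · exact hro
    refine le_of_le_of_eq ?_ (expect_override_update (by rw [hu, hC.lam_eq, hC.k_eq]) htab
      fun G => interact ((P.cca δ k t).ccaOracle δ lam random pk sk G) C.next j
        (s.ans ++ [G u]) (s.transcript random) o).symm
    rw [Cfg.expect_blocks, hC.l_eq, hC.t_eq, ← expect_const (randomBits C.lam) (expect (randomBits (P.encCoins lam)) _)]
    refine expect_mono _ fun _ _ => expect_mono _ fun a _ => expect_mono _ fun b _ => ?_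
    dsimp only
    rw [expect_const, gameProb_running (by exact hs)]
    simp only [Function.update_self]
    refine expect_mono _ fun g _ => ?_
    have hkey : Entry.key ⟨u.take C.lam, u.drop C.lam, a, b, (C.encode (u ++ b) a).take C.n⟩ = u :=
      List.take_append_drop _ _
    refine le_of_eq ?_
    rw [show override (SimState.table random ⟨s.out, s.ans ++ [a ++ b], ⟨u.take C.lam,
      u.drop C.lam, a, b, (C.encode (u ++ b) a).take C.n⟩ :: s.ro, s.ct⟩) g =
      Function.update (override (s.table random) g) u (a ++ b) from ?_]
    · rfl
    cases random
    -- In the real world the new entry sits behind the ciphertexts; its key is none of theirs, so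
    -- the updates commute.
    · simp only [SimState.table, cond_false, override_append, override_cons, hkey]
      rw [override_update hct]
    · simp only [SimState.table, cond_true, override_cons, hkey]
  · obtain ⟨he, hkey⟩ := mem_withKey.1 (hro ▸ List.mem_cons_self : e ∈ withKey s.ro u)
    have hetab : e ∈ s.table random := by cases random <;> simp [SimState.table, he]
    have hv := hinv.valid e hetab
    simp only [gameProb_answer hs, expect_const]
    refine expect_mono _ fun g _ => ?_
    rw [← hkey, override_of_mem hinv.table_nodup hetab, List.take_of_length_le
      (by rw [List.length_append, hv.a, hv.b])]

theorem closeTo_append (n θ : ℕ) (es es' : List Entry) (x : Str) :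
    closeTo n θ (es ++ es') x = closeTo n θ es x ++ closeTo n θ es' x := List.filter_append _ _

theorem mem_matching (hC : C.Simulates P δ k t lam pk sk) {s : SimState} {x m : Str} :
    m ∈ ROCode.matching δ (P.codeLen lam) (s.transcript true) x ↔
      ∃ e ∈ closeTo C.n C.θ s.ct x, e.m = m := by
  simp only [ROCode.matching, SimState.transcript, cond_true, Finset.mem_image, Finset.mem_filter,
    List.mem_toFinset, List.mem_reverse, List.mem_map, mem_closeTo, hC.close_iff]
  constructor
  · rintro ⟨_, ⟨⟨e, he, rfl⟩, hx⟩, rfl⟩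
    exact ⟨e, ⟨he, hx⟩, rfl⟩
  · rintro ⟨e, ⟨he, hx⟩, rfl⟩
    exact ⟨(e.m, e.c), ⟨⟨e, he, rfl⟩, hx⟩, rfl⟩

/-- The answer to a decoding query that is not close to the transcript. -/
theorem expect_decoder (hC : C.Simulates P δ k t lam pk sk) {s : SimState} {x : Str}
    (h : random = true → closeTo C.n C.θ s.ct x = []) (g : Str → Str)
    (F : Str × List (Str × Str) → ℝ≥0∞) :
    expect ((P.cca δ k t).ccaOracle δ lam random pk sk g (false, true) x (s.transcript random)) F =
      expect (randomBits (P.decCoins lam)) fun d =>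
        F (answerString ((P.decode lam sk x d).bind (P.check δ k lam pk x g)),
          s.transcript random) := by
  unfold ROCode.ccaOracle
  dsimp only
  rw [dif_neg, expect_map, PRC.cca_decode, expect_map]
  rintro ⟨rfl, m, hm⟩
  obtain ⟨e, he, -⟩ := (mem_matching hC).1 hm
  simp [h rfl] at he

/-- For fixed decoder coins the decoded string does not depend on the hash function, so acceptance
amounts to hitting a prescribed value of `t` uniform bits. -/
theorem prob_check_miss_le (hC : C.Simulates P δ k t lam pk sk) {es : List Entry}
    (hes : (es.map Entry.key).Nodup) (hv : ∀ e ∈ es, C.Valid e) {x : Str}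
    (hx : closeTo C.n C.θ es x = []) : (expect (randomOracle (lam + k lam) (P.encCoins lam + t lam))
      fun g => expect (randomBits (P.decCoins lam)) fun d =>
        if ((P.decode lam sk x d).bind (P.check δ k lam pk x (override es g))).isSome then 1 else 0)
      ≤ (2 ^ t lam : ℝ≥0∞)⁻¹ := by
  rw [expect_comm, ← expect_const (randomBits (P.decCoins lam)) (2 ^ t lam : ℝ≥0∞)⁻¹]
  refine expect_mono _ fun d hd => ?_
  rcases hw : P.decode lam sk x d with _ | w
  · simp [expect_const]
  have hlen := P.decode_length lam sk x d w hC.length_sk (length_of_mem_randomBits hd) hw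
  rw [hC.msgLen_eq] at hlen
  refine (expect_mono _ fun g _ => ?_).trans (expect_randomOracle_drop_le
    (u := w.take (lam + k lam)) (by rw [List.length_take]; omega) (w.drop (lam + k lam)))
  rcases hm : P.check δ k lam pk x (override es g) w with _ | m
  · simp [hm]
  · rw [if_pos (hC.check_miss hes hv hx g hm).2]
    split_ifs <;> simp

/-- Without a close codeword the loss is the chance of hitting a tag. If the only one is a
ciphertext in the random world, the transcript admits just its message and nothing is lost. For any
other single match its coins are known, so either the decoder recovers the plaintext or the attack
wins. With two matches the simulator aborts and the left side is `0`. -/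
theorem gameProb_decode (hC : C.Simulates P δ k t lam pk sk) {s : SimState} {j : ℕ} {x : Str}
    (hs : s.out = []) (hinv : C.Inv random s) (hnext : C.next s.ans = false :: true :: x) :
    (expect C.blocks fun b => gameProb C P δ k t lam pk sk random o j (C.worldStep random b s)) ≤
      gameProb C P δ k t lam pk sk random o (j + 1) s +
        (attackProb C P δ lam pk sk random false s + (2 ^ t lam : ℝ≥0∞)⁻¹) := by
  have hstep : ∀ b, C.worldStep random b s = C.onDecode x s := fun b => by
    simp [Cfg.worldStep, C.step_running hs, hnext, Cfg.react]
  simp only [hstep, expect_const, gameProb_running hs, interact_query hnext]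
  rcases hL : closeTo C.n C.θ (s.ct ++ s.ro) x with _ | ⟨e, _ | ⟨e', es⟩⟩
  · have hL' := hL
    rw [closeTo_append, List.append_eq_nil_iff] at hL'
    have hT : closeTo C.n C.θ (s.table random) x = [] := by
      cases random
      · exact hL
      · exact hL'.2
    simp only [Cfg.onDecode, hL, gameProb_answer hs, expect_decoder hC fun _ => hL'.1]
    refine le_trans ?_ (add_le_add_right (le_add_left (prob_check_miss_le hC hinv.table_nodup
      hinv.valid hT)) _)
    rw [← expect_add]
    refine expect_mono _ fun g _ => ?_
    rw [← expect_add, ← expect_const (randomBits (P.decCoins lam)) (interact _ _ _ _ _ _)]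
    refine expect_mono _ fun d _ => ?_
    rcases (P.decode lam sk x d).bind (P.check δ k lam pk x (override (s.table random) g)) with _ | m
    · exact le_add_right le_rfl
    · exact le_add_left ((PMF.coe_le_one _ _).trans (by simp))
  · have he : e ∈ s.ct ++ s.ro ∧ closeB C.n C.θ e.c x = true := mem_closeTo.1 (by simp [hL])
    have hm : e.m.take C.k = e.m := List.take_of_length_le (by
      rcases List.mem_append.1 he.1 with h | h
      · exact (hinv.ct e h).2.le
      · exact (hinv.valid e (by cases random <;> simp [SimState.table, h])).m.le)
    simp only [Cfg.onDecode, hL, List.isEmpty_nil, cond_true, hm, gameProb_answer hs]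
    by_cases hct : random = true ∧ closeTo C.n C.θ s.ct x = [e]
    · obtain ⟨rfl, hct⟩ := hct
      refine le_add_right (expect_mono _ fun g _ => ?_)
      have hne : (ROCode.matching δ (P.cca δ k t |>.codeLen lam) (s.transcript true) x).Nonempty :=
        ⟨e.m, (mem_matching hC).2 ⟨e, by simp [hct], rfl⟩⟩
      unfold ROCode.ccaOracle
      dsimp only
      rw [dif_pos ⟨rfl, hne⟩, expect_map, ← expect_const (PMF.uniformOfFinset _ hne)
        (interact _ _ _ _ _ _)]
      refine expect_mono _ fun m hm' => ?_
      rw [PMF.mem_support_uniformOfFinset_iff] at hm'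
      obtain ⟨e', he', rfl⟩ := (mem_matching hC).1 hm'
      rw [hct, List.mem_singleton] at he'
      subst he'
      exact le_rfl
    have hT : closeTo C.n C.θ (s.table random) x = [e] ∧
        (random = true → closeTo C.n C.θ s.ct x = []) := by
      cases random
      · exact ⟨hL, by simp⟩
      · rw [closeTo_append, List.append_eq_singleton_iff] at hL
        rcases hL with h | h
        · exact ⟨h.2, fun _ => h.1⟩
        · exact absurd ⟨rfl, h.1⟩ hct
    have heT : e ∈ s.table random := (mem_closeTo.1 (by simp [hT.1] : e ∈ closeTo C.n C.θ _ x)).1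
    have hv := hinv.valid e heT
    have hatt : C.attack random false s = (e.r ++ e.m ++ e.b, e.a, x) := by
      have := hT.1
      unfold SimState.table at this
      simp [Cfg.attack, hs, hnext, Cfg.attackOn, this]
    simp only [expect_decoder hC hT.2, attackProb, PRC.winProb, hatt]
    refine le_trans ?_ (add_le_add_right (le_add_right le_rfl) _)
    rw [← expect_const (randomOracle (lam + k lam) (P.encCoins lam + t lam))
      (expect (randomBits (P.decCoins lam)) _), ← expect_add]
    refine expect_mono _ fun g _ => ?_
    rw [← expect_add, ← expect_const (randomBits (P.decCoins lam)) (interact _ _ _ _ _ _)]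
    refine expect_mono _ fun d _ => ?_
    by_cases hd : P.decode lam sk x d = some (e.r ++ e.m ++ e.b)
    · rw [hd, Option.bind_some, hC.check_hit hinv.table_nodup heT hv he.2]
      exact le_add_right le_rfl
    · rw [if_pos]
      · exact le_add_left (PMF.coe_le_one _ _)
      · rw [hatt]
        exact hC.wins hv he.2 hd
  · simp only [Cfg.onDecode, hL, List.isEmpty_cons, cond_false, abortMatch,
      gameProb_halt (show [false, false].length ≠ 1 by simp) (show [false, false] ≠ [] by simp),
      zero_le]

/-- One round of the simulation. -/
theorem gameProb_step (hC : C.Simulates P δ k t lam pk sk) {s : SimState} {j : ℕ}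
    (hs : s.out = []) (hinv : C.Inv random s) :
    (expect C.blocks fun b => gameProb C P δ k t lam pk sk random o j (C.worldStep random b s)) ≤
      gameProb C P δ k t lam pk sk random o (j + 1) s +
        (attackProb C P δ lam pk sk random false s + (2 ^ t lam : ℝ≥0∞)⁻¹) := by
  rcases hnext : C.next s.ans with _ | ⟨b, _ | ⟨b', w⟩⟩
  · have hstep : ∀ b, C.worldStep random b s = s.halt [false] := fun b => by
      simp [Cfg.worldStep, C.step_running hs, hnext, Cfg.react]
    simp only [hstep, expect_const, gameProb_running hs]
    refine le_add_right ?_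
    rw [gameProb, if_neg (by simp [SimState.halt])]
    simp only [interact, hnext, expect_const]
    cases o <;> simp [SimState.halt, SimState.outcome]
  · have hstep : ∀ c, C.worldStep random c s = s.halt [b] := fun c => by
      simp [Cfg.worldStep, C.step_running hs, hnext, Cfg.react]
    simp only [hstep, expect_const, gameProb_running hs]
    refine le_add_right ?_
    rw [gameProb, if_neg (by simp [SimState.halt])]
    simp only [interact, hnext, expect_const]
    cases o <;> cases b <;> simp [SimState.halt, SimState.outcome]
  · cases b
    · cases b'
      · exact le_add_right (gameProb_encode hC hs hinv hnext)
      · exact gameProb_decode hC hs hinv hnext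
    · exact le_add_right (gameProb_hash hC hs hinv hnext)

/-! ### The invariant, and the losses summed over all rounds. -/

theorem inv_worldStep (hC : C.Simulates P δ k t lam pk sk) {s : SimState}
    (hinv : C.Inv random s) {b : Block} (hb : C.BlockOK b) :
    C.Inv random (C.worldStep random b s) := by
  have halt : ∀ w, C.Inv random (s.halt w) := fun w => ⟨hinv.valid, hinv.nodup, hinv.ct⟩
  by_cases hs : s.out = []
  swap
  · rwa [Cfg.worldStep, C.step_halted hs]
  rw [Cfg.worldStep, C.step_running hs]
  rcases hnext : C.next s.ans with _ | ⟨_ | _, _ | ⟨_ | _, w⟩⟩ <;> simp only [Cfg.react]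
  · exact halt _
  · exact halt _
  · unfold Cfg.onEncode
    by_cases hw : w.length = C.k
    swap
    · simpa [hw] using hinv.answer []
    cases hkey : (withKey (s.ct ++ s.ro) (b.r ++ w)).isEmpty
    · simpa [hw, hkey] using halt _
    simp only [hw, decide_true, cond_true]
    rw [withKey_isEmpty] at hkey
    refine ⟨fun e he => ?_, List.nodup_cons.2 ⟨hkey, hinv.nodup⟩, fun e he => ?_⟩
    · cases random
      · rcases List.mem_cons.1 he with rfl | he
        · refine ⟨hb.length_r, hw, hb.length_a, hb.length_b, ?_⟩
          simp only [cond_false, Cfg.plain, Cfg.msg, hnext, List.tail_cons]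
          exact List.take_of_length_le
            (hC.length_encode hb.length_r hw hb.length_a hb.length_b).le
        · exact hinv.valid e he
      · exact hinv.valid e he
    · rcases List.mem_cons.1 he with rfl | he
      · exact ⟨hb.length_r, hw⟩
      · exact hinv.ct e he
  · unfold Cfg.onDecode
    split
    · exact hinv.answer _
    · rename_i es _
      cases es.isEmpty
      · exact halt _
      · exact hinv.answer _
  · exact halt _
  all_goals
    unfold Cfg.onHash
    by_cases hw : w.length = C.lam + C.k
    swap
    · simpa [hw] using hinv.answer []
    cases hkey : (withKey s.ct w).isEmpty
    · simpa [hw, hkey] using halt _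
    simp only [hw, decide_true, cond_true]
    rcases hro : withKey s.ro w with _ | ⟨e, es⟩
    · have hro : w ∉ s.ro.map Entry.key := withKey_isEmpty.1 (by simp [hro])
      rw [withKey_isEmpty] at hkey
      have hv : C.Valid ⟨w.take C.lam, w.drop C.lam, b.a, b.b,
          (C.encode (w ++ b.b) b.a).take C.n⟩ := by
        have hr : (w.take C.lam).length = C.lam := by rw [List.length_take]; omega
        have hm : (w.drop C.lam).length = C.k := by rw [List.length_drop]; omega
        refine ⟨hr, hm, hb.length_a, hb.length_b, ?_⟩
        dsimp only
        rw [List.take_append_drop, List.take_of_length_le]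
        conv_lhs => rw [← List.take_append_drop C.lam w]
        exact (hC.length_encode hr hm hb.length_a hb.length_b).le
      refine ⟨fun e he => ?_, ?_, hinv.ct⟩
      · have : e ∈ s.table random ∨ e = ⟨w.take C.lam, w.drop C.lam, b.a, b.b,
            (C.encode (w ++ b.b) b.a).take C.n⟩ := by
          cases random <;> simp [SimState.table] at he ⊢ <;> tauto
        rcases this with he | rfl
        · exact hinv.valid e he
        · exact hv
      · have := hinv.nodup
        simp only [List.map_append] at this ⊢
        refine (List.perm_middle.nodup_iff).2 (List.nodup_cons.2 ⟨?_, this⟩)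
        rw [List.mem_append, Entry.key, List.take_append_drop]
        tauto
    · exact hinv.answer _

theorem inv_init : C.Inv random SimState.init := by
  refine ⟨fun e he => ?_, by simp [SimState.init], fun e he => ?_⟩
  · cases random <;> simp [SimState.init, SimState.table] at he
  · simp [SimState.init] at he

/-- Accumulating the loss in each round. -/
theorem expect_run_le (hC : C.Simulates P δ k t lam pk sk) (f : ℕ → SimState → ℝ≥0∞)
    (g : SimState → ℝ≥0∞) (hstep : ∀ j s, C.Inv random s → s.out = [] →
      (expect C.blocks fun b => f j (C.worldStep random b s)) ≤ f (j + 1) s + g s)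
    (hhalt : ∀ j s, s.out ≠ [] → f 0 s ≤ f j s) : ∀ (j : ℕ) (s : SimState), C.Inv random s →
      expect (C.run random j s) (f 0) ≤ f j s + ∑ i ∈ Finset.range j, expect (C.run random i s) g
  | 0, s, _ => by simp [Cfg.run, expect_pure]
  | j + 1, s, hinv => by
    by_cases hs : s.out = []
    swap
    · rw [C.run_halted random hs, expect_pure]
      exact le_add_right (hhalt _ _ hs)
    -- The summand for `0` is the loss at `s` itself; the others are the losses of the runs that
    -- start one round later.
    rw [Cfg.expect_run_succ, Finset.sum_range_succ', Cfg.run, expect_pure]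
    refine (expect_mono _ fun b hb => expect_run_le hC f g hstep hhalt j _
      (inv_worldStep hC hinv (C.blockOK_of_mem hb))).trans ?_
    rw [expect_add, expect_sum]
    simp only [Cfg.expect_run_succ]
    rw [add_comm (∑ _ ∈ _, _), ← add_assoc]
    gcongr
    exact hstep j s hinv hs

open Classical in
/-- The probability of an outcome of the simulation. -/
def outProb (C : Cfg) (random : Bool) (q : ℕ) (w : Str) : ℝ≥0∞ :=
  expect (C.run random q SimState.init) fun s => if s.outcome = w then 1 else 0

/-- With no rounds left `gameProb` is the indicator of the outcome: running out of rounds counts as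
the output `0` both in `interact` and in `SimState.outcome`. -/
theorem outProb_ok_le (hC : C.Simulates P δ k t lam pk sk) (q : ℕ) :
    outProb C random q [o] ≤ gameProb C P δ k t lam pk sk random o q SimState.init +
      ∑ i ∈ Finset.range q, expect (C.run random i SimState.init) fun s =>
        attackProb C P δ lam pk sk random false s + (2 ^ t lam : ℝ≥0∞)⁻¹ := by
  refine le_trans (expect_mono _ fun s _ => ?_) (expect_run_le hC
    (gameProb C P δ k t lam pk sk random o) _ (fun j s hinv hs => gameProb_step hC hs hinv)
    (fun j s hs => by simp [gameProb, hs]) q SimState.init inv_init)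
  by_cases hs : s.out = []
  · simp only [gameProb, hs, if_true, interact, expect_const]
    cases o <;> simp [SimState.outcome, hs]
  · simp only [gameProb, hs, if_false]
    exact le_of_eq (by congr)

/-- The two close entries have different keys and hence different plaintexts, and the decoded string
cannot be both. So for any decoder coins one of the two attacks wins. This takes place in the real
world, where all known codewords are encodings with known coins. -/
theorem abortMatch_step (hC : C.Simulates P δ k t lam pk sk) {s : SimState}
    (hs : s.out = []) (hinv : C.Inv false s) (b : Block) :
    (if (C.worldStep false b s).out = abortMatch then 1 else 0) ≤
      attackProb C P δ lam pk sk false false s + attackProb C P δ lam pk sk false true s := by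
  split_ifs with h
  swap
  · exact zero_le
  rw [Cfg.worldStep, C.step_running hs] at h
  rcases hnext : C.next s.ans with _ | ⟨_ | _, _ | ⟨_ | _, x⟩⟩ <;>
    simp only [Cfg.react, hnext] at h
  · simp [SimState.halt, abortMatch] at h
  · simp [SimState.halt, abortMatch] at h
  · unfold Cfg.onEncode at h
    cases h1 : decide (x.length = C.k)
    · simp [h1, SimState.answer, hs, abortMatch] at h
    · cases h2 : (withKey (s.ct ++ s.ro) (b.r ++ x)).isEmpty <;> rw [h1, h2] at h <;>
        simp [SimState.halt, abortNonce, hs, abortMatch] at h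
  · unfold Cfg.onDecode at h
    rcases hL : closeTo C.n C.θ (s.ct ++ s.ro) x with _ | ⟨e, _ | ⟨e', es⟩⟩
    · simp [hL, SimState.answer, hs, abortMatch] at h
    · simp [hL, SimState.answer, hs, abortMatch] at h
    have he : e ∈ s.ct ++ s.ro ∧ closeB C.n C.θ e.c x = true := mem_closeTo.1 (by simp [hL])
    have he' : e' ∈ s.ct ++ s.ro ∧ closeB C.n C.θ e'.c x = true := mem_closeTo.1 (by simp [hL])
    have hv := hinv.valid e he.1
    have hv' := hinv.valid e' he'.1
    have hne : e.key ≠ e'.key := by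
      have h1 : (closeTo C.n C.θ (s.ct ++ s.ro) x).map Entry.key |>.Nodup :=
        hinv.nodup.sublist (List.filter_sublist.map _)
      rw [hL] at h1
      simp at h1
      exact h1.1.1
    have h1 : C.attack false false s = (e.r ++ e.m ++ e.b, e.a, x) := by
      simp [Cfg.attack, hs, hnext, Cfg.attackOn, hL]
    have h2 : C.attack false true s = (e'.r ++ e'.m ++ e'.b, e'.a, x) := by
      simp [Cfg.attack, hs, hnext, Cfg.attackOn, hL]
    unfold attackProb PRC.winProb
    rw [h1, h2, ← expect_add]
    refine (expect_const (randomBits (P.decCoins lam)) 1).ge.trans (expect_mono _ fun d _ => ?_)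
    by_cases hd : P.decode lam sk x d = some (e.r ++ e.m ++ e.b)
    · refine le_add_left (le_of_eq (if_pos (hC.wins hv' he'.2 ?_)).symm)
      rw [hd]
      intro h
      refine hne ?_
      simp only [Option.some.injEq] at h
      exact (List.append_inj h (by simp [hv.r, hv.m, hv'.r, hv'.m])).1
    · exact le_add_right (le_of_eq (if_pos (hC.wins hv he.2 hd)).symm)
  · simp [SimState.halt, abortMatch] at h
  all_goals
    unfold Cfg.onHash at h
    cases h1 : decide (x.length = C.lam + C.k)
    · simp [h1, SimState.answer, hs, abortMatch] at h
    · cases h2 : (withKey s.ct x).isEmpty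
      · simp [h1, h2, SimState.halt, abortNonce, abortMatch] at h
      · rcases h3 : withKey s.ro x with _ | ⟨e, es⟩ <;>
          simp [h1, h2, h3, SimState.answer, hs, abortMatch] at h

theorem outProb_abortMatch_le (hC : C.Simulates P δ k t lam pk sk) (q : ℕ) :
    outProb C false q abortMatch ≤
      ∑ i ∈ Finset.range q, expect (C.run false i SimState.init) fun s =>
        attackProb C P δ lam pk sk false false s + attackProb C P δ lam pk sk false true s := by
  classical
  refine le_trans (expect_mono _ fun s _ => ?_) ((expect_run_le hC (random := false)
    (fun _ s => if s.out = abortMatch then 1 else 0) (fun s =>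
      attackProb C P δ lam pk sk false false s + attackProb C P δ lam pk sk false true s)
    (fun j s hinv hs => ?_)
    (fun _ _ _ => le_rfl) q SimState.init inv_init).trans_eq ?_)
  · unfold SimState.outcome
    cases h : s.out.isEmpty
    · simp
    · simp [abortMatch]
  · rw [← expect_const C.blocks (_ + _)]
    exact expect_mono _ fun b _ => le_add_left (abortMatch_step hC hs hinv b)
  · simp [SimState.init, abortMatch]

end game
end

noncomputable section
open scoped ENNReal

/-! ### The distinguisher for pseudorandomness -/

/-- The entry without its coins. -/
def Entry.erase (e : Entry) : Entry := ⟨e.r, e.m, [], e.b, e.c⟩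

/-- The state without the coins of the ciphertexts. -/
def SimState.erase (s : SimState) : SimState := ⟨s.out, s.ans, s.ro, s.ct.map Entry.erase⟩

theorem withKey_map {f : Entry → Entry} (hf : ∀ e, (f e).key = e.key) (es : List Entry) (u : Str) :
    withKey (es.map f) u = (withKey es u).map f := by
  unfold Entry.key at hf
  simp [withKey, List.filter_map, Function.comp_def, hf]

theorem closeTo_map {f : Entry → Entry} (hf : ∀ e, (f e).c = e.c) (n θ : ℕ) (es : List Entry)
    (x : Str) : closeTo n θ (es.map f) x = (closeTo n θ es x).map f := by
  simp [closeTo, List.filter_map, Function.comp_def, hf]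

namespace Cfg
variable (C : Cfg)

theorem step_c_irrel {s : SimState} (h : s.out ≠ [] ∨ C.isEncodeMsg (C.next s.ans) = false)
    (c c' : Str) (b : Block) : C.step c b s = C.step c' b s := by
  by_cases hs : s.out = []
  swap
  · rw [C.step_halted hs, C.step_halted hs]
  rw [C.step_running hs, C.step_running hs]
  have h := h.resolve_left (by simpa using hs)
  rcases hn : C.next s.ans with _ | ⟨_ | _, _ | ⟨_ | _, w⟩⟩ <;> try rfl
  rw [hn] at h
  simp only [isEncodeMsg] at h
  simp [react, onEncode, h]

/-- Key tests use the nonce and the message, decoding uses the codeword and the message, and a hash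
query at the key of a ciphertext halts. The coins of a ciphertext are never read, so a simulator
ignorant of them behaves alike. -/
theorem erase_step (c : Str) (b : Block) (s : SimState) :
    (C.step c b s).erase = (C.step c b s.erase).erase := by
  have hk : ∀ u, (withKey s.erase.ct u).isEmpty = (withKey s.ct u).isEmpty := fun u => by
    rw [SimState.erase, withKey_map (f := Entry.erase) fun _ => rfl, List.isEmpty_map]
  have hk' : ∀ u, (withKey (s.erase.ct ++ s.erase.ro) u).isEmpty =
      (withKey (s.ct ++ s.ro) u).isEmpty := fun u => by
    have := hk u
    unfold withKey at this ⊢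
    rw [List.filter_append, List.filter_append, Bool.eq_iff_iff, List.isEmpty_iff, List.isEmpty_iff,
      List.append_eq_nil_iff, List.append_eq_nil_iff, ← List.isEmpty_iff, this, List.isEmpty_iff]
    rfl
  have he : s.erase.erase = s.erase := by simp [SimState.erase, Entry.erase]
  by_cases hs : s.out = []
  swap
  · rw [C.step_halted hs, C.step_halted (by exact hs), he]
  rw [C.step_running hs, C.step_running (by exact hs)]
  have ha : ∀ w, (s.answer w).erase = (s.erase.answer w).erase := fun w => by
    simp [SimState.answer, SimState.erase, Entry.erase]
  have hh : ∀ w, (s.halt w).erase = (s.erase.halt w).erase := fun w => by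
    simp [SimState.halt, SimState.erase, Entry.erase]
  rw [show s.erase.ans = s.ans from rfl]
  rcases C.next s.ans with _ | ⟨_ | _, _ | ⟨_ | _, w⟩⟩ <;> simp only [react]
  · exact hh _
  · exact hh _
  · unfold onEncode
    rw [hk']
    cases decide (w.length = C.k)
    · exact ha _
    · cases (withKey (s.ct ++ s.ro) (b.r ++ w)).isEmpty
      · exact hh _
      · simp [SimState.erase, Entry.erase]
  · unfold onDecode
    have : closeTo C.n C.θ (s.erase.ct ++ s.erase.ro) w =
        (closeTo C.n C.θ s.ct w).map Entry.erase ++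
          closeTo C.n C.θ s.ro w := by
      rw [closeTo_append, SimState.erase, closeTo_map (f := Entry.erase) fun _ => rfl]
    rw [this, closeTo_append]
    rcases closeTo C.n C.θ s.ct w with _ | ⟨e, _ | ⟨e', es⟩⟩ <;>
      rcases closeTo C.n C.θ s.ro w with _ | ⟨e₁, _ | ⟨e₂, es'⟩⟩ <;>
      simp [SimState.answer, SimState.erase, SimState.halt, Entry.erase]
  · exact hh _
  all_goals
    unfold onHash
    rw [hk]
    cases decide (w.length = C.lam + C.k)
    · exact ha _
    · cases (withKey s.ct w).isEmpty
      · exact hh _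
      · simp only [cond_true]
        rw [show s.erase.ro = s.ro from rfl]
        rcases withKey s.ro w with _ | ⟨e, es⟩
        · simp [SimState.erase, Entry.erase]
        · exact ha _

theorem erase_worldStep (random : Bool) (b : Block) (s : SimState) :
    (C.worldStep random b s).erase = (C.worldStep random b s.erase).erase :=
  C.erase_step _ b s

theorem expect_run_erase (random : Bool) (f : Str → ℝ≥0∞) : ∀ (j : ℕ) (s s' : SimState),
    s.erase = s'.erase → (expect (C.run random j s) fun s => f s.outcome) =
      expect (C.run random j s') fun s => f s.outcome
  | 0, s, s', h => by
    have : s.erase.out = s'.erase.out := congrArg SimState.out h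
    replace this : s.out = s'.out := this
    simp only [run, expect_pure, SimState.outcome, this]
  | j + 1, s, s', h => by
    simp only [expect_run_succ]
    refine expect_congr _ fun b _ => expect_run_erase random f j _ _ ?_
    rw [erase_worldStep, h, ← erase_worldStep]

theorem tapeExtStep_pending {w : Str} (hw : w ≠ []) (s : SimState) (cs : List Str) :
    ∀ (j : ℕ) (x : Str), (C.tapeExtStep^[j] (x, s, cs, w)).2 = (s, cs, w)
  | 0, _ => rfl
  | j + 1, x => by
    have : w.isEmpty = false := by simpa using hw
    rw [Function.iterate_succ_apply, tapeExtStep]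
    simp only [extStep, this, cond_false]
    exact tapeExtStep_pending hw s cs j _

variable {C} {P : PRC} {δ : ℝ} {k t : ℕ → ℕ} {lam : ℕ} {pk sk : Str}

/-- The real oracle encodes with its own coins, while the string `a` in the simulator's entry is
independent of them. Up to erasure the states agree, and the superfluous string averages out. -/
theorem Simulates.expect_oracle (hC : C.Simulates P δ k t lam pk sk) (random : Bool) {s : SimState}
    (hs : s.out = []) (hmsg : C.isEncodeMsg (C.next s.ans) = true) (j : ℕ) (f : Str → ℝ≥0∞) :
    (expect C.blocks fun b => expect (P.encodingOracle lam random pk (false, false) (C.plain b s) ())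
      fun r => expect (C.run random j (C.step r.1 b s)) fun s => f s.outcome) =
    expect (C.run random (j + 1) s) fun s => f s.outcome := by
  rw [expect_run_succ]
  have hlen : ∀ b ∈ C.blocks.support, (C.plain b s).length = P.msgLen lam := fun b hb => by
    have hb := C.blockOK_of_mem hb
    have := C.length_msg hmsg
    rw [hC.msgLen_eq, plain, List.length_append, List.length_append, hb.length_r, hb.length_b,
      msg, this, hC.lam_eq, hC.k_eq, hC.t_eq]
  cases random
  · have h1 : ∀ b ∈ C.blocks.support, (expect (P.encodingOracle lam false pk (false, false)
        (C.plain b s) ()) fun r => expect (C.run false j (C.step r.1 b s)) fun s => f s.outcome) =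
        expect (randomBits C.l) fun a => expect (C.run false j
          (C.worldStep false ⟨b.r, a, b.b, b.c⟩ s)) fun s => f s.outcome := fun b hb => by
      simp only [PRC.encodingOracle, hlen b hb, if_true, Bool.false_eq_true, if_false, expect_map,
        hC.l_eq]
      refine expect_congr _ fun a _ => C.expect_run_erase false f j _ _ ?_
      rw [worldStep, C.step_running hs, C.step_running hs, hC.encode_eq]
      rcases hn : C.next s.ans with _ | ⟨_ | _, _ | ⟨_ | _, w⟩⟩ <;> simp [hn, isEncodeMsg] at hmsg
      simp only [react, onEncode, plain, cond_false]
      cases decide (w.length = C.k)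
      · rfl
      · cases (withKey (s.ct ++ s.ro) (b.r ++ w)).isEmpty
        · rfl
        · rfl
    rw [expect_congr _ h1]
    simp only [expect_blocks]
    refine expect_congr _ fun r _ => ?_
    rw [expect_const, expect_comm (randomBits C.l)]
    refine expect_congr _ fun b _ => ?_
    rw [expect_comm (randomBits C.l)]
  · have h1 : ∀ b ∈ C.blocks.support, (expect (P.encodingOracle lam true pk (false, false)
        (C.plain b s) ()) fun r => expect (C.run true j (C.step r.1 b s)) fun s => f s.outcome) =
        expect (randomBits C.n) fun c => expect (C.run true j
          (C.worldStep true ⟨b.r, b.a, b.b, c⟩ s)) fun s => f s.outcome := fun b hb => by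
      simp only [PRC.encodingOracle, hlen b hb, if_true, expect_map, hC.n_eq]
      rfl
    rw [expect_congr _ h1]
    simp only [expect_blocks, expect_const]

/-- The hypothesis on `nx` says that, whatever further answers `e` arrive, its messages are those of
a replay from the current state `s`; the answers `cs` have been consumed before. This form survives
a round: either no query is made, or one answer moves from `e` to `cs`. The condition `j < h`
reserves a message for the verdict. -/
theorem Simulates.expect_interact (hC : C.Simulates P δ k t lam pk sk) (random : Bool)
    (target : Str) (extra : ℕ) : ∀ (j h : ℕ) (s : SimState) (cs : List Str)
    (nx : Str → List Str → Str), j < h →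
    (∀ x : Str, x.length = j * C.width + extra → ∀ e, nx x (cs ++ e) =
      bif (C.tapeExtStep^[j] (x, s, e, [])).2.2.2.isEmpty then
        [decide ((C.tapeExtStep^[j] (x, s, e, [])).2.1.outcome = target)]
      else (C.tapeExtStep^[j] (x, s, e, [])).2.2.2) →
    (expect (randomBits (j * C.width + extra)) fun x =>
      interact (P.encodingOracle lam random pk) (nx x) h cs () true) =
      expect (C.run random j s) fun s => if s.outcome = target then 1 else 0
  | 0, h + 1, s, cs, nx, _, hnx => by
    rw [run, expect_pure]
    refine (expect_congr _ fun x hx => ?_).trans (expect_const _ _)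
    have := hnx x (length_of_mem_randomBits hx) []
    simp only [List.append_nil, Function.iterate_zero, id, List.isEmpty_nil, cond_true] at this
    by_cases ho : s.outcome = target <;> simp [interact, this, ho]
  | j + 1, h + 1, s, cs, nx, hjh, hnx => by
    rw [show (j + 1) * C.width + extra = C.width + (j * C.width + extra) by ring,
      expect_randomBits_add]
    replace hnx : ∀ y : Str, y.length = C.width → ∀ x : Str, x.length = j * C.width + extra →
        ∀ e, nx (y ++ x) (cs ++ e) =
          bif (C.tapeExtStep^[j] (x, C.extStep (C.parse y) (s, e, []))).2.2.2.isEmpty then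
          [decide ((C.tapeExtStep^[j] (x, C.extStep (C.parse y) (s, e, []))).2.1.outcome = target)]
          else (C.tapeExtStep^[j] (x, C.extStep (C.parse y) (s, e, []))).2.2.2 := fun y hy x hx e => by
      have := hnx (y ++ x) (by rw [List.length_append, hy, hx]; ring) e
      rw [Function.iterate_succ_apply, tapeExtStep, C.parse_append hy] at this
      simpa only [List.drop_left' hy] using this
    cases hq : s.out.isEmpty && C.isEncodeMsg (C.next s.ans)
    · have hq' : s.out ≠ [] ∨ C.isEncodeMsg (C.next s.ans) = false := by
        rw [Bool.and_eq_false_iff] at hq; simpa using hq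
      rw [expect_run_succ, ← expect_parse]
      refine expect_congr _ fun y hy => ?_
      refine hC.expect_interact random target extra j (h + 1) _ cs (fun x => nx (y ++ x)) (by omega)
        fun x hx e => ?_
      have := hnx y (length_of_mem_randomBits hy) x hx e
      rw [extStep] at this
      simp only [hq, List.isEmpty_nil, cond_true, cond_false] at this
      rw [worldStep, C.step_c_irrel hq' _ []]
      exact this
    · have hq' : s.out = [] ∧ C.isEncodeMsg (C.next s.ans) = true := by simpa using hq
      rw [← hC.expect_oracle random hq'.1 hq'.2 j (fun w => if w = target then 1 else 0),
        ← expect_parse]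
      refine expect_congr _ fun y hy => ?_
      have hy := length_of_mem_randomBits hy
      have h1 : ∀ x ∈ (randomBits (j * C.width + extra)).support,
          interact (P.encodingOracle lam random pk) (nx (y ++ x)) (h + 1) cs () true =
          expect (P.encodingOracle lam random pk (false, false) (C.plain (C.parse y) s) ()) fun r =>
            interact (P.encodingOracle lam random pk) (nx (y ++ x)) h (cs ++ [r.1]) () true :=
          fun x hx => by
        -- With no further answer the replay gets stuck at this query, which is therefore the next
        -- message.
        have := hnx y hy x (length_of_mem_randomBits hx) []
        rw [extStep] at this
        simp only [hq, List.isEmpty_nil, cond_true] at this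
        rw [tapeExtStep_pending _ (by simp)] at this
        simp only [List.append_nil, List.isEmpty_cons, cond_false] at this
        rw [interact_query this]
      rw [expect_congr _ h1, expect_comm]
      refine expect_congr _ fun r _ => ?_
      refine hC.expect_interact random target extra j h _ _ (fun x => nx (y ++ x)) (by omega)
        fun x hx e => ?_
      have := hnx y hy x hx (r.1 :: e)
      rw [extStep] at this
      simp only [hq, List.isEmpty_nil, cond_true] at this
      rw [List.append_assoc, List.singleton_append]
      exact this

end Cfg

/-! ### Guessing a round -/

theorem expect_randomBits_succ (n : ℕ) (f : Str → ℝ≥0∞) : expect (randomBits (n + 1)) f =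
    2⁻¹ * (expect (randomBits n) fun y => f (false :: y)) +
      2⁻¹ * expect (randomBits n) fun y => f (true :: y) := by
  rw [add_comm n 1, expect_randomBits_add, expect_randomBits, ← (Equiv.funUnique (Fin 1) Bool).symm.sum_comp]
  simp [mul_add, add_comm]

theorem foldl_guessStep_done {q : ℕ} {p : ℕ × ℕ} (h : q ≤ p.1) (g : Str) :
    g.foldl (guessStep q) p = p := by
  induction g with
  | nil => rfl
  | cons b g ih =>
    have : guessStep q p b = p := by simp [guessStep, show ¬ p.1 + 1 ≤ q by omega]
    rw [List.foldl_cons, this, ih]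

/-- A value that agrees with `j` modulo `lo` extends to agreement modulo `2 * lo` for one of the two
bits. Doubling ends once the modulus is at least `q`; it is then at most `2 * q`, so `j` is reached
with probability at least `lo / (2 * q)`. -/
theorem foldl_guessStep_le {q j : ℕ} (hj : j < q) : ∀ (m lo : ℕ), 0 < lo → lo ≤ 2 * q →
    q ≤ lo * 2 ^ m → (lo : ℝ≥0∞) ≤ 2 * q * expect (randomBits m) fun g =>
      if (g.foldl (guessStep q) (lo, j % lo)).2 = j then 1 else 0
  | m, lo, h0, h1, h2 => by
    by_cases hq : q ≤ lo
    · simp only [Nat.mod_eq_of_lt (hj.trans_le hq), foldl_guessStep_done (p := (lo, j)) hq,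
        if_true, expect_const, mul_one]
      exact_mod_cast h1
    obtain _ | m := m
    · omega
    have hstep : ∀ b, guessStep q (lo, j % lo) b = (lo + lo, bif b then j % lo + lo else j % lo) :=
      fun b => by simp [guessStep, show lo + 1 ≤ q by omega]
    have hbit : ∃ b, (bif b then j % lo + lo else j % lo) = j % (lo + lo) := by
      have e : j % (lo + lo) = j % lo + lo * (j / lo % 2) := by
        rw [← two_mul, mul_comm 2 lo, Nat.mod_mul]
      rcases Nat.mod_two_eq_zero_or_one (j / lo) with h | h
      · exact ⟨false, by rw [e, h]; simp⟩
      · exact ⟨true, by rw [e, h]; simp⟩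
    obtain ⟨b, hb⟩ := hbit
    have ih := foldl_guessStep_le hj m (lo + lo) (by omega) (by omega)
      (by rw [pow_succ] at h2; linarith)
    rw [← hb] at ih
    rw [expect_randomBits_succ]
    simp only [List.foldl_cons, hstep]
    have : (2⁻¹ : ℝ≥0∞) * ((lo + lo : ℕ) : ℝ≥0∞) = lo := by
      rw [← two_mul, Nat.cast_mul, ← mul_assoc, Nat.cast_ofNat,
        ENNReal.inv_mul_cancel (by simp) (by simp), one_mul]
    rw [← this]
    refine (mul_le_mul_right ih 2⁻¹).trans ?_
    rw [mul_left_comm]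
    refine mul_le_mul_right ?_ _
    cases b
    · exact le_add_right le_rfl
    · exact le_add_left le_rfl

theorem guess_le {q j : ℕ} (hj : j < q) :
    1 ≤ 2 * q * expect (randomBits q) fun g => if guess q g = j then 1 else 0 := by
  have := foldl_guessStep_le hj q 1 one_pos (by omega) (by rw [one_mul]; exact Nat.lt_two_pow_self.le)
  rwa [Nat.mod_one, Nat.cast_one] at this

/-- The price of guessing a round. It is `2 * q` and not `q` because fair bits are uniform only on
ranges whose length is a power of two. -/
theorem sum_le_expect_guess (q : ℕ) (S : ℕ → ℝ≥0∞) : ∑ j ∈ Finset.range q, S j ≤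
    2 * q * expect (randomBits q) fun g => if guess q g < q then S (guess q g) else 0 := by
  have h : ∀ g, (if guess q g < q then S (guess q g) else 0) =
      ∑ j ∈ Finset.range q, S j * if guess q g = j then 1 else 0 := fun g => by
    simp
  simp only [h, expect_sum, expect_mul_left, Finset.mul_sum]
  refine Finset.sum_le_sum fun j hj => ?_
  rw [mul_left_comm]
  exact le_mul_of_one_le_right' (guess_le (Finset.mem_range.1 hj))

/-! ### Repeated nonces in the random world -/

/-- Independent random nonces. -/
def nonces (lam : ℕ) : ℕ → PMF (List Str)
  | 0 => PMF.pure []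
  | i + 1 => (randomBits lam).bind fun r => (nonces lam i).map fun rs => r :: rs

theorem expect_nonces_succ (lam i : ℕ) (f : List Str → ℝ≥0∞) : expect (nonces lam (i + 1)) f =
    expect (randomBits lam) fun r => expect (nonces lam i) fun rs => f (r :: rs) := by
  simp only [nonces, expect_bind, expect_map]

theorem length_of_mem_nonces {lam : ℕ} : ∀ {i : ℕ} {rs : List Str},
    rs ∈ (nonces lam i).support → rs.length = i
  | 0, rs, h => by simp [nonces] at h; simp [h]
  | i + 1, rs, h => by
    simp only [nonces, PMF.mem_support_bind_iff, PMF.support_map, Set.mem_image] at h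
    obtain ⟨r, -, rs, h, rfl⟩ := h
    simp [length_of_mem_nonces h]

/-- A union bound: each key determines the nonce as its first `lam` bits. -/
theorem prob_append_mem_le (lam : ℕ) (m : Str) (ks : List Str) :
    (expect (randomBits lam) fun r => if r ++ m ∈ ks then 1 else 0) ≤
      ks.length * (2 ^ lam : ℝ≥0∞)⁻¹ := by
  induction ks with
  | nil => simp [expect_const]
  | cons u ks ih =>
    rw [List.length_cons, Nat.cast_add, add_mul, add_comm, Nat.cast_one, one_mul]
    refine le_trans ?_ (add_le_add (expect_randomBits_eq_le lam (u.take lam)) ih)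
    rw [← expect_add]
    refine expect_mono _ fun r hr => ?_
    have hr := length_of_mem_randomBits hr
    by_cases h : r ++ m = u
    · refine le_add_right ?_
      rw [if_pos (show r = u.take lam by rw [← h, List.take_left' hr])]
      split_ifs <;> simp
    · refine le_add_left (le_of_eq ?_)
      simp [h]

/-- The entry with a new nonce. -/
def Entry.withNonce (r : Str) (e : Entry) : Entry := ⟨r, e.m, e.a, e.b, e.c⟩

/-- The state with new nonces of the ciphertexts. -/
def SimState.withNonces (rs : List Str) (s : SimState) : SimState :=
  ⟨s.out, s.ans, s.ro, List.zipWith Entry.withNonce rs s.ct⟩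

theorem prob_mem_nonces_le (lam : ℕ) (u : Str) (es : List Entry) :
    (expect (nonces lam es.length) fun rs =>
      if u ∈ (List.zipWith Entry.withNonce rs es).map Entry.key then 1 else 0) ≤
      es.length * (2 ^ lam : ℝ≥0∞)⁻¹ := by
  induction es with
  | nil => simp [expect_const]
  | cons e es ih =>
    rw [List.length_cons, expect_nonces_succ, Nat.cast_add, add_mul, add_comm, Nat.cast_one,
      one_mul]
    refine le_trans ?_ (add_le_add (expect_randomBits_eq_le lam (u.take lam)) ih)
    rw [← expect_const (randomBits lam) (expect (nonces lam es.length) _), ← expect_add]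
    refine expect_mono _ fun r hr => ?_
    have hr := length_of_mem_randomBits hr
    by_cases h : u = r ++ e.m
    · refine le_add_right ?_
      rw [if_pos (by rw [h, List.take_left' hr])]
      exact expect_le_one _ fun rs => by split_ifs <;> simp
    · refine le_add_left (le_of_eq ?_)
      simp [h, Entry.withNonce, Entry.key]

namespace Cfg
variable (C : Cfg)

theorem expect_blocks_r (f : Str → ℝ≥0∞) :
    (expect C.blocks fun b => f b.r) = expect (randomBits C.lam) f := by
  simp only [expect_blocks, expect_const]

/-- The probability to abort because of a nonce. -/
def abortProb (j : ℕ) (s : SimState) : ℝ≥0∞ :=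
  expect (C.run true j s) fun s => if s.out = abortNonce then 1 else 0

theorem abortProb_halted {s : SimState} (h : s.out ≠ []) (h' : s.out ≠ abortNonce) (j : ℕ) :
    C.abortProb j s = 0 := by
  simp [abortProb, C.run_halted true h, expect_pure, h']

theorem abortProb_le_one (j : ℕ) (s : SimState) : C.abortProb j s ≤ 1 :=
  expect_le_one _ fun s => by split_ifs <;> simp

/-- Closeness concerns the codewords only, so the answers to decoding queries do not depend on the
nonces. -/
theorem closeTo_withNonces (n θ : ℕ) (x : Str) : ∀ {rs : List Str} {es : List Entry},
    rs.length = es.length → (closeTo n θ (List.zipWith Entry.withNonce rs es) x).map Entry.m =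
      (closeTo n θ es x).map Entry.m
  | [], [], _ => rfl
  | r :: rs, e :: es, h => by
    have ih := closeTo_withNonces n θ x (Nat.succ.inj h)
    unfold closeTo at ih ⊢
    rw [List.zipWith_cons_cons, List.filter_cons, List.filter_cons]
    by_cases hc : closeB n θ e.c x = true <;> simp [Entry.withNonce, hc] at ih ⊢ <;> exact ih

theorem onDecode_withNonces (x : Str) {rs : List Str} {s : SimState}
    (h : rs.length = s.ct.length) :
    C.onDecode x (s.withNonces rs) = (C.onDecode x s).withNonces rs := by
  have := closeTo_withNonces C.n C.θ x h
  have h : (closeTo C.n C.θ ((s.withNonces rs).ct ++ (s.withNonces rs).ro) x).map Entry.m =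
      (closeTo C.n C.θ (s.ct ++ s.ro) x).map Entry.m := by
    rw [closeTo_append, closeTo_append, List.map_append, List.map_append]
    exact congrArg (· ++ _) this
  unfold onDecode
  revert h
  rcases closeTo C.n C.θ ((s.withNonces rs).ct ++ (s.withNonces rs).ro) x with
    _ | ⟨e, _ | ⟨e', es⟩⟩ <;>
    rcases closeTo C.n C.θ (s.ct ++ s.ro) x with _ | ⟨e₁, _ | ⟨e₁', es₁⟩⟩ <;> intro h <;>
    simp at h
  · rfl
  · simp only [List.isEmpty_nil, cond_true, h]; rfl
  · rfl

theorem onDecode_ct_ro (x : Str) (s : SimState) : (C.onDecode x s).ct = s.ct ∧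
    (C.onDecode x s).ro = s.ro ∧ (s.out = [] → (C.onDecode x s).out ≠ abortNonce) := by
  unfold onDecode
  rcases closeTo C.n C.θ (s.ct ++ s.ro) x with _ | ⟨e, _ | ⟨e', es⟩⟩ <;>
    refine ⟨rfl, rfl, fun h => ?_⟩ <;>
    simp [SimState.answer, SimState.halt, h, abortNonce, abortMatch]

/-- A round in which no ciphertext is produced. -/
theorem abortProb_step {N j : ℕ} {s : SimState} (u : Str) (blind : Block → SimState)
    (ih : ∀ b, expect (nonces C.lam (blind b).ct.length) (fun rs =>
      C.abortProb j ((blind b).withNonces rs)) ≤ j * (N * (2 ^ C.lam : ℝ≥0∞)⁻¹))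
    (hct : ∀ b, (blind b).ct = s.ct) (hN : s.ct.length ≤ N)
    (hstep : ∀ b rs, rs.length = s.ct.length →
      C.worldStep true b (s.withNonces rs) = (blind b).withNonces rs ∨
        u ∈ (List.zipWith Entry.withNonce rs s.ct).map Entry.key) :
    (expect (nonces C.lam s.ct.length) fun rs => C.abortProb (j + 1) (s.withNonces rs)) ≤
      ((j + 1 : ℕ) : ℝ≥0∞) * (N * (2 ^ C.lam : ℝ≥0∞)⁻¹) := by
  rw [Nat.cast_add, add_mul, Nat.cast_one, one_mul]
  -- The loss of the round is the chance that `u` is the key of a ciphertext under fresh nonces;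
  -- otherwise the successor state does not depend on them.
  have h1 : (s.ct.length : ℝ≥0∞) * (2 ^ C.lam : ℝ≥0∞)⁻¹ ≤ N * (2 ^ C.lam : ℝ≥0∞)⁻¹ := by gcongr
  refine le_trans ?_ (add_le_add_right ((prob_mem_nonces_le C.lam u s.ct).trans h1) _)
  refine le_trans ?_ (add_le_add_left ((expect_mono C.blocks fun b _ => ih b).trans
    (expect_const _ _).le) _)
  simp only [hct]
  rw [expect_comm, ← expect_add]
  refine expect_mono _ fun rs hrs => ?_
  rw [abortProb, expect_run_succ]
  by_cases hu : u ∈ (List.zipWith Entry.withNonce rs s.ct).map Entry.key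
  · rw [if_pos hu]
    exact le_add_left (expect_le_one _ fun b => C.abortProb_le_one _ _)
  · refine le_add_right (expect_mono _ fun b _ => le_of_eq ?_)
    rw [← (hstep b rs (length_of_mem_nonces hrs)).resolve_right hu]
    rfl

/-- Codewords in the random world are independent of the nonces, so before an abort the nonces are
still uniform given everything the adversary has seen. This is expressed by averaging over new
nonces in the state. Each round then aborts with probability at most `N * 2^{-lam}`, where `N`
bounds the number of keys at all times, or passes to a state of the same form. -/
theorem abortProb_le (N : ℕ) : ∀ (j : ℕ) (s : SimState), s.out ≠ abortNonce →
    s.ct.length + s.ro.length + j ≤ N →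
    (expect (nonces C.lam s.ct.length) fun rs => C.abortProb j (s.withNonces rs)) ≤
      j * (N * (2 ^ C.lam : ℝ≥0∞)⁻¹)
  | 0, s, h, _ => by
    have : ∀ rs, C.abortProb 0 (s.withNonces rs) = 0 := fun rs => by
      rw [abortProb, run, expect_pure, if_neg]
      exact h
    simp only [this, expect_const, zero_le]
  | j + 1, s, h, hN => by
    by_cases hs : s.out = []
    swap
    · have : ∀ rs, C.abortProb (j + 1) (s.withNonces rs) = 0 := fun rs =>
        C.abortProb_halted (s := s.withNonces rs) hs h _
      simp only [this, expect_const, zero_le]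
    have ih := abortProb_le N j
    have hws : ∀ rs b, C.worldStep true b (s.withNonces rs) =
        C.react b.c b (s.withNonces rs) (C.next s.ans) := fun rs b => C.step_running hs
    rcases hn : C.next s.ans with _ | ⟨_ | _, _ | ⟨_ | _, w⟩⟩ <;> simp only [hn, react] at hws
    · exact C.abortProb_step [] (fun _ => s.halt [false]) (fun b => ih _ (by simp [SimState.halt, abortNonce])
        (by simp only [SimState.halt]; omega)) (fun _ => rfl) (by omega)
        fun b rs hrs => .inl (hws rs b)
    · exact C.abortProb_step [] (fun _ => s.halt [false]) (fun b => ih _ (by simp [SimState.halt, abortNonce])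
        (by simp only [SimState.halt]; omega)) (fun _ => rfl) (by omega)
        fun b rs hrs => .inl (hws rs b)
    · by_cases hw : w.length = C.k
      swap
      · exact C.abortProb_step [] (fun _ => s.answer []) (fun b => ih _ (by simp [SimState.answer, hs, abortNonce])
          (by simp only [SimState.answer]; omega)) (fun _ => rfl) (by omega)
          fun b rs hrs => .inl (by rw [hws]; simp [onEncode, hw, SimState.answer, SimState.withNonces])
      let blind : Block → SimState := fun b =>
        ⟨[], s.ans ++ [b.c.take C.n], s.ro, ⟨[], w, b.a, b.b, b.c.take C.n⟩ :: s.ct⟩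
      have hblind := fun b => ih (blind b) (by simp [blind, abortNonce])
        (by simp only [blind, List.length_cons]; omega)
      have hstep : ∀ rs ∈ (nonces C.lam s.ct.length).support, ∀ b,
          C.abortProb j (C.worldStep true b (s.withNonces rs)) ≤
            C.abortProb j ((blind b).withNonces (b.r :: rs)) +
              if b.r ++ w ∈ ((s.withNonces rs).ct ++ s.ro).map Entry.key then 1 else 0 := by
        intro rs _ b
        split_ifs with hb
        · exact le_add_left (C.abortProb_le_one _ _)
        · have : (withKey ((s.withNonces rs).ct ++ s.ro) (b.r ++ w)).isEmpty = true :=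
            withKey_isEmpty.2 hb
          rw [hws, onEncode, show (s.withNonces rs).ro = s.ro from rfl, this]
          simp [hw, blind, SimState.withNonces, Entry.withNonce, hs]
      have hbad : ∀ rs ∈ (nonces C.lam s.ct.length).support, (expect C.blocks fun b =>
          if b.r ++ w ∈ ((s.withNonces rs).ct ++ s.ro).map Entry.key then 1 else 0) ≤
            N * (2 ^ C.lam : ℝ≥0∞)⁻¹ := fun rs hrs => by
        refine (C.expect_blocks_r fun r => if r ++ w ∈ ((s.withNonces rs).ct ++ s.ro).map Entry.key
          then 1 else 0).trans_le ((prob_append_mem_le _ _ _).trans ?_)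
        gcongr
        simp only [SimState.withNonces, List.length_map, List.length_append, List.length_zipWith,
          length_of_mem_nonces hrs]
        omega
      rw [Nat.cast_add, add_mul, Nat.cast_one, one_mul]
      have hgood : (expect (nonces C.lam s.ct.length) fun rs => expect C.blocks fun b =>
          C.abortProb j ((blind b).withNonces (b.r :: rs))) ≤ j * (N * (2 ^ C.lam : ℝ≥0∞)⁻¹) := by
        rw [expect_comm, expect_blocks, expect_comm]
        refine le_trans (expect_mono _ fun a _ => ?_) (expect_const (randomBits C.l) _).le
        rw [expect_comm]
        refine le_trans (expect_mono _ fun b _ => ?_) (expect_const (randomBits C.t) _).le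
        rw [expect_comm]
        refine le_trans (expect_mono _ fun c _ => ?_) (expect_const (randomBits C.n) _).le
        exact (expect_nonces_succ C.lam s.ct.length fun rs =>
          C.abortProb j ((blind ⟨[], a, b, c⟩).withNonces rs)).symm.le.trans (hblind ⟨[], a, b, c⟩)
      refine le_trans ?_ (add_le_add hgood ((expect_mono _ hbad).trans (expect_const _ _).le))
      rw [← expect_add]
      refine expect_mono _ fun rs hrs => ?_
      rw [← expect_add, abortProb, expect_run_succ]
      exact expect_mono _ fun b _ => hstep rs hrs b
    · have hd := C.onDecode_ct_ro w s
      exact C.abortProb_step [] (fun _ => C.onDecode w s) (fun b => ih _ (hd.2.2 hs)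
        (by rw [hd.1, hd.2.1]; omega)) (fun _ => hd.1) (by omega)
        fun b rs hrs => .inl (by rw [hws, C.onDecode_withNonces w hrs])
    · exact C.abortProb_step [] (fun _ => s.halt [true]) (fun b => ih _ (by simp [SimState.halt, abortNonce])
        (by simp only [SimState.halt]; omega)) (fun _ => rfl) (by omega)
        fun b rs hrs => .inl (hws rs b)
    all_goals
      -- Removing the ciphertexts gives the reaction to a hash query that misses all their keys.
      have hd : ∀ b, (C.onHash b w ⟨s.out, s.ans, s.ro, []⟩).ct = [] ∧
          (C.onHash b w ⟨s.out, s.ans, s.ro, []⟩).ro.length ≤ s.ro.length + 1 ∧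
          (C.onHash b w ⟨s.out, s.ans, s.ro, []⟩).out = [] := fun b => by
        unfold onHash
        cases decide (w.length = C.lam + C.k)
        · simp [SimState.answer, hs]
        · rcases withKey s.ro w <;> simp [SimState.answer, hs, withKey]
      refine C.abortProb_step w (fun b => ⟨[], (C.onHash b w ⟨s.out, s.ans, s.ro, []⟩).ans,
        (C.onHash b w ⟨s.out, s.ans, s.ro, []⟩).ro, s.ct⟩) (fun b => ih _ (by simp [abortNonce])
        (by have := (hd b).2.1; dsimp only; omega)) (fun _ => rfl) (by omega) fun b rs hrs => ?_
      by_cases hu : w ∈ (List.zipWith Entry.withNonce rs s.ct).map Entry.key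
      · exact .inr hu
      left
      have hu' : (withKey (s.withNonces rs).ct w).isEmpty = true := withKey_isEmpty.2 hu
      rw [hws]
      unfold onHash
      rw [hu', show (s.withNonces rs).ro = s.ro from rfl]
      cases decide (w.length = C.lam + C.k)
      · simp [SimState.answer, SimState.withNonces, hs]
      · rcases withKey s.ro w <;> simp [SimState.answer, hs, withKey, SimState.withNonces]

theorem outProb_abortNonce_le (q : ℕ) :
    outProb C true q abortNonce ≤ q * (q * (2 ^ C.lam : ℝ≥0∞)⁻¹) := by
  have := C.abortProb_le q q SimState.init (by simp [SimState.init, abortNonce])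
    (by simp [SimState.init])
  simp only [SimState.init, List.length_nil, nonces, expect_pure] at this
  refine le_trans (expect_mono _ fun s _ => ?_) this
  by_cases h : s.out = []
  · simp [SimState.outcome, h, abortNonce]
  · have : s.out.isEmpty = false := by simpa using h
    simp [SimState.outcome, this]

end Cfg
end

noncomputable section
open scoped ENNReal

/-! ### The outcomes of the simulation -/

namespace Cfg
variable (C : Cfg)

theorem out_worldStep (random : Bool) (b : Block) {s : SimState}
    (h : s.out ∈ [[], [true], [false], abortNonce, abortMatch]) :
    (C.worldStep random b s).out ∈ [[], [true], [false], abortNonce, abortMatch] := by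
  by_cases hs : s.out = []
  swap
  · rwa [worldStep, C.step_halted hs]
  rw [worldStep, C.step_running hs]
  rcases C.next s.ans with _ | ⟨_ | _, _ | ⟨_ | _, w⟩⟩ <;> simp only [react]
  · simp [SimState.halt]
  · simp [SimState.halt]
  · unfold onEncode
    cases decide (w.length = C.k)
    · simp [SimState.answer, hs]
    · cases (withKey (s.ct ++ s.ro) (b.r ++ w)).isEmpty <;> simp [SimState.halt, hs]
  · unfold onDecode
    rcases closeTo C.n C.θ (s.ct ++ s.ro) w with _ | ⟨e, _ | ⟨e', es⟩⟩ <;>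
      simp [SimState.answer, SimState.halt, hs]
  · simp [SimState.halt]
  all_goals
    unfold onHash
    cases decide (w.length = C.lam + C.k)
    · simp [SimState.answer, hs]
    · cases (withKey s.ct w).isEmpty
      · simp [SimState.halt]
      · rcases withKey s.ro w <;> simp [SimState.answer, hs]

open Classical in
theorem expect_run_outcomes (random : Bool) : ∀ (j : ℕ) (s : SimState),
    s.out ∈ [[], [true], [false], abortNonce, abortMatch] →
    (expect (C.run random j s) fun s => (if s.outcome = [true] then (1 : ℝ≥0∞) else 0) +
      (if s.outcome = [false] then 1 else 0) + (if s.outcome = abortNonce then 1 else 0) +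
      (if s.outcome = abortMatch then 1 else 0)) = 1
  | 0, s, h => by
    simp only [List.mem_cons, List.not_mem_nil, or_false] at h
    rw [run, expect_pure]
    rcases h with h | h | h | h | h <;> simp [SimState.outcome, h, abortNonce, abortMatch]
  | j + 1, s, h => by
    rw [expect_run_succ]
    exact (expect_congr _ fun b _ =>
      expect_run_outcomes random j _ (C.out_worldStep random b h)).trans (expect_const _ _)

/-- The simulation has only these four outcomes. This turns upper bounds on the other outcomes into
a lower bound on one of them. -/
theorem outProb_sum (random : Bool) (q : ℕ) : outProb C random q [true] +
    outProb C random q [false] + outProb C random q abortNonce + outProb C random q abortMatch =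
      1 := by
  simp only [outProb, ← expect_add]
  exact C.expect_run_outcomes random q _ (by simp [SimState.init])

end Cfg

/-! ### Averaging over the keys and the coins of the adversary -/

namespace PRC

/-- The expectation over the keys and the coins of the adversary. -/
def average (P : PRC) (A : OracleAdversary) (lam : ℕ) (F : Str × Str → Str → ℝ≥0∞) : ℝ≥0∞ :=
  expect (P.keys lam) fun kp => expect (randomBits (A.coinLen.eval lam)) fun coins => F kp coins

/-- The largest number of errors. -/
def radius (P : PRC) (δ : ℝ) (lam : ℕ) : ℕ := ⌊δ * P.codeLen lam⌋₊

section
variable {P : PRC} {A : OracleAdversary} {lam : ℕ} {F G : Str × Str → Str → ℝ≥0∞}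

theorem average_mono (h : ∀ kp ∈ (P.keys lam).support, ∀ coins, F kp coins ≤ G kp coins) :
    P.average A lam F ≤ P.average A lam G :=
  expect_mono _ fun kp hkp => expect_mono _ fun coins _ => h kp hkp coins

theorem average_add : P.average A lam (fun kp coins => F kp coins + G kp coins) =
    P.average A lam F + P.average A lam G := by
  simp only [average, expect_add]

theorem average_const (c : ℝ≥0∞) : P.average A lam (fun _ _ => c) = c := by
  simp only [average, expect_const]

end

variable (P : PRC) (δ : ℝ) (k t : ℕ → ℕ) (A : OracleAdversary) (lam : ℕ)

/-- The probability of an outcome of the simulation for random keys. -/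
def outcomeProb (random : Bool) (w : Str) : ℝ≥0∞ := P.average A lam fun kp coins =>
  outProb (P.simCfg A k t (P.radius δ) (lam, coins, kp.1)) random (A.rounds.eval lam) w

/-- The expected number of wins in the robustness game. -/
def expectedWins (random second : Bool) : ℝ≥0∞ := P.average A lam fun kp coins =>
  ∑ i ∈ Finset.range (A.rounds.eval lam),
    expect ((P.simCfg A k t (P.radius δ) (lam, coins, kp.1)).run random i SimState.init) fun s =>
      attackProb (P.simCfg A k t (P.radius δ) (lam, coins, kp.1)) P δ lam kp.1 kp.2 random second s

variable {P δ k t A lam}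

theorem simulates (hδ : 0 ≤ δ) (hlen : ∀ lam, P.msgLen lam = lam + k lam + t lam)
    {kp : Str × Str} (hkp : kp ∈ (P.keys lam).support) (coins : Str) :
    (P.simCfg A k t (P.radius δ) (lam, coins, kp.1)).Simulates P δ k t lam kp.1 kp.2 := by
  simp only [keys, PMF.support_map, Set.mem_image] at hkp
  obtain ⟨r, hr, rfl⟩ := hkp
  have := P.keyGen_length lam r (length_of_mem_randomBits hr)
  exact ⟨rfl, rfl, rfl, rfl, rfl, rfl, rfl, hδ, hlen lam, this.1, this.2⟩

theorem ccaGame_eq (random o : Bool) : (P.cca δ k t).ccaGame δ A lam random o =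
    P.average A lam fun kp coins => gameProb (P.simCfg A k t (P.radius δ) (lam, coins, kp.1)) P δ k
      t lam kp.1 kp.2 random o (A.rounds.eval lam) SimState.init := by
  have hr := fun (kp : Str × Str) (coins : Str) => gameProb_running (C := P.simCfg A k t (P.radius δ) (lam, coins, kp.1))
    (P := P) (δ := δ) (k := k) (t := t) (lam := lam) (pk := kp.1) (sk := kp.2) (random := random)
    (o := o) (j := A.rounds.eval lam) (s := SimState.init) rfl
  have ht : SimState.init.table random = [] := by cases random <;> rfl
  have htr : SimState.init.transcript random = [] := by cases random <;> rfl
  simp only [average, hr, ht, htr, ROCode.ccaGame, bind_apply_eq_expect, randomOracle, expect_map]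
  refine expect_congr _ fun kp _ => ?_
  rw [expect_comm]
  rfl

theorem outcomeProb_sum (random : Bool) : P.outcomeProb δ k t A lam random [true] +
    P.outcomeProb δ k t A lam random [false] + P.outcomeProb δ k t A lam random abortNonce +
      P.outcomeProb δ k t A lam random abortMatch = 1 := by
  simp only [outcomeProb, ← average_add, Cfg.outProb_sum, average_const]

/-- The tag length enters here: a tag is hit with probability at most `2^{-lam}` in each round. -/
theorem outcomeProb_ok_le (hδ : 0 ≤ δ) (hlen : ∀ lam, P.msgLen lam = lam + k lam + t lam)
    (htag : ∀ lam, lam ≤ t lam) (random o : Bool) : P.outcomeProb δ k t A lam random [o] ≤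
      (P.cca δ k t).ccaGame δ A lam random o + (P.expectedWins δ k t A lam random false +
        A.rounds.eval lam * (2 ^ lam : ℝ≥0∞)⁻¹) := by
  rw [ccaGame_eq, expectedWins, ← average_const (P := P) (A := A) (lam := lam) (_ * _),
    ← average_add, ← average_add]
  refine average_mono fun kp hkp coins => ?_
  refine (outProb_ok_le (simulates hδ hlen hkp coins) _).trans ?_
  gcongr
  simp only [expect_add, expect_const, Finset.sum_add_distrib, Finset.sum_const, Finset.card_range,
    nsmul_eq_mul]
  gcongr
  · exact one_le_two
  · exact htag lam

theorem outcomeProb_abortMatch_le (hδ : 0 ≤ δ) (hlen : ∀ lam, P.msgLen lam = lam + k lam + t lam) :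
    P.outcomeProb δ k t A lam false abortMatch ≤
      P.expectedWins δ k t A lam false false + P.expectedWins δ k t A lam false true := by
  simp only [expectedWins, ← average_add, ← Finset.sum_add_distrib, ← expect_add]
  exact average_mono fun kp hkp coins => outProb_abortMatch_le (simulates hδ hlen hkp coins) _

theorem outcomeProb_abortNonce_le : P.outcomeProb δ k t A lam true abortNonce ≤
    A.rounds.eval lam * (A.rounds.eval lam * (2 ^ lam : ℝ≥0∞)⁻¹) := by
  rw [← average_const (P := P) (A := A) (lam := lam) (_ * _)]
  exact average_mono fun kp _ coins => Cfg.outProb_abortNonce_le _ _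

/-! ### Success probabilities of the two reductions. -/

variable {W : Polynomial ℕ}

theorem pseudorandomGame_distinguisher (hδ : 0 ≤ δ)
    (hlen : ∀ lam, P.msgLen lam = lam + k lam + t lam)
    (h : P.SimEfficient k t (P.radius δ) W) (random : Bool) (target : Str) :
    P.pseudorandomGame (P.distinguisher h A target) lam random true =
      P.outcomeProb δ k t A lam random target := by
  simp only [pseudorandomGame, bind_apply_eq_expect, outcomeProb, average]
  refine expect_congr _ fun kp hkp => ?_
  have hcoin : (P.distinguisher h A target).coinLen.eval lam =
      A.coinLen.eval lam + A.rounds.eval lam * W.eval lam := by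
    simp [distinguisher]
  have hrounds : (P.distinguisher h A target).rounds.eval lam = A.rounds.eval lam + 1 := by
    simp [distinguisher]
  rw [hcoin, hrounds, expect_randomBits_add]
  refine expect_congr _ fun x hx => ?_
  have hx := length_of_mem_randomBits hx
  have hC := simulates (A := A) hδ hlen hkp x
  -- The tape splits into the bits that the rounds read and the surplus that `W` allows.
  have hW : A.rounds.eval lam * W.eval lam = A.rounds.eval lam *
      (P.simCfg A k t (P.radius δ) (lam, x, kp.1)).width + A.rounds.eval lam *
        (W.eval lam - (P.simCfg A k t (P.radius δ) (lam, x, kp.1)).width) := by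
    have hw : (P.simCfg A k t (P.radius δ) (lam, x, kp.1)).width ≤ W.eval lam := h.width lam
    rw [← mul_add, Nat.add_sub_of_le hw]
  rw [hW]
  refine (hC.expect_interact random target _ (A.rounds.eval lam) _ SimState.init []
    (fun y => (P.distinguisher h A target).next lam (x ++ y) kp.1) (Nat.lt_succ_self _)
    fun y _ e => ?_).trans (by rw [outProb])
  simp only [distinguisher, List.nil_append, List.take_left' hx, List.drop_left' hx]

theorem robustGame_apply (B : TripleAdversary) : P.robustGame δ B lam true =
    expect (P.keys lam) fun kp => expect (randomBits (B.coinLen.eval lam)) fun coins =>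
      P.winProb δ lam kp.1 kp.2 (B.out lam coins kp.1) := by
  classical
  simp only [robustGame, bind_apply_eq_expect, map_apply_eq_expect, winProb]
  refine expect_congr _ fun kp _ => expect_congr _ fun coins _ => expect_congr _ fun d _ => ?_
  exact if_congr decide_eq_true_iff rfl rfl

/-- The sum over the rounds is traded for one guessed round by `sum_le_expect_guess`. A guess beyond
the last round is only bounded below by zero. -/
theorem expectedWins_le (h : P.SimEfficient k t (P.radius δ) W) (random second : Bool) :
    P.expectedWins δ k t A lam random second ≤
      2 * A.rounds.eval lam * P.robustGame δ (P.attacker h A random second) lam true := by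
  rw [robustGame_apply, expectedWins, average, ← expect_mul_left]
  refine expect_mono _ fun kp _ => ?_
  have hcoin : (P.attacker h A random second).coinLen.eval lam =
      A.coinLen.eval lam + (A.rounds.eval lam + A.rounds.eval lam * W.eval lam) := by
    simp [attacker]
  rw [hcoin, expect_randomBits_add, ← expect_mul_left]
  refine expect_mono _ fun x hx => ?_
  have hx := length_of_mem_randomBits hx
  rw [expect_randomBits_add]
  refine (sum_le_expect_guess _ _).trans (mul_le_mul_right (expect_mono _ fun g hg => ?_) _)
  have hg := length_of_mem_randomBits hg
  split_ifs with hlt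
  swap
  · exact zero_le
  have hW : A.rounds.eval lam * W.eval lam = guess (A.rounds.eval lam) g *
      (P.simCfg A k t (P.radius δ) (lam, x, kp.1)).width + (A.rounds.eval lam * W.eval lam -
        guess (A.rounds.eval lam) g * (P.simCfg A k t (P.radius δ) (lam, x, kp.1)).width) := by
    have hw : (P.simCfg A k t (P.radius δ) (lam, x, kp.1)).width ≤ W.eval lam := h.width lam
    rw [Nat.add_sub_of_le (Nat.mul_le_mul hlt.le hw)]
  rw [hW, ← Cfg.expect_tape]
  refine le_of_eq (expect_congr _ fun y _ => ?_)
  simp only [attackProb, attacker, List.take_left' hx, List.drop_left' hx, List.take_left' hg,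
    List.drop_left' hg]

end PRC

/-! ### Negligible functions -/

theorem Negligible.add {f g : ℕ → ℝ} (hf : Negligible f) (hg : Negligible g) :
    Negligible fun lam => f lam + g lam := Asymptotics.SuperpolynomialDecay.add hf hg

theorem Negligible.eval_mul {f : ℕ → ℝ} (hf : Negligible f) (p : Polynomial ℕ) :
    Negligible fun lam => ((p.eval lam : ℕ) : ℝ) * f lam := by
  have := Asymptotics.SuperpolynomialDecay.polynomial_mul hf (p.map (Nat.castRingHom ℝ))
  simp only [Polynomial.eval_natCast_map, eq_natCast, Nat.cast_id] at this
  exact this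

theorem negligible_two_pow_inv : Negligible fun lam => (2 ^ lam : ℝ)⁻¹ := fun n => by
  have := tendsto_pow_const_mul_const_pow_of_abs_lt_one n (r := (2 : ℝ)⁻¹)
    (by rw [abs_of_pos] <;> norm_num)
  simpa only [inv_pow] using this

theorem Negligible.of_abs_le {f g : ℕ → ℝ} (hg : Negligible g) (h : ∀ lam, |f lam| ≤ g lam) :
    Negligible f :=
  Asymptotics.SuperpolynomialDecay.trans_abs_le hg fun lam => (h lam).trans (le_abs_self _)

/-- The advantage in the CCA game. -/
theorem PRC.cca_advantage_le {P : PRC} {δ : ℝ} {k t : ℕ → ℕ} {A : OracleAdversary} {lam : ℕ}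
    {W : Polynomial ℕ} (hδ : 0 ≤ δ) (hlen : ∀ lam, P.msgLen lam = lam + k lam + t lam)
    (htag : ∀ lam, lam ≤ t lam) (h : P.SimEfficient k t (P.radius δ) W) :
    let dist := fun w => |(P.pseudorandomGame (P.distinguisher h A w) lam false true).toReal -
      (P.pseudorandomGame (P.distinguisher h A w) lam true true).toReal|
    let rob := fun random second =>
      (P.robustGame δ (P.attacker h A random second) lam true).toReal
    let q : ℝ := ((A.rounds.eval lam : ℕ) : ℝ)
    |((P.cca δ k t).ccaGame δ A lam false true).toReal -
      ((P.cca δ k t).ccaGame δ A lam true true).toReal| ≤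
      dist [true] + dist abortNonce + dist abortMatch + q * (4 * rob false false) +
        q * (2 * rob false true) + q * (2 * rob true false) + q * (2 * (2 ^ lam : ℝ)⁻¹) +
        q * (q * (2 ^ lam : ℝ)⁻¹) := by
  intro dist rob q
  have hgame : ∀ random, ((P.cca δ k t).ccaGame δ A lam random true).toReal +
      ((P.cca δ k t).ccaGame δ A lam random false).toReal = 1 := fun random => by
    have := ((P.cca δ k t).ccaGame δ A lam random).tsum_coe
    rw [tsum_bool] at this
    rw [← ENNReal.toReal_add (PMF.apply_ne_top _ _) (PMF.apply_ne_top _ _), add_comm, this,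
      ENNReal.toReal_one]
  have hfin : ∀ random w, P.outcomeProb δ k t A lam random w ≠ ⊤ := fun random w => by
    rw [← pseudorandomGame_distinguisher hδ hlen h]
    exact PMF.apply_ne_top _ _
  have hdist : ∀ w, |(P.outcomeProb δ k t A lam false w).toReal -
      (P.outcomeProb δ k t A lam true w).toReal| = dist w := fun w => by
    simp only [dist, pseudorandomGame_distinguisher hδ hlen h]
  have hwfin : ∀ random second, 2 * ((A.rounds.eval lam : ℕ) : ℝ≥0∞) *
      P.robustGame δ (P.attacker h A random second) lam true ≠ ⊤ := fun random second =>
    ENNReal.mul_ne_top (ENNReal.mul_ne_top (by simp) (by simp)) (PMF.apply_ne_top _ _)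
  have hwins : ∀ random second, (P.expectedWins δ k t A lam random second).toReal ≤
      2 * q * rob random second := fun random second => by
    have := ENNReal.toReal_mono (hwfin random second) (expectedWins_le h random second)
    simpa only [ENNReal.toReal_mul, ENNReal.toReal_ofNat, ENNReal.toReal_natCast] using this
  have hwfin' : ∀ random second, P.expectedWins δ k t A lam random second ≠ ⊤ :=
    fun random second => ne_top_of_le_ne_top (hwfin random second) (expectedWins_le h _ _)
  have hε : ∀ n : ℕ, (n : ℝ≥0∞) * (2 ^ lam : ℝ≥0∞)⁻¹ ≠ ⊤ := fun n =>
    ENNReal.mul_ne_top (by simp) (by simp)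
  have hok : ∀ random o, (P.outcomeProb δ k t A lam random [o]).toReal ≤
      ((P.cca δ k t).ccaGame δ A lam random o).toReal + (2 * q * rob random false +
        q * (2 ^ lam : ℝ)⁻¹) := fun random o => by
    have := ENNReal.toReal_mono (ENNReal.add_ne_top.2 ⟨PMF.apply_ne_top _ _,
      ENNReal.add_ne_top.2 ⟨hwfin' random false, hε _⟩⟩) (outcomeProb_ok_le hδ hlen htag random o)
    rw [ENNReal.toReal_add (PMF.apply_ne_top _ _) (ENNReal.add_ne_top.2 ⟨hwfin' random false, hε _⟩),
      ENNReal.toReal_add (hwfin' random false) (hε _)] at this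
    simp only [ENNReal.toReal_mul, ENNReal.toReal_inv, ENNReal.toReal_pow, ENNReal.toReal_ofNat,
      ENNReal.toReal_natCast] at this
    have := hwins random false
    simp only [q] at this ⊢
    linarith
  have hmatch : (P.outcomeProb δ k t A lam false abortMatch).toReal ≤
      2 * q * rob false false + 2 * q * rob false true := by
    have := ENNReal.toReal_mono (ENNReal.add_ne_top.2 ⟨hwfin' false false, hwfin' false true⟩)
      (outcomeProb_abortMatch_le (A := A) (lam := lam) hδ hlen)
    rw [ENNReal.toReal_add (hwfin' false false) (hwfin' false true)] at this
    linarith [hwins false false, hwins false true]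
  have hnonce : (P.outcomeProb δ k t A lam true abortNonce).toReal ≤
      q * (q * (2 ^ lam : ℝ)⁻¹) := by
    have := ENNReal.toReal_mono (ENNReal.mul_ne_top (by simp) (hε _))
      (outcomeProb_abortNonce_le (P := P) (δ := δ) (k := k) (t := t) (A := A) (lam := lam))
    simpa only [ENNReal.toReal_mul, ENNReal.toReal_inv, ENNReal.toReal_pow, ENNReal.toReal_ofNat,
      ENNReal.toReal_natCast] using this
  have hsum : ∀ random, (P.outcomeProb δ k t A lam random [true]).toReal +
      (P.outcomeProb δ k t A lam random [false]).toReal +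
      (P.outcomeProb δ k t A lam random abortNonce).toReal +
      (P.outcomeProb δ k t A lam random abortMatch).toReal = 1 := fun random => by
    rw [← ENNReal.toReal_add, ← ENNReal.toReal_add, ← ENNReal.toReal_add, outcomeProb_sum,
      ENNReal.toReal_one] <;> simp [hfin]
  obtain ⟨h1, h1'⟩ := abs_le.1 (hdist [true]).le
  obtain ⟨h2, h2'⟩ := abs_le.1 (hdist abortNonce).le
  obtain ⟨h3, h3'⟩ := abs_le.1 (hdist abortMatch).le
  -- Both bounds compare the game with output `1` in one world to the complement of output `0` in
  -- the other. If the real game is larger, the aborts of the real simulation enter and its nonce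
  -- aborts are moved to the random world; if the random game is larger, the match aborts of the
  -- random simulation are moved to the real one. The coefficient `4` combines the decoding loss of
  -- the real world with its first attack on double matches.
  rw [abs_le]
  constructor
  · linarith [hgame false, hgame true, hok false true, hok false false, hok true true,
      hok true false, hsum false, hsum true]
  · linarith [hgame false, hgame true, hok false true, hok false false, hok true true,
      hok true false, hsum false, hsum true]

theorem mainTheorem7 (P : PRC) (δ : ℝ) (msgLen tagLen : ℕ → ℕ)
    (hδ : 0 ≤ δ)
    (hP : P.Efficient)
    (hpseudorandom : P.Pseudorandom)
    (hrobust : P.AdaptivelyRobust δ)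
    (hlen : ∀ lam : ℕ, P.msgLen lam = lam + msgLen lam + tagLen lam)
    (htag : ∀ lam : ℕ, lam ≤ tagLen lam)
    (hmsgLen : LengthComputable msgLen)
    (htagLen : LengthComputable tagLen)
    (hthreshold : LengthComputable fun lam => ⌊δ * (P.codeLen lam : ℝ)⌋₊) :
    (P.cca δ msgLen tagLen).CCASecure δ := by
  intro A
  obtain ⟨W, h⟩ := PRC.exists_simEfficient hP hmsgLen.pf htagLen.pf
    (θ := P.radius δ) hthreshold.pf
  have hc : ∀ {f : ℕ → ℝ} (c : ℝ), Negligible f → Negligible fun lam => c * f lam := fun c hf =>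
    Asymptotics.SuperpolynomialDecay.const_mul hf c
  refine Negligible.of_abs_le ?_ fun lam =>
    (abs_abs _).trans_le (PRC.cca_advantage_le (A := A) (lam := lam) hδ hlen htag h)
  exact ((((((((hpseudorandom _).add (hpseudorandom _)).add (hpseudorandom _)).add
    ((hc 4 (hrobust _)).eval_mul _)).add ((hc 2 (hrobust _)).eval_mul _)).add
    ((hc 2 (hrobust _)).eval_mul _)).add ((hc 2 negligible_two_pow_inv).eval_mul _)).add
    ((negligible_two_pow_inv.eval_mul _).eval_mul _))
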